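/- **Theorem.** Let $T\in\mathbb Z^{d\times m}$, $W\in\mathbb Z^{d\times n}$, $C\in\mathbb Z^{s\times m}$, $D\in\mathbb Z^{s\times n}$ be fixed integer matrices; let $c_j$ and $d_j$ denote the $j$-th rows of $C$ and $D$. For a number $N$ of scenarios, right-hand sides $b^{(i)}\in\mathbb Z^d$ and bounds $u_x\in\mathbb Z^m$, $u_y^{(i)}\in\mathbb Z^n$ ($i=1,\dots,N$), consider the two-stage stochastic convex integer program $$\min\Big\{\sum_{i=1}^N f^{(i)}(x,y^{(i)}) : Tx+Wy^{(i)}=b^{(i)},\ 0\le x\le u_x,\ 0\le y^{(i)}\le u_y^{(i)},\ x\in\mathbb Z^m,\ y^{(i)}\in\mathbb Z^n,\ i=1,\dots,N\Big\},$$ where $f^{(i)}(x,y)=\sum_{j=1}^s f^{(i)}_j\big(c_j^\intercal x+d_j^\intercal y\big)$ with convex functions $f^{(i)}_j:\mathbb R\to\mathbb R$. (a) There is an algorithm that, in time polynomial in $N$ and in the encoding length of $b,u_x,u_y$, constructs a feasible solution $z_0$ of this program, or reports that there is none. (b) There is an algorithm that, given the data, a feasible solution $z_0$ (such as the one from (a))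 and polynomial-time evaluation oracles for the functions $f^{(i)}$ on integer points, augments $z_0$ to optimality whenever all $f^{(i)}$ are splittable: it outputs a finite sequence of feasible solutions that starts with $z_0$, has strictly decreasing objective values, and ends with an optimal solution. Its running time is polynomial in the encoding length $L$ of the input data (which comprises $N,b,u_x,u_y$ and the description of the functions), where the polynomial depends only on $T,W,C,D$, on the polynomial that bounds the time and the answer length of the oracles in terms of $L$ and the query length, and on the polynomial in the definition of splittable. Here a convex function $f:\mathbb R^{m+n}\to\mathbb R$ that maps $\mathbb Z^{m+n}$ to $\mathbb Z$ is *splittable* if for all $x\in\mathbb Z^m$, $y,g_1,g_2\in\mathbb Z^n$ and every finite interval $[l,u]\subseteq\mathbb R$ there are polynomially many (in the encoding length of the data, that is, of the input and of $x,y,g_1,g_2,\lfloor l\rfloor,\lceil u\rceil$) intervals $I_1,\dots,I_r$ such that $[l,u]=\bigcup_j I_j$, $I_i\cap I_j\cap\mathbb Z=\emptyset$ for $i\ne j$, and for each $j$ either $f(x,y+\alpha g_1)\le f(x,y+\alpha g_2)$ for all $\alpha\in I_j$, or $f(x,y+\alpha g_1)\ge f(x,y+\alpha g_2)$ for all $\alpha\in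 I_j$. (For example, convex polynomials of fixed maximal degree that map integer points to integers are splittable.) -/

import Mathlib

/-!
The machine model: a structured while-language over binary trees with integer leaves
(a Lisp-like random access model).  A program is a finite object; integers are of arbitrary size but
every elementary operation is charged at least the bit size of the whole value it works on, so that
running times are polynomially related to those of (oracle) Turing machines.
-/

/-- Values a program works on: binary trees whose leaves are integers. -/
inductive Val : Type
  | num (z : ℤ) : Val
  | pair (a b : Val) : Val

namespace Val

/-- Encoding length: binary length of the integers (with a sign bit) plus one per inner node. -/
def size : Val → ℕ
  | num z => 1 + Nat.size z.natAbs
  | pair a b => 1 + a.size + b.size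

def fst : Val → Val
  | num _ => num 0
  | pair a _ => a

def snd : Val → Val
  | num _ => num 0
  | pair _ b => b

/-- `1` on an inner node, `0` on a leaf. -/
def isPair : Val → Val
  | num _ => num 0
  | pair _ _ => num 1

/-- A binary integer operation on a pair of integer leaves; anything else is sent to `0`. -/
def arith (op : ℤ → ℤ → ℤ) : Val → Val
  | pair (num a) (num b) => num (op a b)
  | _ => num 0

/-- The branching condition: the value is a positive integer. -/
def IsPos : Val → Prop
  | num z => 0 < z
  | pair _ _ => False

/-- Lists are right-nested pairs that end in the leaf `0`. -/
def ofList : List Val → Val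
  | [] => num 0
  | a :: l => pair a (ofList l)

/-- Integer vectors are encoded as the list of their entries. -/
def ofVec {k : ℕ} (v : Fin k → ℤ) : Val :=
  ofList (List.ofFn fun i => num (v i))

end Val

/-- Programs.  Each program transforms one value into another. -/
inductive Prog : Type
  | id : Prog
  | const (c : Val) : Prog
  | fst : Prog
  | snd : Prog
  | isPair : Prog
  | add : Prog
  | sub : Prog
  | mul : Prog
  /-- query the oracle on the current value -/
  | query : Prog
  /-- run `p` and `q` on the current value and pair the results -/
  | pair (p q : Prog) : Prog
  /-- run `p`, then `q` on its result -/
  | seq (p q : Prog) : Prog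
  /-- if `c` returns a positive integer on the current value then `p`, else `q` -/
  | ite (c p q : Prog) : Prog
  /-- as long as `c` returns a positive integer on the current value, replace that by the
  result of `p` -/
  | loop (c p : Prog) : Prog

/-- An integer-valued oracle, with the time that it takes to answer. -/
structure Oracle : Type where
  answer : Val → ℤ
  time : Val → ℕ

/-- The trivial oracle, for programs that run without one. -/
def Oracle.trivial : Oracle where
  answer := fun _ => 0
  time := fun _ => 0

/-- `Runs O p v w t`: with oracle `O`, the program `p` started on `v` halts with result `w` after
time `t`.  Multiplication is charged quadratically, an oracle call is charged the lengths of the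
question and of the answer and the time of the oracle, and every other operation is charged the
length of the value it is applied to. -/
inductive Runs (O : Oracle) : Prog → Val → Val → ℕ → Prop
  | id (v : Val) : Runs O .id v v (1 + v.size)
  | const (c v : Val) : Runs O (.const c) v c (1 + v.size + c.size)
  | fst (v : Val) : Runs O .fst v v.fst (1 + v.size)
  | snd (v : Val) : Runs O .snd v v.snd (1 + v.size)
  | isPair (v : Val) : Runs O .isPair v v.isPair (1 + v.size)
  | add (v : Val) : Runs O .add v (v.arith (· + ·)) (1 + v.size)
  | sub (v : Val) : Runs O .sub v (v.arith (· - ·)) (1 + v.size)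
  | mul (v : Val) : Runs O .mul v (v.arith (· * ·)) ((1 + v.size) ^ 2)
  | query (v : Val) : Runs O .query v (.num (O.answer v))
      (1 + v.size + (Val.num (O.answer v)).size + O.time v)
  | pair {p q : Prog} {v a b : Val} {t t' : ℕ} (hp : Runs O p v a t) (hq : Runs O q v b t') :
      Runs O (.pair p q) v (.pair a b) (1 + v.size + t + t')
  | seq {p q : Prog} {v a b : Val} {t t' : ℕ} (hp : Runs O p v a t) (hq : Runs O q a b t') :
      Runs O (.seq p q) v b (1 + v.size + t + t')
  | ite_pos {c p q : Prog} {v a b : Val} {t t' : ℕ} (hc : Runs O c v a t) (ha : a.IsPos)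
      (hp : Runs O p v b t') : Runs O (.ite c p q) v b (1 + v.size + t + t')
  | ite_neg {c p q : Prog} {v a b : Val} {t t' : ℕ} (hc : Runs O c v a t) (ha : ¬ a.IsPos)
      (hq : Runs O q v b t') : Runs O (.ite c p q) v b (1 + v.size + t + t')
  | loop_stop {c p : Prog} {v a : Val} {t : ℕ} (hc : Runs O c v a t) (ha : ¬ a.IsPos) :
      Runs O (.loop c p) v v (1 + v.size + t)
  | loop_step {c p : Prog} {v a v' w : Val} {t t' t'' : ℕ} (hc : Runs O c v a t) (ha : a.IsPos)
      (hp : Runs O p v v' t') (hl : Runs O (.loop c p) v' w t'') :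
      Runs O (.loop c p) v w (1 + v.size + t + t' + t'')

/-- The numerical data of an `N`-scenario two-stage problem: right-hand sides `b i`, upper bounds
`ux` on the first-stage variables and `uy i` on the second-stage variables of scenario `i`. -/
structure TwoStageData (d m n : ℕ) : Type where
  N : ℕ
  b : Fin N → Fin d → ℤ
  ux : Fin m → ℤ
  uy : Fin N → Fin n → ℤ

/-- An integer point `(x, y 0, …, y (N-1))`. -/
structure TwoStagePoint (m n N : ℕ) : Type where
  x : Fin m → ℤ
  y : Fin N → Fin n → ℤ

namespace TwoStageData

variable {d m n : ℕ}

/-- The input of the algorithms: the pair of `ux` and the list of all `(b i, uy i)`. -/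
def encode (I : TwoStageData d m n) : Val :=
  .pair (.ofVec I.ux) (.ofList (List.ofFn fun i => .pair (.ofVec (I.b i)) (.ofVec (I.uy i))))

/-- `T x + W y i = b i`, `0 ≤ x ≤ ux` and `0 ≤ y i ≤ uy i` for all scenarios `i`. -/
def Feasible (T : Matrix (Fin d) (Fin m) ℤ) (W : Matrix (Fin d) (Fin n) ℤ)
    (I : TwoStageData d m n) (z : TwoStagePoint m n I.N) : Prop :=
  (0 ≤ z.x ∧ z.x ≤ I.ux) ∧
    ∀ i, T.mulVec z.x + W.mulVec (z.y i) = I.b i ∧ 0 ≤ z.y i ∧ z.y i ≤ I.uy i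

end TwoStageData

/-- The pair of `x` and the list of all `y i`. -/
def TwoStagePoint.encode {m n N : ℕ} (z : TwoStagePoint m n N) : Val :=
  .pair (.ofVec z.x) (.ofList (List.ofFn fun i => .ofVec (z.y i)))

/-- An integer vector as a real vector. -/
def realVec {k : ℕ} (v : Fin k → ℤ) : Fin k → ℝ := fun i => (v i : ℝ)

/-- The function `(x, y) ↦ ∑ j, F j (c_j ᵀ x + d_j ᵀ y)` on `ℝ^m × ℝ^n`, where `c_j` and `d_j` are
the rows of `C` and `D`. -/
noncomputable def scenarioCost {m n s : ℕ} (C : Matrix (Fin s) (Fin m) ℤ)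
    (D : Matrix (Fin s) (Fin n) ℤ) (F : Fin s → ℝ → ℝ) (q : (Fin m → ℝ) × (Fin n → ℝ)) : ℝ :=
  ∑ j, F j (∑ k, (C j k : ℝ) * q.1 k + ∑ k, (D j k : ℝ) * q.2 k)

/-- The sum over all scenarios `i` of the cost `f i` at `(x, y i)`. -/
noncomputable def totalCost {m n N : ℕ} (f : Fin N → (Fin m → ℝ) × (Fin n → ℝ) → ℝ)
    (z : TwoStagePoint m n N) : ℝ :=
  ∑ i, f i (realVec z.x, realVec (z.y i))

/-- `z` is an optimal solution of the minimization problem. -/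
def IsOptimal {d m n : ℕ} (T : Matrix (Fin d) (Fin m) ℤ) (W : Matrix (Fin d) (Fin n) ℤ)
    (I : TwoStageData d m n) (f : Fin I.N → (Fin m → ℝ) × (Fin n → ℝ) → ℝ)
    (z : TwoStagePoint m n I.N) : Prop :=
  I.Feasible T W z ∧ ∀ z', I.Feasible T W z' → totalCost f z ≤ totalCost f z'

/-- `path` is a sequence of feasible solutions that starts in `z₀`, in which every step strictly
improves the objective, and that ends in an optimal solution. -/
def AugmentsToOptimality {d m n : ℕ} (T : Matrix (Fin d) (Fin m) ℤ)
    (W : Matrix (Fin d) (Fin n) ℤ) (I : TwoStageData d m n)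
    (f : Fin I.N → (Fin m → ℝ) × (Fin n → ℝ) → ℝ) (z₀ : TwoStagePoint m n I.N)
    (path : List (TwoStagePoint m n I.N)) : Prop :=
  path.head? = some z₀ ∧
    (∀ z ∈ path, I.Feasible T W z) ∧
    path.IsChain (fun z z' => totalCost f z' < totalCost f z) ∧
    ∃ z, path.getLast? = some z ∧ IsOptimal T W I f z

/-- Splittable convex functions: `f` is convex, maps integer points to integers, and for all integer
vectors `x, y, g₁, g₂` every interval `[l, u]` is a union of `r` intervals, no two of which share an
integer, such that on each of them one of `f (x, y + α g₁)` and `f (x, y + α g₂)` is at most the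
other for all `α`.  Here `r` is bounded by the polynomial `p` in the encoding lengths of the problem
data (`L`) and of `x, y, g₁, g₂` and `l, u` (rounded outwards). -/
def Splittable {m n : ℕ} (p : Polynomial ℕ) (L : ℕ)
    (f : (Fin m → ℝ) × (Fin n → ℝ) → ℝ) : Prop :=
  ConvexOn ℝ Set.univ f ∧
    (∀ (x : Fin m → ℤ) (y : Fin n → ℤ), ∃ k : ℤ, f (realVec x, realVec y) = k) ∧
    ∀ (x : Fin m → ℤ) (y g₁ g₂ : Fin n → ℤ) (l u : ℝ),
      ∃ (r : ℕ) (J : Fin r → Set ℝ),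
        r ≤ p.eval (L + (Val.ofVec x).size + (Val.ofVec y).size + (Val.ofVec g₁).size +
          (Val.ofVec g₂).size + (Val.num ⌊l⌋).size + (Val.num ⌈u⌉).size) ∧
        (∀ j, (J j).OrdConnected) ∧
        Set.Icc l u = ⋃ j, J j ∧
        (∀ i j, i ≠ j → J i ∩ J j ∩ Set.range ((↑) : ℤ → ℝ) = ∅) ∧
        ∀ j,
          (∀ α ∈ J j, f (realVec x, realVec y + α • realVec g₁) ≤
            f (realVec x, realVec y + α • realVec g₂)) ∨
          (∀ α ∈ J j, f (realVec x, realVec y + α • realVec g₂) ≤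
            f (realVec x, realVec y + α • realVec g₁))

/-- The question for the value of the cost function of scenario `i` at the integer point
`(x, y)`. -/
def evalQuery {m n N : ℕ} (i : Fin N) (x : Fin m → ℤ) (y : Fin n → ℤ) : Val :=
  .pair (.num (i : ℕ)) (.pair (.ofVec x) (.ofVec y))

/-- `O` is an evaluation oracle for the functions `f i` on integer points, with answers whose length
and whose time are bounded by the polynomial `q` in the encoding lengths of the problem data (`L`)
and of the question. -/
def IsEvalOracle {m n N : ℕ} (q : Polynomial ℕ) (L : ℕ)
    (f : Fin N → (Fin m → ℝ) × (Fin n → ℝ) → ℝ) (O : Oracle) : Prop :=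
  ∀ (i : Fin N) (x : Fin m → ℤ) (y : Fin n → ℤ),
    (O.answer (evalQuery i x y) : ℝ) = f i (realVec x, realVec y) ∧
      (Val.num (O.answer (evalQuery i x y))).size + O.time (evalQuery i x y) ≤
        q.eval (L + (evalQuery i x y).size)

/-! ### Polynomially bounded families -/

/-! The difference of two feasible points is a vector `(u, w 1, …, w N)` with `T u + W (w i) = 0`
for all `i`. To each block `(u, w i)` the entries of `C u + D (w i)` are adjoined, and vectors are
compared conformally, that is, with compatible signs and smaller absolute values. The crucial
finiteness result, `exists_moves`, is that a finite list of first-stage vectors, each with a finite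
list of second-stage vectors, suffices for all `N` at once: below every nonzero kernel vector lies a
nonzero one assembled from a single first-stage entry of the list and its second-stage vectors. It
rests on Maclagan's theorem (`exists_finset_upper_basis`), which follows from Dickson's and Higman's
lemmas.

A kernel vector is decomposed by subtracting such a move, multiplied by the largest power of two
that keeps it conformal. Each subtraction deletes a binary digit of some entry, so the number of
steps is at most the number `Φ` of digits. The cost is separable convex in the adjoined entries,
hence the gains of conformal steps taken separately from the current point add up to at least the
gain of their sum (`totalCost_shift_add`, `totalCost_le_shift`). Therefore the best dyadic step
closes at least the `Φ`-th part of the gap to any feasible point (`gap_le`). After polynomially many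
strict improvements no improvement remains, and then the gap is zero
(`length_le_of_geometric_decrease`, `iterate_count_le`).

The best step is easy to find: once the move and its length are fixed, the first-stage vector is
known and the scenarios decouple, so each one picks the cheapest admissible vector of a constant
list by cost evaluations (`stepCand_le`).

For feasibility, slack variables with coefficients `1` and `-1` give an obvious starting point, and
their sum is minimized by the same algorithm. This linear cost is computed by a program, so no
oracle is needed.

Running times are handled for whole families of instances: `Comp` expresses a time bound by one
polynomial over the family, and each program construct has a rule for it. Families over dependent
pairs express uniformity over scenarios and loop rounds. -/

instance : DecidablePred Val.IsPos := fun v => by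
  cases v <;> unfold Val.IsPos <;> infer_instance

theorem Nat.size_add_le (a b : ℕ) : Nat.size (a + b) ≤ Nat.size a + Nat.size b := by
  rcases Nat.eq_zero_or_pos a with rfl | ha
  · simp
  rcases Nat.eq_zero_or_pos b with rfl | hb
  · simp
  have h1 : 0 < Nat.size a := Nat.size_pos.2 ha
  have h2 : 0 < Nat.size b := Nat.size_pos.2 hb
  rw [Nat.size_le, pow_add]
  have h3 := Nat.lt_size_self a
  have h4 := Nat.lt_size_self b
  have h5 : 2 ^ 1 ≤ 2 ^ Nat.size a := Nat.pow_le_pow_right (by norm_num) h1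
  have h6 : 2 ^ 1 ≤ 2 ^ Nat.size b := Nat.pow_le_pow_right (by norm_num) h2
  nlinarith

theorem Nat.size_mul_le (a b : ℕ) : Nat.size (a * b) ≤ Nat.size a + Nat.size b := by
  rw [Nat.size_le, pow_add]
  exact Nat.mul_lt_mul'' (Nat.lt_size_self a) (Nat.lt_size_self b)

theorem Nat.size_le_self (a : ℕ) : Nat.size a ≤ a := Nat.size_le.2 Nat.lt_two_pow_self

theorem Nat.size_sum_le {ι : Type*} (s : Finset ι) (f : ι → ℕ) :
    Nat.size (∑ i ∈ s, f i) ≤ ∑ i ∈ s, Nat.size (f i) := by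
  classical
  induction s using Finset.induction_on with
  | empty => simp
  | insert a s ha ih =>
    rw [Finset.sum_insert ha, Finset.sum_insert ha]
    exact (Nat.size_add_le _ _).trans (by omega)

theorem Polynomial.eval_nat_mono (P : Polynomial ℕ) : Monotone fun x => P.eval x := by
  intro a b h
  simp only [Polynomial.eval_eq_sum_range]
  exact Finset.sum_le_sum fun i _ => Nat.mul_le_mul_left _ (Nat.pow_le_pow_left h i)

/-- `f` is bounded by a polynomial in `L`. -/
def PolyBdd {S : Type} (L f : S → ℕ) : Prop := ∃ P : Polynomial ℕ, ∀ s, f s ≤ P.eval (L s)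

namespace PolyBdd

variable {S : Type} {L f g : S → ℕ}

theorem mono (hg : PolyBdd L g) (h : ∀ s, f s ≤ g s) : PolyBdd L f :=
  hg.imp fun _ hP s => (h s).trans (hP s)

theorem const (c : ℕ) : PolyBdd L fun _ => c := ⟨Polynomial.C c, fun s => by simp⟩

theorem self : PolyBdd L L := ⟨Polynomial.X, fun s => by simp⟩

theorem add (hf : PolyBdd L f) (hg : PolyBdd L g) : PolyBdd L fun s => f s + g s := by
  obtain ⟨P, hP⟩ := hf
  obtain ⟨Q, hQ⟩ := hg
  exact ⟨P + Q, fun s => by simpa using Nat.add_le_add (hP s) (hQ s)⟩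

theorem mul (hf : PolyBdd L f) (hg : PolyBdd L g) : PolyBdd L fun s => f s * g s := by
  obtain ⟨P, hP⟩ := hf
  obtain ⟨Q, hQ⟩ := hg
  exact ⟨P * Q, fun s => by simpa using Nat.mul_le_mul (hP s) (hQ s)⟩

theorem pow (hf : PolyBdd L f) (n : ℕ) : PolyBdd L fun s => f s ^ n := by
  obtain ⟨P, hP⟩ := hf
  exact ⟨P ^ n, fun s => by simpa using Nat.pow_le_pow_left (hP s) n⟩

theorem eval (hf : PolyBdd L f) (Q : Polynomial ℕ) : PolyBdd L fun s => Q.eval (f s) := by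
  obtain ⟨P, hP⟩ := hf
  exact ⟨Q.comp P, fun s => by simpa using Q.eval_nat_mono (hP s)⟩

theorem comap {S' : Type} (φ : S' → S) (hf : PolyBdd L f) :
    PolyBdd (fun s => L (φ s)) fun s => f (φ s) :=
  hf.imp fun _ hP _ => hP _

/-- The bound on the summands must not depend on the index, hence the family over all pairs of an
instance and an index. The same device is used for all loops. -/
theorem sum_fin {N : S → ℕ} {f : (s : S) → Fin (N s) → ℕ} (hN : PolyBdd L N)
    (hf : PolyBdd (fun x : Σ s, Fin (N s) => L x.1) fun x => f x.1 x.2) :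
    PolyBdd L fun s => ∑ i, f s i := by
  obtain ⟨P, hP⟩ := hN
  obtain ⟨Q, hQ⟩ := hf
  refine ⟨P * Q, fun s => ?_⟩
  calc ∑ i, f s i ≤ ∑ _i : Fin (N s), Q.eval (L s) := Finset.sum_le_sum fun i _ => hQ ⟨s, i⟩
    _ = N s * Q.eval (L s) := by simp
    _ ≤ _ := by rw [Polynomial.eval_mul]; exact Nat.mul_le_mul_right _ (hP s)

end PolyBdd

/-- The values `v s` have size polynomial in `L`. -/
def PolySize {S : Type} (L : S → ℕ) (v : S → Val) : Prop := PolyBdd L fun s => (v s).size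

namespace PolySize

variable {S : Type} {L : S → ℕ} {v w : S → Val}

theorem const (c : Val) : PolySize L fun _ => c := PolyBdd.const _

theorem pair (hv : PolySize L v) (hw : PolySize L w) : PolySize L fun s => .pair (v s) (w s) :=
  ((PolyBdd.const 1).add hv).add hw

theorem left (h : PolySize L fun s => .pair (v s) (w s)) : PolySize L v :=
  h.mono fun s => by simp only [Val.size]; omega

theorem right (h : PolySize L fun s => .pair (v s) (w s)) : PolySize L w :=
  h.mono fun s => by simp only [Val.size]; omega

theorem num {z : S → ℤ} (h : PolyBdd L fun s => Nat.size (z s).natAbs) :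
    PolySize L fun s => .num (z s) :=
  (PolyBdd.const 1).add h

theorem natAbs {z : S → ℤ} (h : PolySize L fun s => .num (z s)) :
    PolyBdd L fun s => Nat.size (z s).natAbs :=
  h.mono fun s => by simp only [Val.size]; omega

theorem comap {S' : Type} (φ : S' → S) (h : PolySize L v) :
    PolySize (fun s => L (φ s)) fun s => v (φ s) :=
  PolyBdd.comap φ h

end PolySize

namespace Val

theorem size_ofList (l : List Val) : (ofList l).size = 1 + (l.map fun a => 1 + a.size).sum := by
  induction l with
  | nil => simp [ofList, size]
  | cons a l ih => simp only [ofList, size, ih, List.map_cons, List.sum_cons]; omega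

theorem size_ofList_ofFn {N : ℕ} (a : Fin N → Val) :
    (ofList (List.ofFn a)).size = 1 + ∑ i, (1 + (a i).size) := by
  rw [size_ofList, List.map_ofFn, List.sum_ofFn]; rfl

theorem size_ofList_le_of_sublist {l l' : List Val} (h : l.Sublist l') :
    (ofList l).size ≤ (ofList l').size := by
  rw [size_ofList, size_ofList]
  exact Nat.add_le_add_left (List.Sublist.sum_le_sum (h.map _) fun _ _ => Nat.zero_le _) 1

theorem size_ofList_reverse (l : List Val) : (ofList l.reverse).size = (ofList l).size := by
  rw [size_ofList, size_ofList, List.map_reverse, List.sum_reverse]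

theorem ofVec_succ {k : ℕ} (v : Fin (k + 1) → ℤ) :
    ofVec v = .pair (.num (v 0)) (ofVec fun i => v i.succ) := by
  simp [ofVec, List.ofFn_succ, ofList]

theorem ofVec_zero (v : Fin 0 → ℤ) : ofVec v = .num 0 := by simp [ofVec, ofList]

end Val

namespace PolySize

variable {S : Type} {L : S → ℕ}

theorem ofFn {N : S → ℕ} {a : (s : S) → Fin (N s) → Val} (hN : PolyBdd L N)
    (ha : PolySize (fun x : Σ s, Fin (N s) => L x.1) fun x => a x.1 x.2) :
    PolySize L fun s => .ofList (List.ofFn (a s)) := by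
  refine (((PolyBdd.const 1).add (hN.sum_fin (f := fun s i => 1 + (a s i).size)
    ((PolyBdd.const 1).add ha)))).mono fun s => ?_
  rw [Val.size_ofList_ofFn]

theorem length {N : S → ℕ} {a : (s : S) → Fin (N s) → Val}
    (h : PolySize L fun s => .ofList (List.ofFn (a s))) : PolyBdd L N := by
  refine h.mono fun s => ?_
  rw [Val.size_ofList_ofFn, Finset.sum_add_distrib]
  simp; omega

theorem get {N : S → ℕ} {a : (s : S) → Fin (N s) → Val}
    (h : PolySize L fun s => .ofList (List.ofFn (a s))) :
    PolySize (fun x : Σ s, Fin (N s) => L x.1) fun x => a x.1 x.2 := by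
  refine (PolyBdd.comap (fun x : Σ s, Fin (N s) => x.1) h).mono fun x => ?_
  rw [Val.size_ofList_ofFn]
  have := Finset.single_le_sum (f := fun i => 1 + (a x.1 i).size) (fun _ _ => Nat.zero_le _)
    (Finset.mem_univ x.2)
  dsimp only
  omega

theorem ofVec {k : ℕ} {v : S → Fin k → ℤ}
    (h : ∀ i, PolyBdd L fun s => Nat.size (v s i).natAbs) : PolySize L fun s => .ofVec (v s) := by
  induction k with
  | zero => simpa only [Val.ofVec_zero] using const _
  | succ k ih =>
    simp only [Val.ofVec_succ]
    exact (num (h 0)).pair (ih fun i => h i.succ)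

theorem entry {k : ℕ} {v : S → Fin k → ℤ} (h : PolySize L fun s => .ofVec (v s)) (i : Fin k) :
    PolyBdd L fun s => Nat.size (v s i).natAbs := by
  have := (get (N := fun _ => k) (a := fun s i => .num (v s i)) h)
  exact (this.comap (fun s => ⟨s, i⟩)).natAbs

theorem sum_num {N : S → ℕ} {z : (s : S) → Fin (N s) → ℤ} (hN : PolyBdd L N)
    (hz : PolySize (fun x : Σ s, Fin (N s) => L x.1) fun x => .num (z x.1 x.2)) :
    PolySize L fun s => .num (∑ i, z s i) := by
  refine num ((hN.sum_fin (f := fun s i => Nat.size (z s i).natAbs) hz.natAbs).mono fun s => ?_)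
  exact (Nat.size_le_size (Int.natAbs_sum_le _ _)).trans (Nat.size_sum_le _ _)

end PolySize

/-! ### Programs that run in polynomial time on a family of inputs -/

/-- Every construct is charged at least the length of its argument, and the charge for arithmetic
also covers the length of the result. Thus a time bound yields all size bounds for free. -/
theorem Runs.size_le {O : Oracle} {p : Prog} {v w : Val} {t : ℕ} (h : Runs O p v w t) :
    v.size ≤ t ∧ w.size ≤ t := by
  have hmin : ∀ v : Val, 1 ≤ v.size := fun v => by
    cases v <;> (simp only [Val.size]; omega)
  have har : ∀ (op : ℤ → ℤ → ℤ), (∀ a b, Nat.size (op a b).natAbs ≤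
      Nat.size a.natAbs + Nat.size b.natAbs) → ∀ v : Val, (v.arith op).size ≤ 1 + v.size := by
    intro op hop v
    rcases v with z | ⟨a | ⟨_, _⟩, b | ⟨_, _⟩⟩
    case pair.num.num => simp only [Val.arith, Val.size]; have := hop a b; omega
    all_goals simp [Val.arith, Val.size]
  induction h with
  | id v => omega
  | const c v => omega
  | fst v => rcases v with z | ⟨a, b⟩ <;> simp [Val.fst, Val.size]; omega
  | snd v => rcases v with z | ⟨a, b⟩ <;> simp [Val.snd, Val.size]; omega
  | isPair v =>
    rcases v with z | ⟨a, b⟩ <;> simp [Val.isPair, Val.size]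
    have := hmin a; omega
  | add v =>
    exact ⟨by omega, har _ (fun a b => (Nat.size_le_size (Int.natAbs_add_le a b)).trans
      (Nat.size_add_le _ _)) v⟩
  | sub v =>
    exact ⟨by omega, har _ (fun a b => (Nat.size_le_size (Int.natAbs_sub_le a b)).trans
      (Nat.size_add_le _ _)) v⟩
  | mul v =>
    have h1 := har (· * ·) (fun a b => by
      rw [Int.natAbs_mul]; exact Nat.size_mul_le _ _) v
    constructor <;> nlinarith
  | query v => omega
  | pair hp hq ih1 ih2 => simp only [Val.size]; omega
  | seq hp hq ih1 ih2 => omega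
  | ite_pos hc ha hp ih1 ih2 => omega
  | ite_neg hc ha hp ih1 ih2 => omega
  | loop_stop hc ha ih => omega
  | loop_step hc ha hp hl ih1 ih2 ih3 => omega

/-- A family of instances: each has a length and an oracle. -/
structure Ctx (S : Type) where
  len : S → ℕ
  orc : S → Oracle

/-- The family of instances obtained by reindexing. -/
def Ctx.comap {S S' : Type} (K : Ctx S) (φ : S' → S) : Ctx S' where
  len s := K.len (φ s)
  orc s := K.orc (φ s)

/-- The program `p` computes `out s` from `inp s` in time polynomial in the length of `s`. -/
def Comp {S : Type} (K : Ctx S) (p : Prog) (inp out : S → Val) : Prop :=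
  ∃ P : Polynomial ℕ, ∀ s, ∃ t ≤ P.eval (K.len s), Runs (K.orc s) p (inp s) (out s) t

namespace Comp

variable {S : Type} {K : Ctx S} {p q c : Prog} {inp out a b : S → Val}

theorem of_polyBdd (t : S → ℕ) (ht : PolyBdd K.len t)
    (h : ∀ s, Runs (K.orc s) p (inp s) (out s) (t s)) : Comp K p inp out :=
  ht.imp fun _ hP s => ⟨t s, hP s, h s⟩

theorem exists_time (h : Comp K p inp out) :
    ∃ t : S → ℕ, PolyBdd K.len t ∧ ∀ s, Runs (K.orc s) p (inp s) (out s) (t s) := by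
  obtain ⟨P, hP⟩ := h
  choose t ht using hP
  exact ⟨t, ⟨P, fun s => (ht s).1⟩, fun s => (ht s).2⟩

theorem comap {S' : Type} (φ : S' → S) (h : Comp K p inp out) :
    Comp (K.comap φ) p (fun s => inp (φ s)) fun s => out (φ s) :=
  h.imp fun _ hP s => hP (φ s)

theorem polySize_inp (h : Comp K p inp out) : PolySize K.len inp := by
  obtain ⟨t, ht, h⟩ := h.exists_time
  exact ht.mono fun s => (h s).size_le.1

theorem polySize_out (h : Comp K p inp out) : PolySize K.len out := by
  obtain ⟨t, ht, h⟩ := h.exists_time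
  exact ht.mono fun s => (h s).size_le.2

theorem seq (hp : Comp K p inp a) (hq : Comp K q a out) : Comp K (.seq p q) inp out := by
  have h := hp.polySize_inp
  obtain ⟨t, ht, hp⟩ := hp.exists_time
  obtain ⟨t', ht', hq⟩ := hq.exists_time
  exact of_polyBdd _ ((((PolyBdd.const 1).add h).add ht).add ht') fun s => .seq (hp s) (hq s)

theorem pair (hp : Comp K p inp a) (hq : Comp K q inp b) :
    Comp K (.pair p q) inp fun s => .pair (a s) (b s) := by
  have h := hp.polySize_inp
  obtain ⟨t, ht, hp⟩ := hp.exists_time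
  obtain ⟨t', ht', hq⟩ := hq.exists_time
  exact of_polyBdd _ ((((PolyBdd.const 1).add h).add ht).add ht') fun s => .pair (hp s) (hq s)

/-- Each branch is required to work only on the subfamily of instances that reach it, so the outcome
of the test is available when a branch is verified. -/
theorem ite (hc : Comp K c inp a)
    (hp : Comp (K.comap fun s : {s // (a s).IsPos} => s.1) p (fun s => inp s.1) fun s => out s.1)
    (hq : Comp (K.comap fun s : {s // ¬ (a s).IsPos} => s.1) q (fun s => inp s.1)
      fun s => out s.1) : Comp K (.ite c p q) inp out := by
  obtain ⟨P, hP⟩ : PolyBdd K.len fun s => (inp s).size := hc.polySize_inp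
  obtain ⟨P1, h1⟩ := hc
  obtain ⟨P2, h2⟩ := hp
  obtain ⟨P3, h3⟩ := hq
  refine ⟨1 + P + P1 + P2 + P3, fun s => ?_⟩
  simp only [Polynomial.eval_add, Polynomial.eval_one]
  have hs : (inp s).size ≤ _ := hP s
  obtain ⟨t, ht, hr⟩ := h1 s
  by_cases h : (a s).IsPos
  · obtain ⟨t', ht', hr'⟩ := h2 ⟨s, h⟩
    exact ⟨_, by simp only [Ctx.comap] at ht'; omega, .ite_pos hr h hr'⟩
  · obtain ⟨t', ht', hr'⟩ := h3 ⟨s, h⟩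
    exact ⟨_, by simp only [Ctx.comap] at ht'; omega, .ite_neg hr h hr'⟩

/-- The whole trace `st` is prescribed, and guard and body are bounded uniformly over its rounds.
Composing the bounds round by round would not stay polynomial. -/
theorem loop {st cv : S → ℕ → Val} {n : S → ℕ} (hn : PolyBdd K.len n)
    (hc : Comp (K.comap fun x : Σ s, Fin (n s + 1) => x.1) c (fun x => st x.1 x.2)
      fun x => cv x.1 x.2)
    (hpos : ∀ s, ∀ j < n s, (cv s j).IsPos) (hlast : ∀ s, ¬ (cv s (n s)).IsPos)
    (hp : Comp (K.comap fun x : Σ s, Fin (n s) => x.1) p (fun x => st x.1 x.2)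
      fun x => st x.1 (x.2 + 1)) :
    Comp K (.loop c p) (fun s => st s 0) fun s => st s (n s) := by
  obtain ⟨P, hP⟩ : PolyBdd _ _ := hc.polySize_inp
  obtain ⟨P1, h1⟩ := hc
  obtain ⟨P2, h2⟩ := hp
  obtain ⟨Q, hQ⟩ := hn
  refine ⟨(Q + 1) * (1 + P + P1 + P2), fun s => ?_⟩
  -- Induction on the number `k` of remaining rounds; the summand `1` pays for the final failing
  -- test.
  have key : ∀ k j, j + k = n s → ∃ t ≤ (k + 1) * (1 + P + P1 + P2).eval (K.len s),
      Runs (K.orc s) (.loop c p) (st s j) (st s (n s)) t := by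
    intro k
    induction k with
    | zero =>
      intro j hj
      obtain rfl : j = n s := by omega
      obtain ⟨t, ht, hr⟩ := h1 ⟨s, ⟨n s, by omega⟩⟩
      have hs := hP ⟨s, ⟨n s, by omega⟩⟩
      refine ⟨_, ?_, Runs.loop_stop hr (hlast s)⟩
      simp only [Ctx.comap, Polynomial.eval_add, Polynomial.eval_one] at *
      omega
    | succ k ih =>
      intro j hj
      obtain ⟨t, ht, hr⟩ := h1 ⟨s, ⟨j, by omega⟩⟩
      have hs := hP ⟨s, ⟨j, by omega⟩⟩
      obtain ⟨t', ht', hr'⟩ := h2 ⟨s, ⟨j, by omega⟩⟩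
      obtain ⟨t'', ht'', hr''⟩ := ih (j + 1) (by omega)
      refine ⟨_, ?_, .loop_step hr (hpos s j (by omega)) hr' hr''⟩
      simp only [Ctx.comap, Polynomial.eval_add, Polynomial.eval_one] at *
      rw [add_mul (k + 1), one_mul]
      omega
  obtain ⟨t, ht, hr⟩ := key (n s) 0 (by omega)
  refine ⟨t, ht.trans ?_, hr⟩
  rw [Polynomial.eval_mul]
  refine Nat.mul_le_mul_right _ ?_
  simpa using hQ s

end Comp

/-! ### Straight-line programs -/

/-- Programs without loops and oracle queries. -/
def Prog.IsSL : Prog → Prop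
  | .query => False
  | .loop _ _ => False
  | .pair p q => p.IsSL ∧ q.IsSL
  | .seq p q => p.IsSL ∧ q.IsSL
  | .ite c p q => c.IsSL ∧ p.IsSL ∧ q.IsSL
  | _ => True

/-- The result of a straight-line program. -/
def Prog.eval : Prog → Val → Val
  | .id, v => v
  | .const c, _ => c
  | .fst, v => v.fst
  | .snd, v => v.snd
  | .isPair, v => v.isPair
  | .add, v => v.arith (· + ·)
  | .sub, v => v.arith (· - ·)
  | .mul, v => v.arith (· * ·)
  | .query, v => v
  | .pair p q, v => .pair (p.eval v) (q.eval v)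
  | .seq p q, v => q.eval (p.eval v)
  | .ite c p q, v => if (c.eval v).IsPos then p.eval v else q.eval v
  | .loop _ _, v => v

namespace Comp

/-- Without loops every construct is executed at most once, so polynomial size of the input is all
that is needed. Correctness of such code becomes an evaluation, often by `rfl`. -/
theorem sl_eval {p : Prog} (h : p.IsSL) {S : Type} {K : Ctx S} {inp : S → Val}
    (hi : PolySize K.len inp) : Comp K p inp fun s => p.eval (inp s) := by
  have h1 : PolyBdd K.len fun s => 1 + (inp s).size := (PolyBdd.const 1).add hi
  induction p generalizing S with
  | id => exact of_polyBdd _ h1 fun _ => .id _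
  | const c => exact of_polyBdd _ (h1.add (PolyBdd.const c.size)) fun s => .const c _
  | fst => exact of_polyBdd _ h1 fun s => .fst _
  | snd => exact of_polyBdd _ h1 fun s => .snd _
  | isPair => exact of_polyBdd _ h1 fun s => .isPair _
  | add => exact of_polyBdd _ h1 fun s => .add _
  | sub => exact of_polyBdd _ h1 fun s => .sub _
  | mul => exact of_polyBdd _ (h1.pow 2) fun s => .mul _
  | query => exact h.elim
  | pair p q ih1 ih2 => exact (ih1 h.1 hi h1).pair (ih2 h.2 hi h1)
  | seq p q ih1 ih2 =>
    have h2 := ih1 h.1 hi h1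
    exact h2.seq (ih2 h.2 h2.polySize_out ((PolyBdd.const 1).add h2.polySize_out))
  | ite c p q ih1 ih2 ih3 =>
    refine (ih1 h.1 hi h1).ite ?_ ?_
    · have h2 := ih2 h.2.1 (K := K.comap fun s : {s // (c.eval (inp s)).IsPos} => s.1)
        (hi.comap Subtype.val) (h1.comap Subtype.val)
      refine cast (congrArg (Comp _ _ _) (funext fun s => ?_)) h2
      simp [Prog.eval, s.2]
    · have h3 := ih3 h.2.2 (K := K.comap fun s : {s // ¬ (c.eval (inp s)).IsPos} => s.1)
        (hi.comap Subtype.val) (h1.comap Subtype.val)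
      refine cast (congrArg (Comp _ _ _) (funext fun s => ?_)) h3
      simp [Prog.eval, s.2]
  | loop => exact h.elim

theorem sl {S : Type} {K : Ctx S} {p : Prog} {inp out : S → Val} (h : p.IsSL)
    (hi : PolySize K.len inp) (ho : ∀ s, p.eval (inp s) = out s) : Comp K p inp out :=
  (funext ho : (fun s => p.eval (inp s)) = out) ▸ sl_eval h hi

theorem congr {S : Type} {K : Ctx S} {p : Prog} {inp out out' : S → Val} (h : Comp K p inp out)
    (ho : ∀ s, out s = out' s) : Comp K p inp out' := funext ho ▸ h

end Comp

/-! ### Finite bases of families of upper sets -/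

/-- If no finite subset sufficed, elements of `A` could be chosen one after the other, none above an
earlier one, which is a bad sequence. -/
theorem WellQuasiOrdered.exists_finset_basis {α : Type*} {r : α → α → Prop}
    (h : WellQuasiOrdered r) (A : Set α) :
    ∃ U : Finset α, ↑U ⊆ A ∧ ∀ a ∈ A, ∃ u ∈ U, r u a := by
  by_contra! hc
  obtain ⟨f, _, hf⟩ := exists_seq_of_forall_finset_exists (· ∈ A) (fun x y => ¬ r x y)
    fun s hs => hc s hs
  obtain ⟨m, n, hmn, hr⟩ := h f
  exact hf m n hmn hr

/-- A lower set of `ℕ ^ k` is a finite union of boxes. -/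
theorem exists_boxes {k : Type*} [Finite k] (M : Set (k → ℕ)) :
    ∃ l : List (k → WithTop ℕ), ∀ x : k → ℕ,
      (∀ p ∈ M, ¬ p ≤ x) ↔ ∃ b ∈ l, ∀ i, (x i : WithTop ℕ) ≤ b i := by
  classical
  -- By Dickson's lemma finitely many members of `M` decide avoidance.
  obtain ⟨U, hU, hU'⟩ := WellQuasiOrdered.exists_finset_basis
    (wellQuasiOrdered_le (α := k → ℕ)) M
  have hM : ∀ x, (∀ p ∈ M, ¬ p ≤ x) ↔ ∀ p ∈ U, ¬ p ≤ x := fun x =>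
    ⟨fun h p hp => h p (hU hp), fun h p hp hpx => by
      obtain ⟨u, hu, hup⟩ := hU' p hp
      exact h u hu (hup.trans hpx)⟩
  simp only [hM]
  clear hM hU hU'
  induction U using Finset.induction_on with
  | empty => exact ⟨[fun _ => ⊤], fun x => by simp⟩
  | insert p U hp ih =>
    obtain ⟨l, hl⟩ := ih
    have := Fintype.ofFinite k
    -- Avoiding `p` means `x i ≤ p i - 1` for some `i` with `0 < p i`; every old box is cut in this
    -- way in each such direction. For `p = 0` no box remains.
    refine ⟨(Finset.univ.filter fun i => 0 < p i).toList.flatMap fun i =>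
      l.map fun b => Function.update b i (min (b i) ((p i - 1 : ℕ) : WithTop ℕ)), fun x => ?_⟩
    simp only [Finset.mem_insert, forall_eq_or_imp, hl, List.mem_flatMap, List.mem_map,
      Finset.mem_toList, Finset.mem_filter, Finset.mem_univ, true_and]
    constructor
    · rintro ⟨hpx, b, hb, hxb⟩
      obtain ⟨i, hi⟩ : ∃ i, x i < p i := by
        by_contra! h
        exact hpx h
      refine ⟨_, ⟨i, by omega, b, hb, rfl⟩, fun j => ?_⟩
      rcases eq_or_ne j i with rfl | hj
      · rw [Function.update_self]
        exact le_min (hxb j) (Nat.cast_le.2 (by omega))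
      · rw [Function.update_of_ne hj]
        exact hxb j
    · rintro ⟨_, ⟨i, hi, b, hb, rfl⟩, hx⟩
      have h1 := hx i
      rw [Function.update_self, le_min_iff] at h1
      refine ⟨fun hpx => ?_, b, hb, fun j => ?_⟩
      · have h2 : x i ≤ p i - 1 := Nat.cast_le.1 h1.2
        have h3 : p i ≤ x i := hpx i
        omega
      · rcases eq_or_ne j i with rfl | hj
        · exact h1.1
        · have := hx j
          rwa [Function.update_of_ne hj] at this

/-- **Maclagan's theorem**: among any family of subsets of `ℕ ^ k` finitely many generate upper sets
that contain all the others. -/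
theorem exists_finset_upper_basis {α k : Type*} [Finite k] (M : α → Set (k → ℕ)) (A : Set α) :
    ∃ U : Finset α, ↑U ⊆ A ∧ ∀ u ∈ A, ∃ v ∈ U, ∀ p ∈ M u, ∃ q ∈ M v, q ≤ p := by
  choose l hl using fun u => exists_boxes (M u)
  -- Higman's lemma for lists of boxes. If the boxes of `v` embed into those of `u`, then the
  -- complement of the upper set of `v` is contained in that of `u`, so the upper sets are contained
  -- the other way round.
  have hw : WellQuasiOrdered fun u v => List.SublistForall₂ (· ≤ ·) (l u) (l v) := by
    intro f
    have h1 := Set.PartiallyWellOrderedOn.partiallyWellOrderedOn_sublistForall₂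
      (α := k → WithTop ℕ) (· ≤ ·) (s := Set.univ)
      (Set.isPWO_of_wellQuasiOrderedLE _)
    exact h1 fun n => ⟨l (f n), fun _ _ => trivial⟩
  obtain ⟨U, hU, hU'⟩ := hw.exists_finset_basis A
  refine ⟨U, hU, fun u hu => ?_⟩
  obtain ⟨v, hv, hvu⟩ := hU' u hu
  refine ⟨v, hv, fun p hp => ?_⟩
  -- Otherwise `p` would lie in a box of `v`, hence in a box of `u`, and so avoid `M u`, to which it
  -- belongs.
  by_contra! hc
  obtain ⟨b, hb, hpb⟩ := (hl v p).1 hc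
  obtain ⟨l', hl', hsub⟩ := List.sublistForall₂_iff.1 hvu
  obtain ⟨b', hb', hbb⟩ : ∃ b' ∈ l', b ≤ b' := by
    clear hsub hvu
    generalize l v = lv at hl' hb
    induction hl' with
    | nil => simp at hb
    | cons hab _ ih =>
      rcases List.mem_cons.1 hb with rfl | hb
      · exact ⟨_, List.mem_cons_self, hab⟩
      · obtain ⟨b', h1, h2⟩ := ih hb
        exact ⟨b', List.mem_cons_of_mem _ h1, h2⟩
  exact (hl u p).2 ⟨b', hsub.subset hb', fun i => (hpb i).trans (hbb i)⟩ p hp le_rfl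

/-! ### Conformal vectors -/

/-- `a` and `b` have compatible signs and `|a| ≤ |b|`. -/
def Conf (a b : ℤ) : Prop := (0 ≤ a ∧ a ≤ b) ∨ (b ≤ a ∧ a ≤ 0)

section Conformal

variable {d m n s : ℕ} (T : Matrix (Fin d) (Fin m) ℤ) (W : Matrix (Fin d) (Fin n) ℤ)
  (C : Matrix (Fin s) (Fin m) ℤ) (D : Matrix (Fin s) (Fin n) ℤ)

/-- The entries of `x`, of `y` and of `C x + D y`. -/
def coords (x : Fin m → ℤ) (y : Fin n → ℤ) : Fin m ⊕ Fin n ⊕ Fin s → ℤ :=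
  Sum.elim x (Sum.elim y (C.mulVec x + D.mulVec y))

/-- The positive and the negative parts of `coords`. -/
def coordParts (x : Fin m → ℤ) (y : Fin n → ℤ) : (Fin m ⊕ Fin n ⊕ Fin s) × Bool → ℕ :=
  fun i => if i.2 then (coords C D x y i.1).toNat else (-coords C D x y i.1).toNat

/-- Splitting entries into positive and negative parts turns the conformal order into the product
order on natural vectors, where Dickson's and Maclagan's theorems apply. -/
theorem coordParts_le_iff {x x' : Fin m → ℤ} {y y' : Fin n → ℤ} :
    coordParts C D x y ≤ coordParts C D x' y' ↔
      ∀ i, Conf (coords C D x y i) (coords C D x' y' i) := by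
  constructor
  · intro h i
    have h1 := h (i, true)
    have h2 := h (i, false)
    simp only [coordParts, if_true, Bool.false_eq_true, if_false] at h1 h2
    unfold Conf; omega
  · rintro h ⟨i, _ | _⟩ <;> have := h i <;> unfold Conf at this <;>
      simp only [coordParts, if_true, Bool.false_eq_true, if_false] <;> omega

/-- The building blocks of the Graver bases of all two-stage matrices with blocks `T` and `W` form
a finite set. -/
theorem exists_moves : ∃ moves : List ((Fin m → ℤ) × List (Fin n → ℤ)),
    (∀ g ∈ moves, ∀ w ∈ g.2, T.mulVec g.1 + W.mulVec w = 0) ∧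
    ∀ (N : ℕ) (u : Fin m → ℤ) (w : Fin N → Fin n → ℤ), 0 < N →
      (∀ i, T.mulVec u + W.mulVec (w i) = 0) → (u ≠ 0 ∨ ∃ i, w i ≠ 0) →
      ∃ g ∈ moves, ∃ w' : Fin N → Fin n → ℤ, (∀ i, w' i ∈ g.2) ∧ (g.1 ≠ 0 ∨ ∃ i, w' i ≠ 0) ∧
        ∀ i j, Conf (coords C D g.1 (w' i) j) (coords C D u (w i) j) := by
  classical
  -- A first-stage vector is represented by the upper set that all its kernel completions generate.
  -- Comparing these sets, rather than single vectors, handles any number of scenarios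
  -- simultaneously.
  obtain ⟨U, hU, hU'⟩ := exists_finset_upper_basis
    (fun v : Fin m → ℤ => coordParts C D v '' {w | T.mulVec v + W.mulVec w = 0}) {v | v ≠ 0}
  -- For a fixed first-stage vector Dickson's lemma leaves finitely many completions.
  have hY : ∀ (v : Fin m → ℤ) (A : Set (Fin n → ℤ)), ∃ Y : Finset (Fin n → ℤ), ↑Y ⊆ A ∧
      ∀ w ∈ A, ∃ w' ∈ Y, coordParts C D v w' ≤ coordParts C D v w := fun v A =>
    WellQuasiOrdered.exists_finset_basis (α := Fin n → ℤ)
      (r := fun w' w => coordParts C D v w' ≤ coordParts C D v w)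
      (fun f => wellQuasiOrdered_le fun n => coordParts C D v (f n)) A
  choose Y hYsub hYbas using fun v => hY v {w | T.mulVec v + W.mulVec w = 0}
  -- For `u = 0` the completion `0` lies below all others and would give only the zero move, so a
  -- basis of the nonzero completions is taken; `0` is added to the list separately, for scenarios
  -- that do not move.
  obtain ⟨Y0, hY0, hY0'⟩ := hY 0 {w | W.mulVec w = 0 ∧ w ≠ 0}
  refine ⟨(0, 0 :: Y0.toList) :: U.toList.map fun v => (v, (Y v).toList), ?_, ?_⟩
  · intro g hg w hw
    rcases List.mem_cons.1 hg with rfl | hg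
    · rcases List.mem_cons.1 hw with rfl | hw
      · simp
      · simpa using (hY0 (Finset.mem_toList.1 hw)).1
    · obtain ⟨v, hv, rfl⟩ := List.mem_map.1 hg
      exact hYsub v (Finset.mem_toList.1 hw)
  · intro N u w hN hker hne
    by_cases hu : u = 0
    · subst hu
      have hex : ∃ i, w i ≠ 0 := by simpa using hne
      have hch : ∀ i, ∃ w' ∈ (0 : Fin n → ℤ) :: Y0.toList, (w i ≠ 0 → w' ≠ 0) ∧
          coordParts C D 0 w' ≤ coordParts C D 0 (w i) := by
        intro i
        by_cases hw : w i = 0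
        · exact ⟨0, List.mem_cons_self, fun h => (h hw).elim, by rw [hw]⟩
        · obtain ⟨w', h1, h2⟩ := hY0' (w i) ⟨by simpa using hker i, hw⟩
          exact ⟨w', List.mem_cons_of_mem _ (Finset.mem_toList.2 h1), fun _ => (hY0 h1).2, h2⟩
      choose w' h1 h2 h3 using hch
      obtain ⟨i, hi⟩ := hex
      exact ⟨_, List.mem_cons_self, w', h1, Or.inr ⟨i, h2 i hi⟩,
        fun i => (coordParts_le_iff C D).1 (h3 i)⟩
    · obtain ⟨v, hv, hvu⟩ := hU' u hu
      have hch : ∀ i, ∃ w' ∈ (Y v).toList, coordParts C D v w' ≤ coordParts C D u (w i) := by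
        intro i
        -- Two descents: from `(u, w i)` to a completion `w₁` of `v`, and from there to one in the
        -- finite list of `v`.
        obtain ⟨_, ⟨w₁, h1, rfl⟩, h2⟩ := hvu _ ⟨w i, hker i, rfl⟩
        obtain ⟨w', h3, h4⟩ := hYbas v w₁ h1
        exact ⟨w', Finset.mem_toList.2 h3, h4.trans h2⟩
      choose w' h1 h2 using hch
      exact ⟨_, List.mem_cons_of_mem _ (List.mem_map.2 ⟨v, Finset.mem_toList.2 hv, rfl⟩), w', h1,
        Or.inl (hU hv), fun i => (coordParts_le_iff C D).1 (h2 i)⟩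

end Conformal

/-! ### Augmentation by building blocks -/

/-- Both `a + h` and `a + (r - h)` are convex combinations of `a` and `a + r`, with the weights `1 -
h / r` and `h / r` interchanged. The two convexity inequalities add up to the claim. -/
theorem ConvexOn.add_le_add_of_conf {F : ℝ → ℝ} (hF : ConvexOn ℝ Set.univ F) (a : ℤ) {h r : ℤ}
    (hr : Conf h r) : F (a + h : ℤ) + F (a + (r - h) : ℤ) ≤ F a + F (a + r : ℤ) := by
  rcases eq_or_ne r 0 with rfl | hr0
  · obtain rfl : h = 0 := by unfold Conf at hr; omega
    simp
  have hr0' : (r : ℝ) ≠ 0 := by exact_mod_cast hr0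
  have ht0 : 0 ≤ (h : ℝ) / r := by
    rcases hr with h1 | h1
    · exact div_nonneg (by exact_mod_cast h1.1) (by exact_mod_cast h1.1.trans h1.2)
    · exact div_nonneg_of_nonpos (by exact_mod_cast h1.2) (by exact_mod_cast h1.1.trans h1.2)
  have ht1 : (h : ℝ) / r ≤ 1 := by
    rcases hr with h1 | h1
    · exact div_le_one_of_le₀ (by exact_mod_cast h1.2) (by exact_mod_cast h1.1.trans h1.2)
    · exact div_le_one_of_ge (by exact_mod_cast h1.1) (by exact_mod_cast h1.1.trans h1.2)
  have e1 := hF.2 (Set.mem_univ (a : ℝ)) (Set.mem_univ ((a + r : ℤ) : ℝ)) (sub_nonneg.2 ht1) ht0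
    (by ring)
  have e2 := hF.2 (Set.mem_univ (a : ℝ)) (Set.mem_univ ((a + r : ℤ) : ℝ)) ht0 (sub_nonneg.2 ht1)
    (by ring)
  have h1 : (1 - (h : ℝ) / r) • (a : ℝ) + ((h : ℝ) / r) • ((a + r : ℤ) : ℝ) = (a + h : ℤ) := by
    push_cast [smul_eq_mul]; field_simp; ring
  have h2 : ((h : ℝ) / r) • (a : ℝ) + (1 - (h : ℝ) / r) • ((a + r : ℤ) : ℝ) =
      (a + (r - h) : ℤ) := by
    push_cast [smul_eq_mul]; field_simp; ring
  rw [h1] at e1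
  rw [h2] at e2
  simp only [smul_eq_mul] at e1 e2
  linarith

theorem Nat.size_lt_size_of_two_mul_le {x a : ℕ} (h : 2 * x ≤ a) (ha : 0 < a) :
    Nat.size x < Nat.size a := by
  have h1 : 0 < Nat.size a := Nat.size_pos.2 ha
  have h2 := Nat.lt_size_self a
  obtain ⟨k, hk⟩ : ∃ k, Nat.size a = k + 1 := ⟨Nat.size a - 1, by omega⟩
  rw [hk, pow_succ] at h2
  have : Nat.size x ≤ k := Nat.size_le.2 (by omega)
  omega

/-- The point `z + (u, w)`. -/
def TwoStagePoint.shift {m n N : ℕ} (z : TwoStagePoint m n N) (u : Fin m → ℤ)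
    (w : Fin N → Fin n → ℤ) : TwoStagePoint m n N where
  x := z.x + u
  y i := z.y i + w i

section Augment

variable {d m n s : ℕ} {T : Matrix (Fin d) (Fin m) ℤ} {W : Matrix (Fin d) (Fin n) ℤ}
  {C : Matrix (Fin s) (Fin m) ℤ} {D : Matrix (Fin s) (Fin n) ℤ}

theorem coords_add (x x' : Fin m → ℤ) (y y' : Fin n → ℤ) (c) :
    coords C D (x + x') (y + y') c = coords C D x y c + coords C D x' y' c := by
  rcases c with c | c | c
  · rfl
  · rfl
  · simp only [coords, Sum.elim_inr, Matrix.mulVec_add, Pi.add_apply]; ring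

theorem coords_smul (a : ℤ) (x : Fin m → ℤ) (y : Fin n → ℤ) (c) :
    coords C D (a • x) (a • y) c = a * coords C D x y c := by
  rcases c with c | c | c
  · rfl
  · rfl
  · simp only [coords, Sum.elim_inr, Matrix.mulVec_smul, Pi.add_apply, Pi.smul_apply, smul_eq_mul]
    ring

theorem coords_sub (x x' : Fin m → ℤ) (y y' : Fin n → ℤ) (c) :
    coords C D (x - x') (y - y') c = coords C D x y c - coords C D x' y' c := by
  have := coords_add (C := C) (D := D) (x - x') x' (y - y') y' c
  simp only [sub_add_cancel] at this
  omega

theorem scenarioCost_realVec (F : Fin s → ℝ → ℝ) (x : Fin m → ℤ) (y : Fin n → ℤ) :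
    scenarioCost C D F (realVec x, realVec y) =
      ∑ j, F j (coords C D x y (.inr (.inr j)) : ℤ) := by
  simp only [scenarioCost, coords, Sum.elim_inr, realVec, Matrix.mulVec, dotProduct, Pi.add_apply]
  push_cast
  rfl

/-- The number of binary digits in the entries of `(u, w)`. -/
def digits (C : Matrix (Fin s) (Fin m) ℤ) (D : Matrix (Fin s) (Fin n) ℤ) {N : ℕ} (u : Fin m → ℤ)
    (w : Fin N → Fin n → ℤ) : ℕ :=
  ∑ i, ∑ c, Nat.size (coords C D u (w i) c).natAbs

/-- The arguments of the convex functions are the last block of `coords`. Since conformality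
includes this block, the one-dimensional inequality applies to each summand. -/
theorem totalCost_shift_add {N : ℕ} {F : Fin N → Fin s → ℝ → ℝ}
    (hF : ∀ i j, ConvexOn ℝ Set.univ (F i j)) (z : TwoStagePoint m n N) {u v : Fin m → ℤ}
    {w w' : Fin N → Fin n → ℤ}
    (h : ∀ i c, Conf (coords C D v (w' i) c) (coords C D u (w i) c)) :
    totalCost (fun i => scenarioCost C D (F i)) (z.shift v w') +
      totalCost (fun i => scenarioCost C D (F i)) (z.shift (u - v) (fun i => w i - w' i)) ≤
    totalCost (fun i => scenarioCost C D (F i)) z +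
      totalCost (fun i => scenarioCost C D (F i)) (z.shift u w) := by
  simp only [totalCost, ← Finset.sum_add_distrib, scenarioCost_realVec, TwoStagePoint.shift]
  refine Finset.sum_le_sum fun i _ => Finset.sum_le_sum fun j _ => ?_
  simp only [coords_add, coords_sub]
  exact (hF i j).add_le_add_of_conf _ (h i _)

/-- A move below `(u, w)` is doubled as often as it stays conformal and then split off. The
remainder has fewer binary digits, a step conformal to the remainder is conformal to `(u, w)`, and
by `totalCost_shift_add` the total gain is at most the sum of the two gains. So `δ`, a bound for the
gain of one dyadic step, is paid at most once per digit. -/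
theorem totalCost_le_shift {moves : List ((Fin m → ℤ) × List (Fin n → ℤ))}
    (hker : ∀ g ∈ moves, ∀ w ∈ g.2, T.mulVec g.1 + W.mulVec w = 0)
    (hmoves : ∀ (N : ℕ) (u : Fin m → ℤ) (w : Fin N → Fin n → ℤ), 0 < N →
      (∀ i, T.mulVec u + W.mulVec (w i) = 0) → (u ≠ 0 ∨ ∃ i, w i ≠ 0) →
      ∃ g ∈ moves, ∃ w' : Fin N → Fin n → ℤ, (∀ i, w' i ∈ g.2) ∧ (g.1 ≠ 0 ∨ ∃ i, w' i ≠ 0) ∧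
        ∀ i j, Conf (coords C D g.1 (w' i) j) (coords C D u (w i) j))
    {N : ℕ} (hN : 0 < N) {F : Fin N → Fin s → ℝ → ℝ} (hF : ∀ i j, ConvexOn ℝ Set.univ (F i j))
    (z : TwoStagePoint m n N) {δ : ℝ} (hδ : 0 ≤ δ) {u : Fin m → ℤ} {w : Fin N → Fin n → ℤ}
    (hz : ∀ i, T.mulVec u + W.mulVec (w i) = 0)
    (hstep : ∀ (k : ℕ), ∀ g ∈ moves, ∀ w' : Fin N → Fin n → ℤ, (∀ i, w' i ∈ g.2) →
      (g.1 ≠ 0 ∨ ∃ i, w' i ≠ 0) →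
      (∀ i c, Conf (2 ^ k * coords C D g.1 (w' i) c) (coords C D u (w i) c)) →
      totalCost (fun i => scenarioCost C D (F i)) z ≤
        totalCost (fun i => scenarioCost C D (F i))
          (z.shift ((2 : ℤ) ^ k • g.1) fun i => (2 : ℤ) ^ k • w' i) + δ) :
    totalCost (fun i => scenarioCost C D (F i)) z ≤
      totalCost (fun i => scenarioCost C D (F i)) (z.shift u w) + digits C D u w * δ := by
  obtain ⟨Φ, hΦ⟩ : ∃ Φ, digits C D u w = Φ := ⟨_, rfl⟩
  induction Φ using Nat.strong_induction_on generalizing u w with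
  | _ Φ ih =>
  by_cases hne : u ≠ 0 ∨ ∃ i, w i ≠ 0
  swap
  · push Not at hne
    have : z.shift u w = z := by
      simp [TwoStagePoint.shift, hne.1, hne.2]
    rw [this]
    have : 0 ≤ (digits C D u w : ℝ) * δ := by positivity
    linarith
  obtain ⟨g, hg, w', hw', hne', hconf⟩ := hmoves N u w hN hz hne
  -- a nonzero entry of the step
  obtain ⟨i₀, c₀, hc₀⟩ : ∃ i c, coords C D g.1 (w' i) c ≠ 0 := by
    rcases hne' with h | ⟨i, h⟩
    · obtain ⟨c, hc⟩ := Function.ne_iff.1 h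
      exact ⟨⟨0, hN⟩, .inl c, hc⟩
    · obtain ⟨c, hc⟩ := Function.ne_iff.1 h
      exact ⟨i, .inr (.inl c), hc⟩
  -- The largest admissible exponent. It exists because the multiples of the nonzero entry
  -- eventually exceed the corresponding entry of `(u, w)`.
  obtain ⟨k, hk, hk'⟩ : ∃ k : ℕ,
      (∀ i c, Conf (2 ^ k * coords C D g.1 (w' i) c) (coords C D u (w i) c)) ∧
      ¬ ∀ i c, Conf (2 ^ (k + 1) * coords C D g.1 (w' i) c) (coords C D u (w i) c) := by
    by_contra! hcon
    have hall : ∀ k : ℕ,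
        ∀ i c, Conf (2 ^ k * coords C D g.1 (w' i) c) (coords C D u (w i) c) := by
      intro k
      induction k with
      | zero => simpa using hconf
      | succ k ihk => exact hcon k ihk
    have h1 := hall (coords C D u (w i₀) c₀).natAbs i₀ c₀
    have h2 : ((coords C D u (w i₀) c₀).natAbs : ℤ) < 2 ^ (coords C D u (w i₀) c₀).natAbs := by
      exact_mod_cast Nat.lt_two_pow_self
    unfold Conf at h1
    rcases lt_or_gt_of_ne hc₀ with h3 | h3
    · have := mul_le_mul_of_nonneg_left (show coords C D g.1 (w' i₀) c₀ ≤ -1 by omega)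
        (show (0 : ℤ) ≤ 2 ^ (coords C D u (w i₀) c₀).natAbs by positivity)
      omega
    · have := mul_le_mul_of_nonneg_left (show 1 ≤ coords C D g.1 (w' i₀) c₀ by omega)
        (show (0 : ℤ) ≤ 2 ^ (coords C D u (w i₀) c₀).natAbs by positivity)
      omega
  push Not at hk'
  obtain ⟨i₁, c₁, hk'⟩ := hk'
  set v := (2 : ℤ) ^ k • g.1 with hv
  set w₁ : Fin N → Fin n → ℤ := fun i => (2 : ℤ) ^ k • w' i with hw₁
  have hco : ∀ i c, coords C D v (w₁ i) c = 2 ^ k * coords C D g.1 (w' i) c := fun i c =>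
    coords_smul _ _ _ _
  -- In the coordinate where the next doubling fails, more than half of the entry is removed, which
  -- costs it a binary digit; no other entry grows.
  have hlt : digits C D (u - v) (fun i => w i - w₁ i) < digits C D u w := by
    have hle : ∀ i c, Nat.size (coords C D (u - v) (w i - w₁ i) c).natAbs ≤
        Nat.size (coords C D u (w i) c).natAbs := fun i c => by
      refine Nat.size_le_size ?_
      have := hk i c
      rw [coords_sub, hco]
      unfold Conf at this
      omega
    refine Finset.sum_lt_sum (fun i _ => Finset.sum_le_sum fun c _ => hle i c)
      ⟨i₁, Finset.mem_univ _, Finset.sum_lt_sum (fun c _ => hle i₁ c) ⟨c₁, Finset.mem_univ _, ?_⟩⟩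
    have h1 := hk i₁ c₁
    rw [pow_succ, mul_right_comm] at hk'
    rw [coords_sub, hco]
    unfold Conf at h1 hk'
    exact Nat.size_lt_size_of_two_mul_le (by omega) (by omega)
  -- The remainder lies in the kernel again and inherits `hstep`, because it is itself conformal to
  -- `(u, w)`.
  have hrec := ih _ (hΦ ▸ hlt) (u := u - v) (w := fun i => w i - w₁ i) (fun i => by
      have h1 := hker g hg (w' i) (hw' i)
      have h2 := hz i
      simp only [hv, hw₁, Matrix.mulVec_sub, Matrix.mulVec_smul]
      calc _ = (T.mulVec u + W.mulVec (w i)) -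
          (2 : ℤ) ^ k • (T.mulVec g.1 + W.mulVec (w' i)) := by rw [smul_add]; abel
        _ = 0 := by rw [h1, h2]; simp) (fun k' g' hg' w₂ hw₂ hne₂ hc => by
      refine hstep k' g' hg' w₂ hw₂ hne₂ fun i c => ?_
      have h1 := hc i c
      have h2 := hk i c
      rw [coords_sub, hco] at h1
      unfold Conf at h1 h2 ⊢
      omega) rfl
  have h1 := totalCost_shift_add hF z (u := u) (w := w) (v := v) (w' := w₁) fun i c => by
    rw [hco]; exact hk i c
  have h2 := hstep k g hg w' hw' hne' hk
  have h3 : (digits C D (u - v) (fun i => w i - w₁ i) : ℝ) + 1 ≤ digits C D u w := by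
    exact_mod_cast hlt
  have h4 := mul_le_mul_of_nonneg_right h3 hδ
  rw [add_mul, one_mul] at h4
  linarith

/-- A strictly decreasing sequence of natural numbers in which each step removes at least the
`Φ`-th part of the current value is short. -/
theorem length_le_of_geometric_decrease {Φ : ℕ} {n : ℕ} {g : ℕ → ℕ} (hlt : ∀ j < n, g (j + 1) < g j)
    (hg : ∀ j < n, g j ≤ Φ * (g j - g (j + 1))) : n ≤ Φ * Nat.size (g 0) := by
  suffices h : ∀ k, Nat.size (g 0) ≤ k → n ≤ Φ * k from h _ le_rfl
  intro k hk
  induction k generalizing n g with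
  | zero =>
    rw [Nat.le_zero, Nat.size_eq_zero] at hk
    rcases Nat.eq_zero_or_pos n with rfl | hn
    · simp
    · have := hlt 0 hn; omega
  | succ k ih =>
    by_cases hn : n ≤ Φ
    · exact hn.trans (Nat.le_mul_of_pos_right _ (by omega))
    have hmono : ∀ j ≤ n, ∀ i ≤ j, g j ≤ g i := by
      intro j
      induction j with
      | zero => intro _ i hi; obtain rfl : i = 0 := by omega
                exact le_rfl
      | succ j ihj =>
        intro hj i hi
        rcases Nat.lt_or_ge i (j + 1) with h | h
        · exact (hlt j (by omega)).le.trans (ihj (by omega) i (by omega))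
        · obtain rfl : i = j + 1 := by omega
          exact le_rfl
    -- Each of the first `Φ` steps removes at least `g Φ / Φ`. Together they remove at least `g Φ`,
    -- so the value is halved and loses a digit.
    have hdec : ∀ j ≤ Φ, Φ * g j + j * g Φ ≤ Φ * g 0 := by
      intro j
      induction j with
      | zero => simp
      | succ j ihj =>
        intro hj
        have h1 := ihj (by omega)
        have h2 := hg j (by omega)
        have h4 := hmono Φ (by omega) j (by omega)
        have h5 := Nat.mul_le_mul_left Φ (hlt j (by omega)).le
        rw [Nat.mul_sub] at h2
        rw [add_mul, one_mul]
        omega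
    have hhalf : 2 * g Φ ≤ g 0 := by
      rcases Nat.eq_zero_or_pos Φ with rfl | h0
      · have h1 := hg 0 (by omega)
        have h2 := hlt 0 (by omega)
        rw [zero_mul] at h1
        omega
      · have h1 := hdec Φ le_rfl
        refine Nat.le_of_mul_le_mul_left ?_ h0
        linarith
    have hsz : Nat.size (g (Φ + 0)) ≤ k := by
      have h1 := Nat.size_le.1 hk
      rw [pow_succ] at h1
      exact Nat.size_le.2 (by rw [add_zero]; omega)
    have h1 := ih (n := n - Φ) (g := fun j => g (Φ + j)) (fun j hj => hlt (Φ + j) (by omega))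
      (fun j hj => hg (Φ + j) (by omega)) hsz
    rw [mul_add, mul_one]
    omega

end Augment

/-! ### Loops over lists -/

namespace Prog

/-- The `k`-th component of a right-nested tuple. -/
def nth : ℕ → Prog
  | 0 => .fst
  | k + 1 => .seq .snd (nth k)

/-- All but the first `k` components of a right-nested tuple. -/
def rest : ℕ → Prog
  | 0 => .id
  | k + 1 => .seq .snd (rest k)

@[simp] theorem isSL_nth (k : ℕ) : (nth k).IsSL := by
  induction k with
  | zero => trivial
  | succ k ih => exact ⟨trivial, ih⟩

@[simp] theorem isSL_rest (k : ℕ) : (rest k).IsSL := by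
  induction k with
  | zero => trivial
  | succ k ih => exact ⟨trivial, ih⟩

/-- Reverses a list. -/
def reverse : Prog :=
  .seq (.pair .id (.const (.num 0)))
    (.seq (.loop (.seq .fst .isPair)
      (.pair (.seq .fst .snd) (.pair (.seq .fst .fst) .snd))) .snd)

/-- Started on a list, an accumulator and an environment: combines, by `body`, the entries of the
list with the accumulator. -/
def fold (body : Prog) : Prog :=
  .seq (.loop (.seq .fst .isPair)
    (.seq (.pair (.seq (.pair (.seq .fst .fst) .snd) body) .id)
      (.pair (.seq (nth 1) .snd) (.pair .fst (rest 3))))) (nth 1)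

/-- Started on two lists and an environment: the list of the results of `body` on the index, the
entries of both lists, and the environment. -/
def map₂ (body : Prog) : Prog :=
  -- A fold over the first list, whose accumulator holds the rest of the second list, the current
  -- index and the reversed output.
  .seq (.pair .fst (.pair (.pair (nth 1) (.pair (.const (.num 0)) (.const (.num 0)))) (rest 2)))
    (.seq (fold (.seq
      (.pair (.seq (.pair (.seq (nth 1) (nth 1)) (.pair .fst (.pair (.seq (nth 1) (.seq .fst .fst))
        (rest 2)))) body) (nth 1))
      (.pair (.seq (rest 1) (.seq .fst .snd))
        (.pair (.seq (.pair (.seq (rest 1) (nth 1)) (.const (.num 1))) .add)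
          (.pair .fst (rest 3))))))
      (.seq (rest 2) reverse))

/-- Applies `body` to every entry of a list. -/
def map (body : Prog) : Prog :=
  .seq (.pair .id (.pair .id .id)) (map₂ (.seq (nth 1) body))

/-- The sum of the values of `body` on the entries of a list. -/
def sum (body : Prog) : Prog :=
  .seq (.pair .id (.pair (.const (.num 0)) (.const (.num 0))))
    (fold (.seq (.pair (nth 1) (.seq .fst body)) .add))

end Prog

theorem Val.isPos_isPair_ofList (l : List Val) : (Val.ofList l).isPair.IsPos ↔ l ≠ [] := by
  cases l <;> simp [Val.ofList, Val.isPair, Val.IsPos]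

namespace Comp

variable {S : Type} {K : Ctx S}

/-- The state of a list loop consists of the unread suffix and the reversed processed prefix;
neither is longer than the list. -/
theorem sizeOf_take_drop {l : S → List Val} (hl : PolySize K.len fun s => .ofList (l s))
    {J : Type} (φ : J → S) (j : J → ℕ) :
    PolySize (K.comap φ).len (fun x => .ofList ((l (φ x)).drop (j x))) ∧
      PolySize (K.comap φ).len fun x => .ofList ((l (φ x)).take (j x)).reverse := by
  refine ⟨PolyBdd.mono (hl.comap φ) fun x => Val.size_ofList_le_of_sublist (List.drop_sublist _ _),
    PolyBdd.mono (hl.comap φ) fun x => ?_⟩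
  rw [Val.size_ofList_reverse]
  exact Val.size_ofList_le_of_sublist (List.take_sublist _ _)

theorem reverse {l : S → List Val} (hl : PolySize K.len fun s => .ofList (l s)) :
    Comp K Prog.reverse (fun s => .ofList (l s)) fun s => .ofList (l s).reverse := by
  have hsz := fun (n : S → ℕ) => sizeOf_take_drop hl (J := Σ s, Fin (n s)) Sigma.fst (·.2)
  have hlen : PolyBdd K.len fun s => (l s).length := by
    refine PolyBdd.mono hl fun s => ?_
    rw [Val.size_ofList, List.sum_map_add]
    simp; omega
  have h := Comp.loop (K := K) (c := .seq .fst .isPair)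
    (p := .pair (.seq .fst .snd) (.pair (.seq .fst .fst) .snd))
    (st := fun s j => .pair (.ofList ((l s).drop j)) (.ofList ((l s).take j).reverse))
    (cv := fun s j => (Val.ofList ((l s).drop j)).isPair) (n := fun s => (l s).length) hlen
    (sl ⟨trivial, trivial⟩ ((hsz _).1.pair (hsz _).2) fun _ => rfl)
    (fun s j hj => by rw [Val.isPos_isPair_ofList]; simpa using hj)
    (fun s => by rw [Val.isPos_isPair_ofList]; simp)
    (sl ⟨⟨trivial, trivial⟩, ⟨trivial, trivial⟩, trivial⟩ ((hsz _).1.pair (hsz _).2) fun x => by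
      obtain ⟨s, j, hj⟩ := x
      have h1 : ((l s).take (j + 1)).reverse = (l s)[j] :: ((l s).take j).reverse := by
        rw [List.take_add_one, List.getElem?_eq_getElem hj]; simp
      dsimp only
      rw [List.drop_eq_getElem_cons hj, h1]
      rfl)
  refine Comp.seq (sl ⟨trivial, trivial⟩ hl fun s => ?_) (h.seq (sl trivial h.polySize_out
    fun s => ?_))
  · simp [Prog.eval, Val.ofList]
  · simp [Prog.eval, Val.snd]

/-- The accumulators are prescribed in advance with a size bound uniform in the round, as the rule
for loops requires. The bound includes round `N s`, which the body never sees as input. -/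
theorem fold {N : S → ℕ} {a : (s : S) → Fin (N s) → Val} {acc : S → ℕ → Val} {env : S → Val}
    {body : Prog} (ha : PolySize K.len fun s => .ofList (List.ofFn (a s)))
    (hacc : PolySize (K.comap fun x : Σ s, Fin (N s + 1) => x.1).len fun x => acc x.1 x.2)
    (henv : PolySize K.len env)
    (hbody : Comp (K.comap fun x : Σ s, Fin (N s) => x.1) body
      (fun x => .pair (a x.1 x.2) (.pair (acc x.1 x.2) (env x.1))) fun x => acc x.1 (x.2 + 1)) :
    Comp K (Prog.fold body)
      (fun s => .pair (.ofList (List.ofFn (a s))) (.pair (acc s 0) (env s)))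
      fun s => acc s (N s) := by
  have hsz := fun (n : S → ℕ) => sizeOf_take_drop ha (J := Σ s, Fin (n s)) Sigma.fst (·.2)
  have hst : PolySize (K.comap fun x : Σ s, Fin (N s) => x.1).len fun x =>
      .pair (.ofList ((List.ofFn (a x.1)).drop x.2)) (.pair (acc x.1 x.2) (env x.1)) :=
    (hsz _).1.pair (hbody.polySize_inp.right)
  have hget : ∀ (s : S) (j : Fin (N s)), (List.ofFn (a s)).drop j =
      a s j :: (List.ofFn (a s)).drop (j + 1) := fun s j => by
    rw [List.drop_eq_getElem_cons (by simp), List.getElem_ofFn]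
  have h := Comp.loop (K := K) (c := .seq .fst .isPair)
    (p := .seq (.pair (.seq (.pair (.seq .fst .fst) .snd) body) .id)
      (.pair (.seq (.nth 1) .snd) (.pair .fst (.rest 3))))
    (st := fun s j => .pair (.ofList ((List.ofFn (a s)).drop j)) (.pair (acc s j) (env s)))
    (cv := fun s j => (Val.ofList ((List.ofFn (a s)).drop j)).isPair) (n := N) ha.length
    (sl ⟨trivial, trivial⟩ ((hsz _).1.pair (hacc.pair (henv.comap Sigma.fst))) fun _ => rfl)
    (fun s j hj => by rw [Val.isPos_isPair_ofList]; simpa using hj)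
    (fun s => by rw [Val.isPos_isPair_ofList]; simp)
    (by
      have h1 := (((sl (K := K.comap fun x : Σ s, Fin (N s) => x.1)
        (p := .pair (.seq .fst .fst) .snd) (out := fun x => Val.pair (a x.1 x.2)
          (.pair (acc x.1 x.2) (env x.1))) ⟨⟨trivial, trivial⟩, trivial⟩ hst fun x => by
        rw [hget]; rfl)).seq hbody).pair (sl (p := .id) trivial hst fun _ => rfl)
      refine h1.seq (sl (by simp [Prog.IsSL]) h1.polySize_out fun x => ?_)
      rw [hget]
      rfl)
  simp only [List.drop_zero] at h
  exact h.seq (sl (by simp) h.polySize_out fun s => rfl)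

theorem map₂ {N : S → ℕ} {a b out : (s : S) → Fin (N s) → Val} {env : S → Val} {body : Prog}
    (ha : PolySize K.len fun s => .ofList (List.ofFn (a s)))
    (hb : PolySize K.len fun s => .ofList (List.ofFn (b s))) (henv : PolySize K.len env)
    (hbody : Comp (K.comap fun x : Σ s, Fin (N s) => x.1) body
      (fun x => .pair (.num ((x.2 : ℕ) : ℤ)) (.pair (a x.1 x.2) (.pair (b x.1 x.2) (env x.1))))
      fun x => out x.1 x.2) :
    Comp K (Prog.map₂ body)
      (fun s => .pair (.ofList (List.ofFn (a s))) (.pair (.ofList (List.ofFn (b s))) (env s)))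
      fun s => .ofList (List.ofFn (out s)) := by
  have hout : PolySize K.len fun s => .ofList (List.ofFn (out s)) :=
    PolySize.ofFn ha.length hbody.polySize_out
  have hsb := fun (n : S → ℕ) => sizeOf_take_drop hb (J := Σ s, Fin (n s)) Sigma.fst (·.2)
  have hso := fun (n : S → ℕ) => sizeOf_take_drop hout (J := Σ s, Fin (n s)) Sigma.fst (·.2)
  have hidx : ∀ (n : S → ℕ), PolyBdd K.len n →
      PolySize (K.comap fun x : Σ s, Fin (n s) => x.1).len fun x => .num ((x.2 : ℕ) : ℤ) :=
    fun n hn => .num <| PolyBdd.mono (hn.comap Sigma.fst) fun x => by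
      rw [Int.natAbs_natCast]
      exact (Nat.size_le_self _).trans x.2.2.le
  have hacc : ∀ (n : S → ℕ), PolyBdd K.len n →
      PolySize (K.comap fun x : Σ s, Fin (n s) => x.1).len fun x =>
        .pair (.ofList ((List.ofFn (b x.1)).drop x.2)) (.pair (.num ((x.2 : ℕ) : ℤ))
          (.ofList ((List.ofFn (out x.1)).take x.2).reverse)) := fun n hn =>
    (hsb n).1.pair ((hidx n hn).pair (hso n).2)
  have hin : PolySize (K.comap fun x : Σ s, Fin (N s) => x.1).len fun x =>
      .pair (a x.1 x.2) (.pair (.pair (.ofList ((List.ofFn (b x.1)).drop x.2))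
        (.pair (.num ((x.2 : ℕ) : ℤ)) (.ofList ((List.ofFn (out x.1)).take x.2).reverse)))
          (env x.1)) :=
    ha.get.pair ((hacc N ha.length).pair (henv.comap Sigma.fst))
  have hget : ∀ (s : S) (j : Fin (N s)), (List.ofFn (b s)).drop j =
      b s j :: (List.ofFn (b s)).drop (j + 1) := fun s j => by
    rw [List.drop_eq_getElem_cons (by simp), List.getElem_ofFn]
  have hfold := Comp.fold (K := K) (a := a) (env := env)
    (acc := fun s j => .pair (.ofList ((List.ofFn (b s)).drop j)) (.pair (.num (j : ℤ))
      (.ofList ((List.ofFn (out s)).take j).reverse))) (body := .seq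
      (.pair (.seq (.pair (.seq (.nth 1) (.nth 1)) (.pair .fst (.pair
        (.seq (.nth 1) (.seq .fst .fst)) (.rest 2)))) body) (.nth 1))
      (.pair (.seq (.rest 1) (.seq .fst .snd))
        (.pair (.seq (.pair (.seq (.rest 1) (.nth 1)) (.const (.num 1))) .add)
          (.pair .fst (.rest 3)))))
    ha (hacc _ (ha.length.add (PolyBdd.const 1))) henv (by
      have h1 := ((sl (K := K.comap fun x : Σ s, Fin (N s) => x.1) (inp := fun x =>
        .pair (a x.1 x.2) (.pair (.pair (.ofList ((List.ofFn (b x.1)).drop x.2))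
        (.pair (.num ((x.2 : ℕ) : ℤ)) (.ofList ((List.ofFn (out x.1)).take x.2).reverse)))
          (env x.1)))
        (p := .pair (.seq (.nth 1) (.nth 1)) (.pair .fst (.pair (.seq (.nth 1) (.seq .fst .fst))
        (.rest 2)))) (out := fun x => .pair (.num ((x.2 : ℕ) : ℤ))
          (.pair (a x.1 x.2) (.pair (b x.1 x.2) (env x.1)))) (by simp [Prog.IsSL]) hin fun x => by
          rw [hget]; rfl).seq hbody).pair
            (sl (p := .nth 1) (by simp) hin fun _ => rfl)
      refine h1.seq (sl (by simp [Prog.IsSL]) h1.polySize_out fun x => ?_)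
      have h2 : ((List.ofFn (out x.1)).take (x.2 + 1)).reverse =
          out x.1 x.2 :: ((List.ofFn (out x.1)).take x.2).reverse := by
        rw [List.take_add_one, List.getElem?_eq_getElem (by simp)]; simp
      rw [hget, h2]
      rfl)
  refine Comp.seq (sl (by simp [Prog.IsSL]) (ha.pair (hb.pair henv)) fun s => ?_)
    (hfold.seq (Comp.seq (sl (out := fun s => .ofList (List.ofFn (out s)).reverse) (by simp)
      hfold.polySize_out fun s => ?_) ?_))
  · simp [Prog.eval, Prog.nth, Prog.rest, Val.fst, Val.snd, Val.ofList]
  · rw [List.take_of_length_le (by simp)]; rfl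
  · refine (reverse ?_).congr fun s => by rw [List.reverse_reverse]
    exact PolyBdd.mono hout fun s => by rw [Val.size_ofList_reverse]

theorem map {N : S → ℕ} {a out : (s : S) → Fin (N s) → Val} {body : Prog}
    (ha : PolySize K.len fun s => .ofList (List.ofFn (a s)))
    (hbody : Comp (K.comap fun x : Σ s, Fin (N s) => x.1) body
      (fun x => a x.1 x.2) fun x => out x.1 x.2) :
    Comp K (Prog.map body) (fun s => .ofList (List.ofFn (a s)))
      fun s => .ofList (List.ofFn (out s)) := by
  refine Comp.seq (sl ⟨trivial, trivial, trivial⟩ ha fun _ => rfl) (map₂ ha ha ha ?_)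
  have hidx : PolySize (K.comap fun x : Σ s, Fin (N s) => x.1).len
      fun x => .num ((x.2 : ℕ) : ℤ) :=
    .num <| PolyBdd.mono (ha.length.comap Sigma.fst) fun x => by
      rw [Int.natAbs_natCast]
      exact (Nat.size_le_self _).trans x.2.2.le
  exact Comp.seq (sl (by simp) (hidx.pair (ha.get.pair (ha.get.pair (ha.comap Sigma.fst))))
    fun _ => rfl) hbody

theorem sum {N : S → ℕ} {a : (s : S) → Fin (N s) → Val} {f : (s : S) → Fin (N s) → ℤ}
    {body : Prog} (ha : PolySize K.len fun s => .ofList (List.ofFn (a s)))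
    (hbody : Comp (K.comap fun x : Σ s, Fin (N s) => x.1) body
      (fun x => a x.1 x.2) fun x => .num (f x.1 x.2)) :
    Comp K (Prog.sum body) (fun s => .ofList (List.ofFn (a s))) fun s => .num (∑ i, f s i) := by
  -- Extension by zero, so that partial sums are indexed by natural numbers.
  let g : (s : S) → ℕ → ℤ := fun s i => if h : i < N s then f s ⟨i, h⟩ else 0
  have hg : ∀ s (i : Fin (N s)), g s i = f s i := fun s i => by simp [g]
  have hacc : ∀ n : S → ℕ, (∀ s, n s ≤ N s + 1) →
      PolySize (K.comap fun x : Σ s, Fin (n s) => x.1).len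
        fun x => .num (∑ i ∈ Finset.range x.2, g x.1 i) := by
    intro n hn
    have h1 := ((PolyBdd.sum_fin ha.length (f := fun s i => Nat.size (f s i).natAbs)
      hbody.polySize_out.natAbs).comap (Sigma.fst (β := fun s => Fin (n s))))
    refine .num (h1.mono fun x => ?_)
    refine ((Nat.size_le_size (Int.natAbs_sum_le _ _)).trans (Nat.size_sum_le _ _)).trans ?_
    calc _ ≤ ∑ i ∈ Finset.range (N x.1), Nat.size (g x.1 i).natAbs :=
          Finset.sum_le_sum_of_subset (Finset.range_subset_range.2 (by
            have := x.2.2; have := hn x.1; omega))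
      _ = _ := by rw [Finset.sum_range]; simp only [hg]
  have h := Comp.fold (K := K) (a := a) (acc := fun s j => .num (∑ i ∈ Finset.range j, g s i))
    (env := fun _ => .num 0) (body := .seq (.pair (.nth 1) (.seq .fst body)) .add) ha
    (hacc _ fun _ => le_rfl) (.const _) (by
      have hin := ha.get.pair ((hacc N fun s => Nat.le_succ _).pair (.const (.num 0)))
      have h1 := (sl (K := K.comap fun x : Σ s, Fin (N s) => x.1) (p := .nth 1)
        (out := fun x => .num (∑ i ∈ Finset.range x.2, g x.1 i)) (by simp) hin fun _ => rfl).pair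
        ((sl (p := .fst) trivial hin fun _ => rfl).seq hbody)
      refine h1.seq (sl trivial h1.polySize_out fun x => ?_)
      rw [Finset.sum_range_succ, hg]
      rfl)
  refine Comp.seq (sl ⟨trivial, trivial, trivial⟩ ha fun s => ?_) (h.congr fun s => ?_)
  · simp [Prog.eval]
  · rw [Finset.sum_range]; simp only [hg]

end Comp

/-! ### Vector operations -/

namespace Prog

/-- `(a, y) ↦ y + a w`. -/
def axpy : (k : ℕ) → (Fin k → ℤ) → Prog
  | 0, _ => .const (.num 0)
  | k + 1, w => .pair
      (.seq (.pair (.seq .snd .fst) (.seq (.pair .fst (.const (.num (w 0)))) .mul)) .add)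
      (.seq (.pair .fst (rest 2)) (axpy k fun i => w i.succ))

/-- Decides `0 ≤ y ≤ u` for a pair `(y, u)`. -/
def inBox : ℕ → Prog
  | 0 => .const (.num 1)
  -- Branching tests positivity, so a violated inequality shows as a positive difference.
  | k + 1 => .ite (.seq (.pair (.const (.num 0)) (.seq .fst .fst)) .sub) (.const (.num 0))
      (.ite (.seq (.pair (.seq .fst .fst) (.seq .snd .fst)) .sub) (.const (.num 0))
        (.seq (.pair (.seq .fst .snd) (.seq .snd .snd)) (inBox k)))

/-- The sum of the entries of a vector. -/
def vecSum : ℕ → Prog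
  | 0 => .const (.num 0)
  | k + 1 => .seq (.pair .fst (.seq .snd (vecSum k))) .add

@[simp] theorem isSL_axpy (k : ℕ) (w : Fin k → ℤ) : (axpy k w).IsSL := by
  induction k with
  | zero => trivial
  | succ k ih => simp [axpy, IsSL, ih]

@[simp] theorem isSL_inBox (k : ℕ) : (inBox k).IsSL := by
  induction k with
  | zero => trivial
  | succ k ih => simp [inBox, IsSL, ih]

@[simp] theorem isSL_vecSum (k : ℕ) : (vecSum k).IsSL := by
  induction k with
  | zero => trivial
  | succ k ih => simp [vecSum, IsSL, ih]

theorem eval_axpy (k : ℕ) (w y : Fin k → ℤ) (a : ℤ) :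
    (axpy k w).eval (.pair (.num a) (.ofVec y)) = .ofVec (y + a • w) := by
  induction k with
  | zero => simp [axpy, eval, Val.ofVec_zero]
  | succ k ih =>
    rw [Val.ofVec_succ, Val.ofVec_succ]
    have := ih (fun i => w i.succ) fun i => y i.succ
    simp only [axpy, eval, rest, Val.fst, Val.snd, this, Val.arith]
    rfl

end Prog

/-- The vector `y` lies between `0` and `u`. -/
def InBox {k : ℕ} (y u : Fin k → ℤ) : Prop := 0 ≤ y ∧ y ≤ u

theorem inBox_succ {k : ℕ} (y u : Fin (k + 1) → ℤ) :
    InBox y u ↔ 0 ≤ y 0 ∧ y 0 ≤ u 0 ∧ InBox (fun i => y i.succ) fun i => u i.succ := by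
  simp only [InBox, Pi.le_def, Fin.forall_fin_succ, Pi.zero_apply]
  tauto

namespace Prog

open Classical in
theorem eval_inBox (k : ℕ) (y u : Fin k → ℤ) :
    (inBox k).eval (.pair (.ofVec y) (.ofVec u)) = .num (if InBox y u then 1 else 0) := by
  induction k with
  | zero => simp [inBox, eval, InBox]
  | succ k ih =>
    rw [Val.ofVec_succ, Val.ofVec_succ]
    simp only [inBox, eval, Val.fst, Val.snd, Val.arith, Val.IsPos, ih, inBox_succ]
    by_cases h1 : 0 < 0 - y 0
    · rw [if_pos h1, if_neg (by omega)]
    · by_cases h2 : 0 < y 0 - u 0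
      · rw [if_neg h1, if_pos h2, if_neg (by omega)]
      · have h3 : 0 ≤ y 0 := by omega
        have h4 : y 0 ≤ u 0 := by omega
        rw [if_neg h1, if_neg h2]
        simp only [h3, h4, true_and]

theorem eval_vecSum (k : ℕ) (y : Fin k → ℤ) :
    (vecSum k).eval (.ofVec y) = .num (∑ i, y i) := by
  induction k with
  | zero => simp [vecSum, eval]
  | succ k ih =>
    rw [Val.ofVec_succ, Fin.sum_univ_succ]
    simp [vecSum, eval, Val.fst, Val.snd, ih, Val.arith]

end Prog

theorem Val.isPos_ite {p : Prop} {_ : Decidable p} : (Val.num (if p then 1 else 0)).IsPos ↔ p := by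
  by_cases h : p <;> simp [h, Val.IsPos]

/-! ### Candidates -/

/-- The cheaper one of two candidates, each of which may be missing. -/
def pick {α : Type} : Option (ℤ × α) → Option (ℤ × α) → Option (ℤ × α)
  | none, o => o
  | some a, none => some a
  | some a, some b => if a.1 < b.1 then some a else some b

/-- There is a candidate of cost at most `t`. -/
def CostLE {α : Type} (o : Option (ℤ × α)) (t : ℤ) : Prop := ∃ a, o = some a ∧ a.1 ≤ t

section pick

variable {α : Type} {o o' : Option (ℤ × α)} {t : ℤ}

theorem CostLE.pick_left (h : CostLE o t) : CostLE (pick o o') t := by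
  obtain ⟨a, rfl, ha⟩ := h
  rcases o' with _ | b
  · exact ⟨a, rfl, ha⟩
  · by_cases hab : a.1 < b.1
    · exact ⟨a, by simp [pick, hab], ha⟩
    · exact ⟨b, by simp [pick, hab], by omega⟩

theorem CostLE.pick_right (h : CostLE o' t) : CostLE (pick o o') t := by
  obtain ⟨b, rfl, hb⟩ := h
  rcases o with _ | a
  · exact ⟨b, rfl, hb⟩
  · by_cases hab : a.1 < b.1
    · exact ⟨a, by simp [pick, hab], by omega⟩
    · exact ⟨b, by simp [pick, hab], hb⟩

theorem pick_valid {V : ℤ × α → Prop} (h : ∀ a ∈ o, V a) (h' : ∀ a ∈ o', V a) :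
    ∀ a ∈ pick o o', V a := by
  rcases o with _ | a <;> rcases o' with _ | b
  · simp [pick]
  · simpa [pick] using h'
  · simpa [pick] using h
  · by_cases hab : a.1 < b.1
    · simpa [pick, hab] using h
    · simpa [pick, hab] using h'

end pick

/-- A candidate as a value. -/
def Val.ofCand {α : Type} (e : α → Val) : Option (ℤ × α) → Val
  | none => .num 0
  | some a => .pair (.num a.1) (e a.2)

/-- Computes `pick`. -/
def Prog.pick : Prog :=
  .ite (.seq .fst .isPair)
    (.ite (.seq .snd .isPair)
      (.ite (.seq (.pair (.seq .snd .fst) (.seq .fst .fst)) .sub) .fst .snd) .fst) .snd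

@[simp] theorem Prog.isSL_pick : Prog.pick.IsSL := by simp [Prog.pick, Prog.IsSL]

theorem Prog.eval_pick {α : Type} (e : α → Val) (o o' : Option (ℤ × α)) :
    Prog.pick.eval (.pair (.ofCand e o) (.ofCand e o')) = .ofCand e (_root_.pick o o') := by
  rcases o with _ | a <;> rcases o' with _ | b
  · simp [Prog.pick, Prog.eval, _root_.pick, Val.ofCand, Val.fst, Val.snd, Val.isPair, Val.IsPos]
  · simp [Prog.pick, Prog.eval, _root_.pick, Val.ofCand, Val.fst, Val.snd, Val.isPair, Val.IsPos]
  · simp [Prog.pick, Prog.eval, _root_.pick, Val.ofCand, Val.fst, Val.snd, Val.isPair, Val.IsPos]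
  · by_cases hab : a.1 < b.1 <;>
    simp [Prog.pick, Prog.eval, _root_.pick, Val.ofCand, Val.fst, Val.snd, Val.isPair, Val.IsPos,
      Val.arith, hab]

theorem Comp.pick {S : Type} {K : Ctx S} {α : S → Type} {e : (s : S) → α s → Val}
    {o o' : (s : S) → Option (ℤ × α s)} {p q : Prog} {inp : S → Val}
    (hp : Comp K p inp fun s => .ofCand (e s) (o s))
    (hq : Comp K q inp fun s => .ofCand (e s) (o' s)) :
    Comp K (.seq (.pair p q) .pick) inp fun s => .ofCand (e s) (_root_.pick (o s) (o' s)) :=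
  (hp.pair hq).seq (.sl (by simp) (hp.pair hq).polySize_out fun _ => Prog.eval_pick _ _ _)

/-! ### Choosing the second-stage vector of a single scenario -/

section Algorithm

variable {m n : ℕ}

open Classical in
/-- The second-stage vector `y + a w` with its cost, if it satisfies the bounds. -/
noncomputable def trial (c : (Fin n → ℤ) → ℤ) (u y : Fin n → ℤ) (a : ℤ) (w : Fin n → ℤ) :
    Option (ℤ × (Fin n → ℤ)) :=
  if InBox (y + a • w) u then some (c (y + a • w), y + a • w) else none

/-- The best one of the vectors `y + a w` that satisfy the bounds. -/
noncomputable def bestTrial (c : (Fin n → ℤ) → ℤ) (u y : Fin n → ℤ) (a : ℤ) :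
    List (Fin n → ℤ) → Option (ℤ × (Fin n → ℤ))
  | [] => none
  | w :: l => pick (trial c u y a w) (bestTrial c u y a l)

theorem bestTrial_valid (c : (Fin n → ℤ) → ℤ) (u y : Fin n → ℤ) (a : ℤ) (l : List (Fin n → ℤ)) :
    ∀ r ∈ bestTrial c u y a l, ∃ w ∈ l, r.2 = y + a • w ∧ InBox r.2 u ∧ r.1 = c r.2 := by
  induction l with
  | nil => simp [bestTrial]
  | cons w l ih =>
    refine pick_valid (V := fun r => ∃ w' ∈ w :: l, r.2 = y + a • w' ∧ InBox r.2 u ∧ r.1 = c r.2)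
      (fun r hr => ?_) fun r hr => ?_
    · unfold trial at hr
      split_ifs at hr with h
      · obtain rfl := Option.mem_some.1 hr
        exact ⟨w, by simp, rfl, h, rfl⟩
      · simp at hr
    · obtain ⟨w', h1, h2⟩ := ih r hr
      exact ⟨w', List.mem_cons_of_mem _ h1, h2⟩

theorem bestTrial_le (c : (Fin n → ℤ) → ℤ) (u y : Fin n → ℤ) (a : ℤ) {l : List (Fin n → ℤ)}
    {w : Fin n → ℤ} (hw : w ∈ l) (hb : InBox (y + a • w) u) :
    CostLE (bestTrial c u y a l) (c (y + a • w)) := by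
  induction l with
  | nil => simp at hw
  | cons w' l ih =>
    rcases List.mem_cons.1 hw with rfl | hw
    · exact CostLE.pick_left ⟨_, by rw [trial, if_pos hb], le_rfl⟩
    · exact (ih hw).pick_right

/-- Started on `(i, (y, ((b, u), (a, x))))`: the candidate `y + a w`; its cost is computed by
`cp`. -/
def trialProg (cp : Prog) (w : Fin n → ℤ) : Prog :=
  .seq (.pair (.seq (.pair (.nth 3) (.nth 1)) (.axpy n w)) .id)
    (.ite (.seq (.pair .fst (.seq (.nth 3) .snd)) (.inBox n))
      (.pair (.seq (.pair (.nth 1) (.pair (.rest 5) .fst)) cp) .fst)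
      (.const (.num 0)))

/-- The best one of the candidates `y + a w`. -/
def bestTrialProg (cp : Prog) : List (Fin n → ℤ) → Prog
  | [] => .const (.num 0)
  | w :: l => .seq (.pair (trialProg cp w) (bestTrialProg cp l)) .pick

/-- The program `cp` evaluates the cost functions `c` in polynomial time. -/
def CostProg {S : Type} (K : Ctx S) {N : S → ℕ}
    (c : (s : S) → Fin (N s) → (Fin m → ℤ) → (Fin n → ℤ) → ℤ) (cp : Prog) : Prop :=
  ∀ {J : Type} (φ : J → S) (i : (t : J) → Fin (N (φ t))) (x : J → Fin m → ℤ) (y : J → Fin n → ℤ),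
    PolySize (K.comap φ).len (fun t => .ofVec (x t)) →
    PolySize (K.comap φ).len (fun t => .ofVec (y t)) →
    Comp (K.comap φ) cp (fun t => evalQuery (i t) (x t) (y t))
      fun t => .num (c (φ t) (i t) (x t) (y t))

theorem CostProg.comap {S : Type} {K : Ctx S} {N : S → ℕ}
    {c : (s : S) → Fin (N s) → (Fin m → ℤ) → (Fin n → ℤ) → ℤ} {cp : Prog} {J : Type}
    (h : CostProg K c cp) (φ : J → S) :
    CostProg (K.comap φ) (N := fun t => N (φ t)) (fun t => c (φ t)) cp :=
  fun ψ i x y hx hy => h (fun t => φ (ψ t)) i x y hx hy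

/-- The list `l` is fixed and built into the program. It is unrolled by induction, and only a
constant number of cost evaluations is made. -/
theorem comp_bestTrial {S : Type} {K : Ctx S} {N : S → ℕ} (hN : PolyBdd K.len N)
    {c : (s : S) → Fin (N s) → (Fin m → ℤ) → (Fin n → ℤ) → ℤ} {cp : Prog} (hcp : CostProg K c cp)
    {i : (s : S) → Fin (N s)} {x : S → Fin m → ℤ} {y u : S → Fin n → ℤ} {b : S → Val} {a : S → ℤ}
    (hx : PolySize K.len fun s => .ofVec (x s)) (hy : PolySize K.len fun s => .ofVec (y s))
    (hu : PolySize K.len fun s => .ofVec (u s)) (hb : PolySize K.len b)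
    (ha : PolySize K.len fun s => .num (a s)) (l : List (Fin n → ℤ)) :
    Comp K (bestTrialProg cp l)
      (fun s => .pair (.num ((i s : ℕ) : ℤ)) (.pair (.ofVec (y s))
        (.pair (.pair (b s) (.ofVec (u s))) (.pair (.num (a s)) (.ofVec (x s))))))
      fun s => .ofCand .ofVec (bestTrial (c s (i s) (x s)) (u s) (y s) (a s) l) := by
  have hi : PolySize K.len fun s => .num ((i s : ℕ) : ℤ) := .num <| PolyBdd.mono hN fun s => by
    rw [Int.natAbs_natCast]
    exact (Nat.size_le_self _).trans (i s).2.le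
  have hin := hi.pair (hy.pair ((hb.pair hu).pair (ha.pair hx)))
  induction l with
  | nil => exact .sl trivial hin fun _ => rfl
  | cons w l ih =>
    refine Comp.pick ?_ ih
    have h1 := (Comp.sl (K := K) (p := .seq (.pair (.nth 3) (.nth 1)) (.axpy n w))
      (out := fun s => .ofVec (y s + a s • w)) (by simp [Prog.IsSL]) hin fun s =>
        Prog.eval_axpy n w (y s) (a s)).pair (.sl (p := .id) trivial hin fun _ => rfl)
    have h2 := h1.polySize_out
    refine h1.seq (Comp.ite (.sl (by simp [Prog.IsSL]) h2 fun s => Prog.eval_inBox n _ (u s)) ?_ ?_)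
    · refine Comp.congr (Comp.pair (a := fun s => .num (c s.1 (i s.1) (x s.1)
        (y s.1 + a s.1 • w))) (b := fun s => .ofVec (y s.1 + a s.1 • w)) (Comp.seq
          (a := fun s => evalQuery (i s.1) (x s.1) (y s.1 + a s.1 • w))
          (.sl (by simp [Prog.IsSL]) (h2.comap Subtype.val) fun _ => rfl) (hcp _ _ _ _
          (hx.comap Subtype.val) (h2.left.comap Subtype.val)))
        (.sl trivial (h2.comap Subtype.val) fun _ => rfl)) fun s => ?_
      rw [trial, if_pos (Val.isPos_ite.1 s.2)]
      rfl
    · refine .sl trivial (h2.comap Subtype.val) fun s => ?_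
      rw [trial, if_neg (mt Val.isPos_ite.2 s.2)]
      rfl

end Algorithm

/-! ### The best step along a move of given length -/

section Algorithm

variable {d m n : ℕ}

/-- The total cost of a point. -/
def TwoStagePoint.cost {N : ℕ} (c : Fin N → (Fin m → ℤ) → (Fin n → ℤ) → ℤ)
    (z : TwoStagePoint m n N) : ℤ := ∑ i, c i z.x (z.y i)

/-- `z` satisfies the bounds of `I`. -/
def TwoStagePoint.InBounds (I : TwoStageData d m n) (z : TwoStagePoint m n I.N) : Prop :=
  InBox z.x I.ux ∧ ∀ i, InBox (z.y i) (I.uy i)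

section Candidate

variable (I : TwoStageData d m n) (c : Fin I.N → (Fin m → ℤ) → (Fin n → ℤ) → ℤ)
  (z : TwoStagePoint m n I.N) (a : ℤ) (g : (Fin m → ℤ) × List (Fin n → ℤ))

/-- The best second-stage vector of scenario `i` after the step `a g`. -/
noncomputable def scenarioTrial (i : Fin I.N) : Option (ℤ × (Fin n → ℤ)) :=
  bestTrial (c i (z.x + a • g.1)) (I.uy i) (z.y i) a g.2

open Classical in
/-- The best one of the points `z + a (g.1, w)` with all `w i` in `g.2` whose second-stage vectors
satisfy the bounds. -/
noncomputable def fillCand : Option (ℤ × TwoStagePoint m n I.N) :=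
  -- Scenarios without an admissible vector are counted, as the program does it.
  if 0 < ∑ i, (if scenarioTrial I c z a g i = none then (1 : ℤ) else 0) then none
  else some (∑ i, ((scenarioTrial I c z a g i).getD (0, 0)).1,
    ⟨z.x + a • g.1, fun i => ((scenarioTrial I c z a g i).getD (0, 0)).2⟩)

open Classical in
/-- The best one of the points `z + a (g.1, w)` with all `w i` in `g.2` that satisfy the bounds. -/
noncomputable def stepCand : Option (ℤ × TwoStagePoint m n I.N) :=
  if InBox (z.x + a • g.1) I.ux then fillCand I c z a g else none

theorem sum_ite_none_pos_iff {N : ℕ} {β : Type} {r : Fin N → Option β}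
    {_ : ∀ i, Decidable (r i = none)} :
    0 < ∑ i, (if r i = none then (1 : ℤ) else 0) ↔ ∃ i, r i = none := by
  rw [Finset.sum_boole]
  simp [Finset.card_pos, Finset.Nonempty]

variable {I c z a g}

theorem stepCand_valid {r : ℤ × TwoStagePoint m n I.N} (hr : r ∈ stepCand I c z a g) :
    (∃ w : Fin I.N → Fin n → ℤ, (∀ i, w i ∈ g.2) ∧ r.2 = z.shift (a • g.1) fun i => a • w i) ∧
      r.2.InBounds I ∧ r.1 = r.2.cost c := by
  classical
  unfold stepCand fillCand at hr
  split_ifs at hr with h1 h2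
  · simp at hr
  · rw [sum_ite_none_pos_iff] at h2
    push Not at h2
    obtain rfl := Option.mem_some.1 hr
    choose t ht using fun i => Option.ne_none_iff_exists'.1 (h2 i)
    choose w hw1 hw2 hw3 hw4 using fun i => bestTrial_valid _ _ _ _ _ (t i) (ht i)
    simp only [ht, Option.getD_some]
    refine ⟨⟨w, hw1, ?_⟩, ⟨h1, hw3⟩, Finset.sum_congr rfl fun i _ => hw4 i⟩
    simp only [TwoStagePoint.shift, hw2]
  · simp at hr

/-- After the first-stage step is fixed, both bounds and costs decouple, so the separate choices of
the scenarios are at least as good as every joint choice. This avoids enumerating the exponentially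
many combinations. -/
theorem stepCand_le {w : Fin I.N → Fin n → ℤ} (hw : ∀ i, w i ∈ g.2)
    (hb : (z.shift (a • g.1) fun i => a • w i).InBounds I) :
    CostLE (stepCand I c z a g) ((z.shift (a • g.1) fun i => a • w i).cost c) := by
  classical
  have h1 := fun i => bestTrial_le (c i (z.x + a • g.1)) (I.uy i) (z.y i) a (hw i) (hb.2 i)
  choose t ht htc using h1
  have hbx : InBox (z.x + a • g.1) I.ux := hb.1
  unfold stepCand fillCand
  rw [if_pos hbx, if_neg (by
    rw [sum_ite_none_pos_iff]; push Not; intro i h; rw [scenarioTrial, ht i] at h; cases h)]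
  refine ⟨_, rfl, ?_⟩
  dsimp only [TwoStagePoint.cost]
  refine Finset.sum_le_sum fun i _ => ?_
  simp only [scenarioTrial, ht, Option.getD_some]
  exact htc i

/-- The best candidate among `acc` and the steps `a g` with `g` in the list. -/
noncomputable def sweep (I : TwoStageData d m n) (c : Fin I.N → (Fin m → ℤ) → (Fin n → ℤ) → ℤ)
    (z : TwoStagePoint m n I.N) (a : ℤ) :
    List ((Fin m → ℤ) × List (Fin n → ℤ)) → Option (ℤ × TwoStagePoint m n I.N) →
      Option (ℤ × TwoStagePoint m n I.N)
  | [], acc => acc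
  | g :: l, acc => sweep I c z a l (pick (stepCand I c z a g) acc)

theorem sweep_valid {V : ℤ × TwoStagePoint m n I.N → Prop}
    {l : List ((Fin m → ℤ) × List (Fin n → ℤ))}
    (hV : ∀ g ∈ l, ∀ r ∈ stepCand I c z a g, V r) {acc : Option (ℤ × TwoStagePoint m n I.N)}
    (hacc : ∀ r ∈ acc, V r) : ∀ r ∈ sweep I c z a l acc, V r := by
  induction l generalizing acc with
  | nil => exact hacc
  | cons g l ih =>
    exact ih (fun g' hg' => hV g' (List.mem_cons_of_mem _ hg'))
      (pick_valid (hV g List.mem_cons_self) hacc)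

theorem CostLE.sweep {l : List ((Fin m → ℤ) × List (Fin n → ℤ))}
    {acc : Option (ℤ × TwoStagePoint m n I.N)} {t : ℤ} (h : CostLE acc t) :
    CostLE (sweep I c z a l acc) t := by
  induction l generalizing acc with
  | nil => exact h
  | cons g l ih => exact ih h.pick_right

theorem sweep_le {l : List ((Fin m → ℤ) × List (Fin n → ℤ))}
    {acc : Option (ℤ × TwoStagePoint m n I.N)} (hg : g ∈ l) {t : ℤ}
    (h : CostLE (stepCand I c z a g) t) : CostLE (sweep I c z a l acc) t := by
  induction l generalizing acc with
  | nil => simp at hg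
  | cons g' l ih =>
    rcases List.mem_cons.1 hg with rfl | hg
    · exact CostLE.sweep (l := l) (CostLE.pick_left h)
    · exact ih hg

/-- The best candidate among `acc` and the steps `2 ^ k g` with `k < j`. -/
noncomputable def scan (I : TwoStageData d m n) (c : Fin I.N → (Fin m → ℤ) → (Fin n → ℤ) → ℤ)
    (moves : List ((Fin m → ℤ) × List (Fin n → ℤ))) (z : TwoStagePoint m n I.N)
    (acc : Option (ℤ × TwoStagePoint m n I.N)) : ℕ → Option (ℤ × TwoStagePoint m n I.N)
  | 0 => acc
  | j + 1 => sweep I c z (2 ^ j) moves (scan I c moves z acc j)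

end Candidate

/-! ### The programs -/

/-- Started on `(x, (a, (z, I)))`: the best point with first-stage vector `x` reached by a step
`a (g.1, w)` with all `w i` in `l`. -/
def fillProg (cp : Prog) (l : List (Fin n → ℤ)) : Prog :=
  .seq (.pair (.seq (.pair (.seq (.nth 2) .snd) (.pair (.seq (.rest 3) .snd)
      (.pair (.nth 1) .fst))) (.map₂ (bestTrialProg cp l))) .fst)
    -- A missing candidate is a leaf and contributes `1`; an existing one is a pair and contributes
    -- `0`.
    (.ite (.seq .fst (.sum (.seq (.pair (.const (.num 1)) .isPair) .sub)))
      (.const (.num 0))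
      (.pair (.seq .fst (.sum .fst)) (.pair .snd (.seq .fst (.map .snd)))))

/-- Started on `(a, (z, I))`: the best point reached by a step `a g`. -/
def stepProg (cp : Prog) (g : (Fin m → ℤ) × List (Fin n → ℤ)) : Prog :=
  .seq (.pair (.seq (.pair .fst (.seq (.nth 1) .fst)) (.axpy m g.1)) .id)
    (.ite (.seq (.pair .fst (.seq (.rest 3) .fst)) (.inBox m)) (fillProg cp g.2)
      (.const (.num 0)))

/-- Started on a candidate and `(a, (z, I))`: the best one of this candidate and the steps
`a g`. -/
def sweepProg (cp : Prog) : List ((Fin m → ℤ) × List (Fin n → ℤ)) → Prog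
  | [] => .fst
  | g :: l => .seq (.pair (.seq (.pair (.seq .snd (stepProg cp g)) .fst) .pick) .snd)
      (sweepProg cp l)

/-- The sizes of the data of a family of problems and of points are polynomial. -/
theorem PolySize.scenarios {S : Type} {L : S → ℕ} {I : S → TwoStageData d m n}
    (h : PolySize L fun s => (I s).encode) :
    PolyBdd L (fun s => (I s).N) ∧ PolySize L (fun s => .ofVec (I s).ux) ∧
      PolySize L (fun s => .ofList (List.ofFn fun i => .pair (.ofVec ((I s).b i))
        (.ofVec ((I s).uy i)))) ∧
      PolySize (fun x : Σ s, Fin (I s).N => L x.1) (fun x => .ofVec ((I x.1).b x.2)) ∧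
      PolySize (fun x : Σ s, Fin (I s).N => L x.1) (fun x => .ofVec ((I x.1).uy x.2)) := by
  have h2 : PolySize L fun s => .ofList (List.ofFn fun i => .pair (.ofVec ((I s).b i))
    (.ofVec ((I s).uy i))) := h.right
  exact ⟨h2.length, h.left, h2, h2.get.left, h2.get.right⟩

theorem comp_fill {S : Type} {K : Ctx S} {I : S → TwoStageData d m n}
    {c : (s : S) → Fin (I s).N → (Fin m → ℤ) → (Fin n → ℤ) → ℤ} {cp : Prog}
    (hcp : CostProg K c cp) {z : (s : S) → TwoStagePoint m n (I s).N} {a : S → ℤ}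
    (hI : PolySize K.len fun s => (I s).encode) (hz : PolySize K.len fun s => (z s).encode)
    (ha : PolySize K.len fun s => .num (a s)) (g : (Fin m → ℤ) × List (Fin n → ℤ))
    (hx : PolySize K.len fun s => .ofVec ((z s).x + a s • g.1)) :
    Comp K (fillProg cp g.2) (fun s => .pair (.ofVec ((z s).x + a s • g.1))
      (.pair (.num (a s)) (.pair (z s).encode (I s).encode)))
      fun s => .ofCand TwoStagePoint.encode (fillCand (I s) (c s) (z s) (a s) g) := by
  classical
  obtain ⟨hN, hux, hsc, hb, huy⟩ := hI.scenarios
  have hys : PolySize K.len fun s => .ofList (List.ofFn fun i => .ofVec ((z s).y i)) := hz.right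
  have hin := hx.pair (ha.pair (hz.pair hI))
  have hmap := Comp.map₂ (out := fun s i => .ofCand .ofVec (scenarioTrial (I s) (c s) (z s) (a s) g i))
    hys hsc (ha.pair hx) (comp_bestTrial
    (K := K.comap fun x : Σ s, Fin (I s).N => x.1) (N := fun x => (I x.1).N)
    (hN.comap Sigma.fst) (hcp.comap Sigma.fst) (i := fun x => x.2) (hx.comap Sigma.fst) hys.get huy
    hb (ha.comap Sigma.fst) g.2)
  have h1 := (Comp.seq (Comp.sl (K := K) (p := .pair (.seq (.nth 2) .snd)
    (.pair (.seq (.rest 3) .snd) (.pair (.nth 1) .fst))) (by simp [Prog.IsSL]) hin fun _ => rfl)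
    hmap).pair (.sl (p := .fst) (out := fun s => .ofVec ((z s).x + a s • g.1)) trivial hin
      fun _ => rfl)
  have h2 := h1.polySize_out
  have hr := h2.left
  have hnone : ∀ s i, Prog.eval (.seq (.pair (.const (.num 1)) .isPair) .sub)
      (Val.ofCand Val.ofVec (scenarioTrial (I s) (c s) (z s) (a s) g i)) =
      .num (if scenarioTrial (I s) (c s) (z s) (a s) g i = none then 1 else 0) := by
    intro s i
    rcases scenarioTrial (I s) (c s) (z s) (a s) g i with _ | r <;> rfl
  refine h1.seq (Comp.ite (Comp.seq (.sl trivial h2 fun _ => rfl) (Comp.sum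
    (f := fun s i => if scenarioTrial (I s) (c s) (z s) (a s) g i = none then (1 : ℤ) else 0) hr
    (.sl ⟨⟨trivial, trivial⟩, trivial⟩ hr.get fun x => hnone x.1 x.2))) ?_ ?_)
  · refine .sl trivial (h2.comap Subtype.val) fun s => ?_
    have := s.2
    rw [fillCand, if_pos (sum_ite_none_pos_iff.2 (sum_ite_none_pos_iff.1 this))]
    rfl
  · have hr' := hr.comap (Subtype.val (p := fun s => ¬ (Val.num (∑ i,
      if scenarioTrial (I s) (c s) (z s) (a s) g i = none then (1 : ℤ) else 0)).IsPos))
    have hsum := Comp.sum (K := K.comap (Subtype.val (p := fun s => ¬ (Val.num (∑ i,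
      if scenarioTrial (I s) (c s) (z s) (a s) g i = none then (1 : ℤ) else 0)).IsPos)))
      (f := fun s i => ((scenarioTrial (I s.1) (c s.1) (z s.1) (a s.1) g i).getD (0, 0)).1)
      (body := .fst) hr' (.sl trivial hr'.get fun x => by
        unfold scenarioTrial
        rcases bestTrial _ _ _ _ _ with _ | r <;> rfl)
    -- Only on this subfamily, where no candidate is missing, does the second component of every
    -- entry encode a vector.
    have hmap := Comp.map (K := K.comap (Subtype.val (p := fun s => ¬ (Val.num (∑ i,
      if scenarioTrial (I s) (c s) (z s) (a s) g i = none then (1 : ℤ) else 0)).IsPos)))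
      (out := fun s i => .ofVec ((scenarioTrial (I s.1) (c s.1) (z s.1) (a s.1) g i).getD
        (0, 0)).2) (body := .snd) hr' (.sl trivial hr'.get fun x => by
        have h := x.1.2
        change ¬ (0 < ∑ i, _) at h
        rw [sum_ite_none_pos_iff] at h
        push Not at h
        obtain ⟨r, hr⟩ := Option.ne_none_iff_exists'.1 (h x.2)
        simp only [hr]
        rfl)
    refine Comp.congr (Comp.pair (Comp.seq (.sl trivial (h2.comap Subtype.val) fun _ => rfl) hsum)
      (Comp.pair (.sl trivial (h2.comap Subtype.val) fun _ => rfl)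
        (Comp.seq (.sl trivial (h2.comap Subtype.val) fun _ => rfl) hmap))) fun s => ?_
    have := s.2
    rw [fillCand, if_neg (mt (fun h => sum_ite_none_pos_iff.2 (sum_ite_none_pos_iff.1 h)) this)]
    rfl

theorem comp_step {S : Type} {K : Ctx S} {I : S → TwoStageData d m n}
    {c : (s : S) → Fin (I s).N → (Fin m → ℤ) → (Fin n → ℤ) → ℤ} {cp : Prog}
    (hcp : CostProg K c cp) {z : (s : S) → TwoStagePoint m n (I s).N} {a : S → ℤ}
    (hI : PolySize K.len fun s => (I s).encode) (hz : PolySize K.len fun s => (z s).encode)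
    (ha : PolySize K.len fun s => .num (a s)) (g : (Fin m → ℤ) × List (Fin n → ℤ)) :
    Comp K (stepProg cp g) (fun s => .pair (.num (a s)) (.pair (z s).encode (I s).encode))
      fun s => .ofCand TwoStagePoint.encode (stepCand (I s) (c s) (z s) (a s) g) := by
  classical
  have hin := ha.pair (hz.pair hI)
  have h1 := (Comp.sl (K := K) (p := .seq (.pair .fst (.seq (.nth 1) .fst)) (.axpy m g.1))
    (out := fun s => .ofVec ((z s).x + a s • g.1)) (by simp [Prog.IsSL]) hin fun s =>
      Prog.eval_axpy m g.1 (z s).x (a s)).pair (.sl (p := .id) (out := fun s =>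
        .pair (.num (a s)) (.pair (z s).encode (I s).encode)) trivial hin fun _ => rfl)
  have h2 := h1.polySize_out
  refine h1.seq (Comp.ite (.sl (by simp [Prog.IsSL]) h2 fun s =>
    Prog.eval_inBox m _ (I s).ux) ?_ ?_)
  · refine ((comp_fill hcp hI hz ha g h2.left).comap Subtype.val).congr fun s => ?_
    rw [stepCand, if_pos (Val.isPos_ite.1 s.2)]
  · refine .sl trivial (h2.comap Subtype.val) fun s => ?_
    rw [stepCand, if_neg (mt Val.isPos_ite.2 s.2)]
    rfl

theorem comp_sweep {S : Type} {K : Ctx S} {I : S → TwoStageData d m n}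
    {c : (s : S) → Fin (I s).N → (Fin m → ℤ) → (Fin n → ℤ) → ℤ} {cp : Prog}
    (hcp : CostProg K c cp) {z : (s : S) → TwoStagePoint m n (I s).N} {a : S → ℤ}
    (hI : PolySize K.len fun s => (I s).encode) (hz : PolySize K.len fun s => (z s).encode)
    (ha : PolySize K.len fun s => .num (a s)) (l : List ((Fin m → ℤ) × List (Fin n → ℤ)))
    {acc : (s : S) → Option (ℤ × TwoStagePoint m n (I s).N)}
    (hacc : PolySize K.len fun s => .ofCand TwoStagePoint.encode (acc s)) :
    Comp K (sweepProg cp l) (fun s => .pair (.ofCand TwoStagePoint.encode (acc s))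
        (.pair (.num (a s)) (.pair (z s).encode (I s).encode)))
      fun s => .ofCand TwoStagePoint.encode (sweep (I s) (c s) (z s) (a s) l (acc s)) := by
  have hE := ha.pair (hz.pair hI)
  induction l generalizing acc with
  | nil => exact .sl trivial (hacc.pair hE) fun _ => rfl
  | cons g l ih =>
    have h1 := Comp.pick (Comp.seq (Comp.sl (K := K) (p := .snd) trivial (hacc.pair hE)
      fun _ => rfl) (comp_step hcp hI hz ha g)) (o' := acc)
        (Comp.sl (p := .fst) trivial (hacc.pair hE) fun _ => rfl)
    exact Comp.seq (h1.pair (.sl trivial (hacc.pair hE) fun _ => rfl)) (ih h1.polySize_out)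

end Algorithm

/-! ### Correctness and progress of an augmentation step -/

section Correctness

variable {d m n s : ℕ}

/-- The sum of all upper bounds. -/
def TwoStageData.bound (I : TwoStageData d m n) : ℕ :=
  (∑ k, I.ux k + ∑ i, ∑ k, I.uy i k).toNat

namespace TwoStageData

variable {I : TwoStageData d m n}

/-- A point within the bounds forces all of them to be nonnegative. Hence their sum dominates each
one, and the truncation in `bound` has no effect. -/
theorem natAbs_le_bound {z : TwoStagePoint m n I.N} (hz : z.InBounds I) :
    ((I.bound : ℕ) : ℤ) = ∑ k, I.ux k + ∑ i, ∑ k, I.uy i k ∧ (∀ k, I.ux k ≤ I.bound) ∧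
      ∀ i k, I.uy i k ≤ I.bound := by
  have h1 : ∀ k, 0 ≤ I.ux k := fun k => (hz.1.1 k).trans (hz.1.2 k)
  have h2 : ∀ i k, 0 ≤ I.uy i k := fun i k => ((hz.2 i).1 k).trans ((hz.2 i).2 k)
  have h3 : 0 ≤ ∑ k, I.ux k := Finset.sum_nonneg fun k _ => h1 k
  have h4 : ∀ i, 0 ≤ ∑ k, I.uy i k := fun i => Finset.sum_nonneg fun k _ => h2 i k
  have h5 : 0 ≤ ∑ i, ∑ k, I.uy i k := Finset.sum_nonneg fun i _ => h4 i
  have h6 : ((I.bound : ℕ) : ℤ) = ∑ k, I.ux k + ∑ i, ∑ k, I.uy i k :=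
    Int.toNat_of_nonneg (add_nonneg h3 h5)
  refine ⟨h6, fun k => ?_, fun i k => ?_⟩
  · have := Finset.single_le_sum (fun k _ => h1 k) (Finset.mem_univ k)
    omega
  · have h7 := Finset.single_le_sum (fun k _ => h2 i k) (Finset.mem_univ k)
    have h8 := Finset.single_le_sum (fun i _ => h4 i) (Finset.mem_univ i)
    omega

theorem Feasible.inBounds {T : Matrix (Fin d) (Fin m) ℤ} {W : Matrix (Fin d) (Fin n) ℤ}
    {z : TwoStagePoint m n I.N} (h : I.Feasible T W z) : z.InBounds I :=
  ⟨h.1, fun i => (h.2 i).2⟩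

end TwoStageData

/-- One augmentation step. -/
noncomputable def nextPoint (I : TwoStageData d m n)
    (c : Fin I.N → (Fin m → ℤ) → (Fin n → ℤ) → ℤ)
    (moves : List ((Fin m → ℤ) × List (Fin n → ℤ))) (p : ℤ × TwoStagePoint m n I.N) :
    ℤ × TwoStagePoint m n I.N :=
  -- The exponents below `Nat.size I.bound` are those with `2 ^ k ≤ I.bound`. The scan starts with
  -- `p` and keeps a candidate throughout, so the default is never taken and the cost never rises.
  (scan I c moves p.2 (some p) (Nat.size I.bound)).getD p

variable {T : Matrix (Fin d) (Fin m) ℤ} {W : Matrix (Fin d) (Fin n) ℤ}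
  {C : Matrix (Fin s) (Fin m) ℤ} {D : Matrix (Fin s) (Fin n) ℤ}
  {moves : List ((Fin m → ℤ) × List (Fin n → ℤ))}
  {I : TwoStageData d m n} {c : Fin I.N → (Fin m → ℤ) → (Fin n → ℤ) → ℤ}

/-- `p` consists of a feasible point and its cost. -/
def IsFeasiblePair (T : Matrix (Fin d) (Fin m) ℤ) (W : Matrix (Fin d) (Fin n) ℤ)
    (I : TwoStageData d m n) (c : Fin I.N → (Fin m → ℤ) → (Fin n → ℤ) → ℤ)
    (p : ℤ × TwoStagePoint m n I.N) : Prop :=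
  I.Feasible T W p.2 ∧ p.1 = p.2.cost c

theorem scan_valid (hker : ∀ g ∈ moves, ∀ w ∈ g.2, T.mulVec g.1 + W.mulVec w = 0)
    {z : TwoStagePoint m n I.N} (hz : I.Feasible T W z)
    {acc : Option (ℤ × TwoStagePoint m n I.N)} (hacc : ∀ p ∈ acc, IsFeasiblePair T W I c p)
    (j : ℕ) : ∀ p ∈ scan I c moves z acc j, IsFeasiblePair T W I c p := by
  induction j with
  | zero => exact hacc
  | succ j ih =>
    refine sweep_valid (fun g hg p hp => ?_) ih
    obtain ⟨⟨w, hw, hpw⟩, hb, hc⟩ := stepCand_valid hp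
    refine ⟨⟨hb.1, fun i => ⟨?_, hb.2 i⟩⟩, hc⟩
    have h1 := (hz.2 i).1
    have h2 := hker g hg (w i) (hw i)
    rw [hpw]
    simp only [TwoStagePoint.shift, Matrix.mulVec_add, Matrix.mulVec_smul]
    calc _ = (T.mulVec z.x + W.mulVec (z.y i)) +
        (2 : ℤ) ^ j • (T.mulVec g.1 + W.mulVec (w i)) := by rw [smul_add]; abel
      _ = I.b i := by rw [h1, h2]; simp

theorem CostLE.scan {z : TwoStagePoint m n I.N} {acc : Option (ℤ × TwoStagePoint m n I.N)} {t : ℤ}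
    {j j' : ℕ} (hj : j ≤ j') (h : CostLE (scan I c moves z acc j) t) :
    CostLE (scan I c moves z acc j') t := by
  induction j', hj using Nat.le_induction with
  | base => exact h
  | succ j' _ ih => exact CostLE.sweep ih

theorem nextPoint_spec (hker : ∀ g ∈ moves, ∀ w ∈ g.2, T.mulVec g.1 + W.mulVec w = 0)
    {p : ℤ × TwoStagePoint m n I.N} (hp : IsFeasiblePair T W I c p) :
    scan I c moves p.2 (some p) (Nat.size I.bound) = some (nextPoint I c moves p) ∧
      IsFeasiblePair T W I c (nextPoint I c moves p) ∧ (nextPoint I c moves p).1 ≤ p.1 := by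
  obtain ⟨q, hq, hqp⟩ := CostLE.scan (I := I) (c := c) (moves := moves) (z := p.2)
    (Nat.zero_le (Nat.size I.bound)) (show CostLE (_root_.scan I c moves p.2 (some p) 0) p.1 from
      ⟨p, rfl, le_rfl⟩)
  have h1 : nextPoint I c moves p = q := by rw [nextPoint, hq, Option.getD_some]
  rw [h1]
  exact ⟨hq, scan_valid hker hp.1 (fun r hr => by obtain rfl := Option.mem_some.1 hr; exact hp)
    _ q hq, hqp⟩

/-- The absolute row sums of `C` and `D`. -/
def rowBound (C : Matrix (Fin s) (Fin m) ℤ) (D : Matrix (Fin s) (Fin n) ℤ) : ℕ :=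
  -- The summand `1` covers the entries of `x` and `y` themselves.
  1 + ∑ j, (∑ k, (C j k).natAbs + ∑ k, (D j k).natAbs)

theorem coords_natAbs_le {M : ℕ} {u : Fin m → ℤ} {w : Fin n → ℤ} (hu : ∀ k, (u k).natAbs ≤ M)
    (hw : ∀ k, (w k).natAbs ≤ M) (j) : (coords C D u w j).natAbs ≤ rowBound C D * M := by
  rcases j with k | k | j
  · exact (hu k).trans (Nat.le_mul_of_pos_left _ (by unfold rowBound; omega))
  · exact (hw k).trans (Nat.le_mul_of_pos_left _ (by unfold rowBound; omega))
  · have h1 : ∑ k, (C j k).natAbs + ∑ k, (D j k).natAbs ≤ rowBound C D := by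
      have := Finset.single_le_sum (f := fun j => ∑ k, (C j k).natAbs + ∑ k, (D j k).natAbs)
        (fun _ _ => Nat.zero_le _) (Finset.mem_univ j)
      unfold rowBound
      omega
    refine le_trans ?_ (Nat.mul_le_mul_right M h1)
    rw [add_mul, Finset.sum_mul, Finset.sum_mul]
    refine (Int.natAbs_add_le _ _).trans (Nat.add_le_add ?_ ?_)
    · rw [Matrix.mulVec, dotProduct]
      refine (Int.natAbs_sum_le _ _).trans (Finset.sum_le_sum fun k _ => ?_)
      rw [Int.natAbs_mul]
      exact Nat.mul_le_mul_left _ (hu k)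
    · rw [Matrix.mulVec, dotProduct]
      refine (Int.natAbs_sum_le _ _).trans (Finset.sum_le_sum fun k _ => ?_)
      rw [Int.natAbs_mul]
      exact Nat.mul_le_mul_left _ (hw k)

/-- A bound for the number of binary digits in the difference of two feasible points. -/
def digitBound (C : Matrix (Fin s) (Fin m) ℤ) (D : Matrix (Fin s) (Fin n) ℤ)
    (I : TwoStageData d m n) : ℕ :=
  -- There are `m + (n + s)` entries per scenario, each of absolute value at most `rowBound C D *
  -- I.bound`.
  I.N * ((m + (n + s)) * (Nat.size (rowBound C D) + Nat.size I.bound))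

theorem natAbs_sub_le_of_inBox {k : ℕ} {y y' u : Fin k → ℤ} {M : ℕ} (h : InBox y u)
    (h' : InBox y' u) (hu : ∀ k, u k ≤ M) (j : Fin k) : ((y' - y) j).natAbs ≤ M := by
  have h1 : 0 ≤ y j := h.1 j
  have h2 : y j ≤ u j := h.2 j
  have h3 : 0 ≤ y' j := h'.1 j
  have h4 : y' j ≤ u j := h'.2 j
  have := hu j
  rw [Pi.sub_apply]
  omega

theorem digits_le {z z' : TwoStagePoint m n I.N} (hz : z.InBounds I) (hz' : z'.InBounds I) :
    digits C D (z'.x - z.x) (fun i => z'.y i - z.y i) ≤ digitBound C D I := by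
  obtain ⟨-, hux, huy⟩ := TwoStageData.natAbs_le_bound hz
  calc _ ≤ ∑ _i : Fin I.N, ∑ _c : Fin m ⊕ Fin n ⊕ Fin s,
        (Nat.size (rowBound C D) + Nat.size I.bound) :=
        Finset.sum_le_sum fun i _ => Finset.sum_le_sum fun j _ =>
          (Nat.size_le_size (coords_natAbs_le (natAbs_sub_le_of_inBox hz.1 hz'.1 hux)
            (natAbs_sub_le_of_inBox (hz.2 i) (hz'.2 i) (huy i)) j)).trans (Nat.size_mul_le _ _)
    _ = digitBound C D I := by simp [digitBound]

/-- Each entry of `y + h` lies between those of `y` and `y'`. Thus conformal steps towards a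
feasible point stay within the bounds. -/
theorem inBox_add_of_conf {k : ℕ} {y y' u h : Fin k → ℤ} (hy : InBox y u) (hy' : InBox y' u)
    (hc : ∀ j, Conf (h j) ((y' - y) j)) : InBox (y + h) u := by
  have key : ∀ j, 0 ≤ y j + h j ∧ y j + h j ≤ u j := fun j => by
    have h1 : 0 ≤ y j := hy.1 j
    have h2 : y j ≤ u j := hy.2 j
    have h3 : 0 ≤ y' j := hy'.1 j
    have h4 : y' j ≤ u j := hy'.2 j
    have h5 := hc j
    simp only [Conf, Pi.sub_apply] at h5
    omega
  exact ⟨fun j => (key j).1, fun j => (key j).2⟩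

/-- A nonzero integer has absolute value at least `1`, so `2 ^ k` is at most the entry it has to fit
into. This limits the step lengths that have to be tried. -/
theorem two_pow_le_of_conf {k : ℕ} {a b : ℤ} {M : ℕ} (ha : a ≠ 0) (h : Conf (2 ^ k * a) b)
    (hb : b.natAbs ≤ M) : 2 ^ k ≤ M := by
  have h1 : (2 ^ k * a).natAbs ≤ b.natAbs := by unfold Conf at h; omega
  rw [Int.natAbs_mul, Int.natAbs_pow] at h1
  have h2 : 0 < a.natAbs := Int.natAbs_pos.2 ha
  calc 2 ^ k ≤ 2 ^ k * a.natAbs := Nat.le_mul_of_pos_right _ h2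
    _ ≤ M := h1.trans hb

theorem cost_cast {F : Fin I.N → Fin s → ℝ → ℝ}
    (hc : ∀ i x y, (c i x y : ℝ) = scenarioCost C D (F i) (realVec x, realVec y))
    (z : TwoStagePoint m n I.N) :
    totalCost (fun i => scenarioCost C D (F i)) z = (z.cost c : ℝ) := by
  simp only [totalCost, TwoStagePoint.cost, ← hc, Int.cast_sum]

/-- An augmentation step closes a good part of the gap to any other feasible point. -/
theorem gap_le (hker : ∀ g ∈ moves, ∀ w ∈ g.2, T.mulVec g.1 + W.mulVec w = 0)
    (hmoves : ∀ (N : ℕ) (u : Fin m → ℤ) (w : Fin N → Fin n → ℤ), 0 < N →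
      (∀ i, T.mulVec u + W.mulVec (w i) = 0) → (u ≠ 0 ∨ ∃ i, w i ≠ 0) →
      ∃ g ∈ moves, ∃ w' : Fin N → Fin n → ℤ, (∀ i, w' i ∈ g.2) ∧ (g.1 ≠ 0 ∨ ∃ i, w' i ≠ 0) ∧
        ∀ i j, Conf (coords C D g.1 (w' i) j) (coords C D u (w i) j))
    {F : Fin I.N → Fin s → ℝ → ℝ} (hF : ∀ i j, ConvexOn ℝ Set.univ (F i j))
    (hc : ∀ i x y, (c i x y : ℝ) = scenarioCost C D (F i) (realVec x, realVec y))
    {p : ℤ × TwoStagePoint m n I.N} (hp : IsFeasiblePair T W I c p) {z' : TwoStagePoint m n I.N}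
    (hz' : I.Feasible T W z') :
    p.1 - z'.cost c ≤ digitBound C D I * (p.1 - (nextPoint I c moves p).1) := by
  obtain ⟨hscan, -, hle⟩ := nextPoint_spec hker hp
  obtain ⟨hpf, hpc⟩ := hp
  -- Without scenarios `exists_moves` is not available, but then all costs vanish.
  rcases Nat.eq_zero_or_pos I.N with hN | hN
  · have h0 : ∀ z : TwoStagePoint m n I.N, z.cost c = 0 := fun z => by
      have : IsEmpty (Fin I.N) := by rw [hN]; infer_instance
      simp [TwoStagePoint.cost]
    have h1 : digitBound C D I = 0 := by simp [digitBound, hN]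
    rw [h1, hpc, h0, h0]
    simp
  obtain ⟨-, hux, huy⟩ := TwoStageData.natAbs_le_bound hpf.inBounds
  have hdx := natAbs_sub_le_of_inBox hpf.inBounds.1 hz'.inBounds.1 hux
  have hdy := fun i => natAbs_sub_le_of_inBox (hpf.inBounds.2 i) (hz'.inBounds.2 i) (huy i)
  -- Here `δ` is the gain of the augmentation step: every conformal dyadic step is among the scanned
  -- ones and gains no more.
  have hkey := totalCost_le_shift (C := C) (D := D) hker hmoves hN hF p.2
    (δ := ((p.1 - (nextPoint I c moves p).1 : ℤ) : ℝ)) (by exact_mod_cast sub_nonneg.2 hle)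
    (u := z'.x - p.2.x) (w := fun i => z'.y i - p.2.y i)
    (fun i => by
      rw [Matrix.mulVec_sub, Matrix.mulVec_sub, sub_add_sub_comm, (hz'.2 i).1, (hpf.2 i).1,
        sub_self])
    (fun k g hg w' hw' hne hconf => by
      have hb : (p.2.shift ((2 : ℤ) ^ k • g.1) fun i => (2 : ℤ) ^ k • w' i).InBounds I :=
        ⟨inBox_add_of_conf hpf.inBounds.1 hz'.inBounds.1 fun j => hconf ⟨0, hN⟩ (.inl j),
          fun i => inBox_add_of_conf (hpf.inBounds.2 i) (hz'.inBounds.2 i) fun j =>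
            hconf i (.inr (.inl j))⟩
      -- A nonzero move has a nonzero entry in its `x` or `y` part, where the difference of the
      -- points is at most `I.bound`.
      have hk : k < Nat.size I.bound := by
        rw [Nat.lt_size]
        rcases hne with hne | ⟨i, hne⟩
        · obtain ⟨j, hj⟩ := Function.ne_iff.1 hne
          exact two_pow_le_of_conf hj (hconf ⟨0, hN⟩ (.inl j)) (hdx j)
        · obtain ⟨j, hj⟩ := Function.ne_iff.1 hne
          exact two_pow_le_of_conf hj (hconf i (.inr (.inl j))) (hdy i j)
      have h1 : CostLE (scan I c moves p.2 (some p) (k + 1)) _ :=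
        sweep_le hg (stepCand_le (c := c) hw' hb)
      obtain ⟨q, hq, hqc⟩ := h1.scan hk
      rw [hscan, Option.some.injEq] at hq
      subst hq
      rw [cost_cast hc, cost_cast hc, ← hpc]
      push_cast
      have : ((nextPoint I c moves p).1 : ℝ) ≤ _ := Int.cast_le.2 hqc
      linarith)
  have hshift : p.2.shift (z'.x - p.2.x) (fun i => z'.y i - p.2.y i) = z' := by
    simp [TwoStagePoint.shift]
  rw [hshift, cost_cast hc, cost_cast hc, ← hpc] at hkey
  have h2 : (digits C D (z'.x - p.2.x) (fun i => z'.y i - p.2.y i) : ℤ) ≤ digitBound C D I :=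
    Nat.cast_le.2 (digits_le hpf.inBounds hz'.inBounds)
  have h3 := mul_le_mul_of_nonneg_right h2 (sub_nonneg.2 hle)
  have h4 : p.1 ≤ z'.cost c + digits C D (z'.x - p.2.x) (fun i => z'.y i - p.2.y i) *
      (p.1 - (nextPoint I c moves p).1) := by exact_mod_cast hkey
  linarith

end Correctness

/-! ### The optimization program -/

section Optimizer

variable {d m n s : ℕ}

/-- The sum of all upper bounds of a problem. -/
def boundProg (m n : ℕ) : Prog :=
  .seq (.pair (.seq .fst (.vecSum m)) (.seq .snd (.sum (.seq .snd (.vecSum n))))) .add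

/-- Started on a candidate, `(1, (z, I))` and a bound: the best one of the candidate and all steps
`2 ^ k g` with `2 ^ k` up to the bound. -/
def scanProg (cp : Prog) (moves : List ((Fin m → ℤ) × List (Fin n → ℤ))) : Prog :=
  -- The guard is `M - 2 ^ j + 1`, which is positive exactly if `2 ^ j ≤ M`.
  .seq (.loop (.seq (.pair (.seq (.pair (.rest 2) (.seq (.nth 1) .fst)) .sub)
      (.const (.num 1))) .add)
    (.pair (.seq (.pair .fst (.nth 1)) (sweepProg cp moves))
      (.pair (.pair (.seq (.pair (.seq (.nth 1) .fst) (.seq (.nth 1) .fst)) .add)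
        (.seq (.nth 1) .snd)) (.rest 2)))) .fst

/-- Started on a flag, a candidate, the problem, the bound and a list of points: augments as long
as possible.  Returns the last candidate and the list of all points before it, the last one
first. -/
def augmentProg (cp : Prog) (moves : List ((Fin m → ℤ) × List (Fin n → ℤ))) : Prog :=
  .seq (.loop .fst
    (.seq (.pair (.seq (.pair (.nth 1) (.pair (.pair (.const (.num 1))
        (.pair (.seq (.nth 1) .snd) (.nth 2))) (.nth 3))) (scanProg cp moves)) .id)
      -- The new flag is the old cost minus the new one, so the loop ends as soon as nothing is
      -- gained.
      (.pair (.seq (.pair (.seq (.nth 2) .fst) (.seq .fst .fst)) .sub)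
        (.pair .fst (.pair (.nth 3) (.pair (.nth 4) (.pair (.seq (.nth 2) .snd) (.rest 5))))))))
    (.pair (.nth 1) (.rest 4))

/-- Started on the problem and a feasible point: an optimal point with its cost, and the reversed
augmentation path. -/
def optimizeProg (cp : Prog) (moves : List ((Fin m → ℤ) × List (Fin n → ℤ))) : Prog :=
  -- A step along the zero move serves to compute the cost of the starting point.
  .seq (.pair (.seq (.pair (.const (.num 1)) (.pair .snd .fst)) (stepProg cp ((0 : Fin m → ℤ),
      [(0 : Fin n → ℤ)]))) (.pair .fst (.pair (.seq .fst (boundProg m n)) (.const (.num 0)))))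
    (.seq (.pair (.const (.num 1)) .id) (augmentProg cp moves))

variable {S : Type} {K : Ctx S} {I : S → TwoStageData d m n}
  {c : (s : S) → Fin (I s).N → (Fin m → ℤ) → (Fin n → ℤ) → ℤ} {cp : Prog}
  {moves : List ((Fin m → ℤ) × List (Fin n → ℤ))}

/-- The size of all intermediate candidates enters as a hypothesis. It is met later because these
candidates are feasible points, whose size does not accumulate over the rounds. -/
theorem comp_scan (hcp : CostProg K c cp) {z : (s : S) → TwoStagePoint m n (I s).N}
    {acc : (s : S) → Option (ℤ × TwoStagePoint m n (I s).N)} {M : S → ℕ}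
    (hI : PolySize K.len fun s => (I s).encode) (hz : PolySize K.len fun s => (z s).encode)
    (hM : PolySize K.len fun s => .num (M s : ℤ))
    (hacc : PolySize (K.comap fun x : Σ s, Fin (Nat.size (M s) + 1) => x.1).len fun x =>
      .ofCand TwoStagePoint.encode
        (scan (I x.1) (c x.1) moves (z x.1) (acc x.1) x.2)) :
    Comp K (scanProg cp moves)
      (fun s => .pair (.ofCand TwoStagePoint.encode (acc s))
        (.pair (.pair (.num 1) (.pair (z s).encode (I s).encode)) (.num (M s : ℤ))))
      fun s => .ofCand TwoStagePoint.encode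
        (scan (I s) (c s) moves (z s) (acc s) (Nat.size (M s))) := by
  have hn : PolyBdd K.len fun s => Nat.size (M s) := hM.natAbs
  have hpow : ∀ k : S → ℕ, (∀ s, k s ≤ Nat.size (M s) + 1) →
      PolySize (K.comap fun x : Σ s, Fin (k s) => x.1).len fun x => .num ((2 : ℤ) ^ (x.2 : ℕ)) :=
    fun k hk => .num <| ((hn.comap Sigma.fst).add (PolyBdd.const 1)).mono fun x => by
      rw [Int.natAbs_pow]
      have h1 := x.2.2
      have h2 := hk x.1
      exact Nat.size_le.2 (Nat.pow_lt_pow_right (by norm_num) (by omega))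
  have hst : ∀ k : S → ℕ, (∀ s, k s ≤ Nat.size (M s) + 1) →
      PolySize (K.comap fun x : Σ s, Fin (k s) => x.1).len fun x =>
        .pair (.ofCand TwoStagePoint.encode (scan (I x.1) (c x.1) moves (z x.1) (acc x.1) x.2))
        (.pair (.pair (.num ((2 : ℤ) ^ (x.2 : ℕ))) (.pair (z x.1).encode (I x.1).encode))
          (.num (M x.1 : ℤ))) := fun k hk =>
    (hacc.comap fun x : Σ s, Fin (k s) =>
      (⟨x.1, ⟨x.2, x.2.2.trans_le (hk x.1)⟩⟩ : Σ s, Fin (Nat.size (M s) + 1))).pair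
      (((hpow k hk).pair ((hz.comap Sigma.fst).pair (hI.comap Sigma.fst))).pair
        (hM.comap Sigma.fst))
  have h0 := hst (fun s => Nat.size (M s) + 1) fun _ => le_rfl
  have h1 := hst (fun s => Nat.size (M s)) fun _ => Nat.le_succ _
  have hsweep := comp_sweep (K := K.comap fun x : Σ s, Fin (Nat.size (M s)) => x.1)
    (I := fun x => I x.1) (c := fun x => c x.1) (hcp.comap Sigma.fst) (hI.comap Sigma.fst)
    (hz.comap Sigma.fst) (hpow _ fun _ => Nat.le_succ _) moves h1.left
  have hloop := Comp.loop (K := K) (c := .seq (.pair (.seq (.pair (.rest 2)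
      (.seq (.nth 1) .fst)) .sub) (.const (.num 1))) .add)
    (p := .pair (.seq (.pair .fst (.nth 1)) (sweepProg cp moves))
      (.pair (.pair (.seq (.pair (.seq (.nth 1) .fst) (.seq (.nth 1) .fst)) .add)
        (.seq (.nth 1) .snd)) (.rest 2)))
    (st := fun s j => .pair (.ofCand TwoStagePoint.encode
      (scan (I s) (c s) moves (z s) (acc s) j))
        (.pair (.pair (.num ((2 : ℤ) ^ j)) (.pair (z s).encode (I s).encode)) (.num (M s : ℤ))))
    (cv := fun s j => .num ((M s : ℤ) - 2 ^ j + 1)) (n := fun s => Nat.size (M s)) hn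
    (.sl (by simp [Prog.IsSL]) h0 fun _ => rfl)
    (fun s j hj => by
      have : ((2 ^ j : ℕ) : ℤ) ≤ M s := Nat.cast_le.2 (Nat.lt_size.1 hj)
      push_cast at this
      change 0 < _
      omega)
    (fun s h => by
      have h2 : ((M s : ℕ) : ℤ) < (2 ^ Nat.size (M s) : ℕ) := Nat.cast_lt.2 (Nat.lt_size_self _)
      push_cast at h2
      change 0 < _ at h
      omega)
    (((Comp.sl (by simp [Prog.IsSL]) h1 fun _ => rfl).seq hsweep).pair
      (.sl (by simp [Prog.IsSL]) h1 fun x => by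
        rw [pow_succ, mul_two]
        rfl))
  simp only [pow_zero] at hloop
  exact hloop.seq (.sl trivial hloop.polySize_out fun _ => rfl)

theorem comp_bound (hI : PolySize K.len fun s => (I s).encode)
    (hb : ∀ s, ∃ z : TwoStagePoint m n (I s).N, z.InBounds (I s)) :
    Comp K (boundProg m n) (fun s => (I s).encode) fun s => .num ((I s).bound : ℤ) := by
  obtain ⟨hN, hux, hsc, hb', huy⟩ := hI.scenarios
  have h1 := Comp.sum (f := fun s i => ∑ k, (I s).uy i k) (body := .seq .snd (.vecSum n)) hsc
    (.sl (by simp [Prog.IsSL]) hsc.get fun x => Prog.eval_vecSum n _)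
  have h2 := (Comp.sl (K := K) (p := .seq .fst (.vecSum m)) (by simp [Prog.IsSL]) hI
    fun s => Prog.eval_vecSum m (I s).ux).pair
      ((Comp.sl (K := K) (p := .snd) trivial hI fun _ => rfl).seq h1)
  refine h2.seq (.sl trivial h2.polySize_out fun s => ?_)
  obtain ⟨z, hz⟩ := hb s
  rw [(TwoStageData.natAbs_le_bound hz).1]
  rfl

variable {T : Matrix (Fin d) (Fin m) ℤ} {W : Matrix (Fin d) (Fin n) ℤ}

/-- Feasible points and their costs have polynomial size. -/
theorem polySize_feasible (hcp : CostProg K c cp) (hI : PolySize K.len fun s => (I s).encode)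
    {J : Type} (φ : J → S) (p : (t : J) → ℤ × TwoStagePoint m n (I (φ t)).N)
    (hp : ∀ t, IsFeasiblePair T W (I (φ t)) (c (φ t)) (p t)) :
    PolySize (K.comap φ).len fun t => .ofCand TwoStagePoint.encode (some (p t)) := by
  obtain ⟨hN, hux, hsc, hb', huy⟩ := hI.scenarios
  have hle : ∀ {a b : ℤ}, 0 ≤ a → a ≤ b → Nat.size a.natAbs ≤ Nat.size b.natAbs :=
    fun h1 h2 => Nat.size_le_size (by omega)
  have hx : PolySize (K.comap φ).len fun t => .ofVec (p t).2.x := PolySize.ofVec fun k =>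
    ((hux.comap φ).entry k).mono fun t => hle ((hp t).1.1.1 k) ((hp t).1.1.2 k)
  have hy : PolySize (K.comap fun x : Σ t, Fin (I (φ t)).N => φ x.1).len fun x =>
      .ofVec ((p x.1).2.y x.2) := PolySize.ofVec fun k =>
    ((huy.comap fun x : Σ t, Fin (I (φ t)).N => (⟨φ x.1, x.2⟩ : Σ s, Fin (I s).N)).entry k).mono fun x =>
      hle (((hp x.1).1.2 x.2).2.1 k) (((hp x.1).1.2 x.2).2.2 k)
  -- Costs are outputs of a polynomial-time program and hence have polynomial length.
  have hcost := (hcp (fun x : Σ t, Fin (I (φ t)).N => φ x.1) (fun x => x.2)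
    (fun x => (p x.1).2.x) (fun x => (p x.1).2.y x.2) (hx.comap Sigma.fst) hy).polySize_out
  have h1 := PolySize.sum_num (hN.comap φ) (z := fun t i => c (φ t) i (p t).2.x ((p t).2.y i)) hcost
  refine PolySize.pair ?_ (hx.pair (PolySize.ofFn (hN.comap φ) hy))
  refine cast (congrArg _ (funext fun t => ?_)) h1
  rw [(hp t).2]
  rfl

end Optimizer

/-! ### Length and limit of the augmentation sequence -/

section Optimizer

variable {d m n s : ℕ} {T : Matrix (Fin d) (Fin m) ℤ} {W : Matrix (Fin d) (Fin n) ℤ}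
  {C : Matrix (Fin s) (Fin m) ℤ} {D : Matrix (Fin s) (Fin n) ℤ}
  {moves : List ((Fin m → ℤ) × List (Fin n → ℤ))}

/-- The decrease of a sequence in its last step, and `1` before the first step. -/
def lastDecrease (g : ℕ → ℤ) : ℕ → ℤ
  -- The positive initial flag makes the loop run at least once.
  | 0 => 1
  | j + 1 => g j - g (j + 1)

section Iterates

variable {I : TwoStageData d m n} {c : Fin I.N → (Fin m → ℤ) → (Fin n → ℤ) → ℤ}

/-- The sequence of points constructed by the augmentation algorithm. -/
noncomputable def iterate (I : TwoStageData d m n)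
    (c : Fin I.N → (Fin m → ℤ) → (Fin n → ℤ) → ℤ)
    (moves : List ((Fin m → ℤ) × List (Fin n → ℤ))) (p : ℤ × TwoStagePoint m n I.N) :
    ℕ → ℤ × TwoStagePoint m n I.N
  | 0 => p
  | j + 1 => nextPoint I c moves (iterate I c moves p j)

theorem iterate_feasible (hker : ∀ g ∈ moves, ∀ w ∈ g.2, T.mulVec g.1 + W.mulVec w = 0)
    {p : ℤ × TwoStagePoint m n I.N} (hp : IsFeasiblePair T W I c p) (j : ℕ) :
    IsFeasiblePair T W I c (iterate I c moves p j) := by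
  induction j with
  | zero => exact hp
  | succ j ih => exact (nextPoint_spec hker ih).2.1

theorem iterate_le (hker : ∀ g ∈ moves, ∀ w ∈ g.2, T.mulVec g.1 + W.mulVec w = 0)
    {p : ℤ × TwoStagePoint m n I.N} (hp : IsFeasiblePair T W I c p) {i j : ℕ} (hij : i ≤ j) :
    (iterate I c moves p j).1 ≤ (iterate I c moves p i).1 := by
  induction j, hij using Nat.le_induction with
  | base => exact le_rfl
  | succ j _ ih => exact (nextPoint_spec hker (iterate_feasible hker hp j)).2.2.trans ih

/-- By `gap_le`, with the `k`-th iterate as the target, every earlier step closes a fixed fraction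
of the gap to that iterate. No optimal solution has to be known to exist. -/
theorem iterate_count_le (hker : ∀ g ∈ moves, ∀ w ∈ g.2, T.mulVec g.1 + W.mulVec w = 0)
    (hmoves : ∀ (N : ℕ) (u : Fin m → ℤ) (w : Fin N → Fin n → ℤ), 0 < N →
      (∀ i, T.mulVec u + W.mulVec (w i) = 0) → (u ≠ 0 ∨ ∃ i, w i ≠ 0) →
      ∃ g ∈ moves, ∃ w' : Fin N → Fin n → ℤ, (∀ i, w' i ∈ g.2) ∧ (g.1 ≠ 0 ∨ ∃ i, w' i ≠ 0) ∧
        ∀ i j, Conf (coords C D g.1 (w' i) j) (coords C D u (w i) j))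
    {F : Fin I.N → Fin s → ℝ → ℝ} (hF : ∀ i j, ConvexOn ℝ Set.univ (F i j))
    (hc : ∀ i x y, (c i x y : ℝ) = scenarioCost C D (F i) (realVec x, realVec y))
    {p : ℤ × TwoStagePoint m n I.N} (hp : IsFeasiblePair T W I c p) {k : ℕ}
    (hk : ∀ j < k, (iterate I c moves p (j + 1)).1 < (iterate I c moves p j).1) :
    k ≤ digitBound C D I * (Nat.size p.1.natAbs +
      Nat.size (iterate I c moves p k).1.natAbs) := by
  have h0 := fun j (hj : j ≤ k) => iterate_le hker hp hj
  have h1 := length_le_of_geometric_decrease (Φ := digitBound C D I) (n := k)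
    (g := fun j => ((iterate I c moves p j).1 - (iterate I c moves p k).1).toNat)
    (fun j hj => by
      have h2 := hk j hj
      have h3 : _ ≤ (iterate I c moves p (j + 1)).1 := h0 (j + 1) hj
      omega)
    (fun j hj => by
      have h2 := gap_le hker hmoves hF hc (iterate_feasible hker hp j)
        (iterate_feasible hker hp k).1
      rw [← (iterate_feasible hker hp k).2] at h2
      change _ ≤ _ * (_ - (iterate I c moves p (j + 1)).1) at h2
      have h3 := hk j hj
      have h4 : _ ≤ (iterate I c moves p (j + 1)).1 := h0 (j + 1) hj
      have h5 : ((((iterate I c moves p j).1 - (iterate I c moves p k).1).toNat -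
          ((iterate I c moves p (j + 1)).1 - (iterate I c moves p k).1).toNat : ℕ) : ℤ) =
          (iterate I c moves p j).1 - (iterate I c moves p (j + 1)).1 := by omega
      rw [← h5] at h2
      zify [h3.le]
      rw [Int.toNat_of_nonneg (by omega)]
      exact h2)
  refine h1.trans (Nat.mul_le_mul_left _ ?_)
  refine (Nat.size_le_size ?_).trans (Nat.size_add_le _ _)
  change (p.1 - _).toNat ≤ _
  omega

end Iterates

variable {S : Type} {K : Ctx S} {I : S → TwoStageData d m n}
  {c : (s : S) → Fin (I s).N → (Fin m → ℤ) → (Fin n → ℤ) → ℤ} {cp : Prog}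

theorem polyBdd_digitBound (hI : PolySize K.len fun s => (I s).encode)
    (hM : PolySize K.len fun s => .num ((I s).bound : ℤ)) :
    PolyBdd K.len fun s => digitBound C D (I s) :=
  hI.scenarios.1.mul ((PolyBdd.const _).mul ((PolyBdd.const _).add hM.natAbs))

/-- Strict improvement lasts only polynomially many rounds, since the costs of feasible points have
polynomially many digits. In the first round without gain the right-hand side of `gap_le` is zero,
which proves optimality. -/
theorem comp_augment (hcp : CostProg K c cp) (hI : PolySize K.len fun s => (I s).encode)
    (hM : PolySize K.len fun s => .num ((I s).bound : ℤ))
    (hker : ∀ g ∈ moves, ∀ w ∈ g.2, T.mulVec g.1 + W.mulVec w = 0)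
    (hmoves : ∀ (N : ℕ) (u : Fin m → ℤ) (w : Fin N → Fin n → ℤ), 0 < N →
      (∀ i, T.mulVec u + W.mulVec (w i) = 0) → (u ≠ 0 ∨ ∃ i, w i ≠ 0) →
      ∃ g ∈ moves, ∃ w' : Fin N → Fin n → ℤ, (∀ i, w' i ∈ g.2) ∧ (g.1 ≠ 0 ∨ ∃ i, w' i ≠ 0) ∧
        ∀ i j, Conf (coords C D g.1 (w' i) j) (coords C D u (w i) j))
    {F : (x : S) → Fin (I x).N → Fin s → ℝ → ℝ} (hF : ∀ x i j, ConvexOn ℝ Set.univ (F x i j))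
    (hc : ∀ t i x y, (c t i x y : ℝ) = scenarioCost C D (F t i) (realVec x, realVec y))
    {p : (x : S) → ℤ × TwoStagePoint m n (I x).N}
    (hp : ∀ x, IsFeasiblePair T W (I x) (c x) (p x)) :
    ∃ (p' : (x : S) → ℤ × TwoStagePoint m n (I x).N)
      (path : (x : S) → List (TwoStagePoint m n (I x).N)),
      (∀ x, IsFeasiblePair T W (I x) (c x) (p' x)) ∧
      (∀ x z', (I x).Feasible T W z' → (p' x).1 ≤ z'.cost (c x)) ∧
      (∀ x, AugmentsToOptimality T W (I x) (fun i => scenarioCost C D (F x i)) (p x).2 (path x)) ∧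
      Comp K (augmentProg cp moves)
        (fun x => .pair (.num 1) (.pair (.ofCand TwoStagePoint.encode (some (p x)))
          (.pair (I x).encode (.pair (.num ((I x).bound : ℤ)) (.num 0)))))
        fun x => .pair (.ofCand TwoStagePoint.encode (some (p' x)))
          (.ofList ((path x).map TwoStagePoint.encode).reverse) := by
  let it := fun x j => iterate (I x) (c x) moves (p x) j
  have hit : ∀ x j, IsFeasiblePair T W (I x) (c x) (it x j) := fun x j =>
    iterate_feasible hker (hp x) j
  let fl := fun x j => lastDecrease (fun j => (it x j).1) j
  -- One polynomial for the costs of all feasible points of all instances, needed before the number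
  -- of rounds is known.
  obtain ⟨P, hP⟩ := (polySize_feasible hcp hI
    (φ := fun t : Σ x, {p // IsFeasiblePair T W (I x) (c x) p} => t.1) (fun t => t.2.1)
    fun t => t.2.2).left.natAbs
  have hcount : ∀ x k, (∀ j < k, 0 < fl x (j + 1)) →
      k ≤ digitBound C D (I x) * (P.eval (K.len x) + P.eval (K.len x)) := fun x k hk =>
    (iterate_count_le hker hmoves (hF x) (hc x) (hp x) fun j hj => by
      have : 0 < (it x j).1 - (it x (j + 1)).1 := hk j hj
      change (it x (j + 1)).1 < (it x j).1
      omega).trans (Nat.mul_le_mul_left _ (Nat.add_le_add (hP ⟨x, _, hp x⟩) (hP ⟨x, _, hit x k⟩)))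
  have hlast : ∀ x, ∃ j, ¬ 0 < fl x j := by
    intro x
    by_contra! h
    have := hcount x (digitBound C D (I x) * (P.eval (K.len x) + P.eval (K.len x)) + 1)
      fun j _ => h _
    omega
  let N := fun x => Nat.find (hlast x)
  have hN0 : ∀ x, 0 < N x := fun x => Nat.pos_of_ne_zero fun h => by
    have h1 : ¬ 0 < fl x (N x) := Nat.find_spec (hlast x)
    rw [h] at h1
    exact h1 one_pos
  have hNpoly : PolyBdd K.len N := by
    have h1 : PolyBdd K.len fun x => P.eval (K.len x) := PolyBdd.self.eval P
    refine (((polyBdd_digitBound (C := C) (D := D) hI hM).mul (h1.add h1)).add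
      (PolyBdd.const 1)).mono fun x => ?_
    have := hcount x (N x - 1) fun j hj => not_not.1 (Nat.find_min (hlast x) (by
      change j + 1 < N x; omega))
    omega
  -- sizes of the states
  have hbest : ∀ {J : Type} (φ : J → S) (j : J → ℕ), PolySize (K.comap φ).len fun t =>
      .ofCand TwoStagePoint.encode (some (it (φ t) (j t))) := fun φ j =>
    polySize_feasible hcp hI φ (fun t => it (φ t) (j t)) fun t => hit _ _
  have hfl : ∀ {J : Type} (φ : J → S) (j : J → ℕ), PolySize (K.comap φ).len fun t =>
      .num (fl (φ t) (j t)) := fun φ j => by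
    refine .num (((PolyBdd.const 1).add ((hbest φ fun t => j t - 1).left.natAbs.add
      (hbest φ j).left.natAbs)).mono fun t => ?_)
    rcases h : j t with _ | k
    · change Nat.size 1 ≤ _
      rw [Nat.size_one]
      omega
    · change Nat.size ((it (φ t) k).1 - (it (φ t) (k + 1)).1).natAbs ≤ _
      have h2 := (Nat.size_le_size (Int.natAbs_sub_le (it (φ t) k).1 (it (φ t) (k + 1)).1)).trans
        (Nat.size_add_le _ _)
      rw [Nat.add_sub_cancel]
      omega
  -- The iterates before round `j`. For `j = N x` the final one is left out, because it repeats the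
  -- cost of its predecessor and would break strictness.
  let path := fun x (j : ℕ) => List.ofFn fun i : Fin j => (it x i).2
  have hpath : ∀ {J : Type} (φ : J → S) (j : J → ℕ), (∀ t, j t ≤ N (φ t)) →
      PolySize (K.comap φ).len fun t =>
        .ofList ((path (φ t) (j t)).map TwoStagePoint.encode).reverse := fun φ j hj => by
    have h1 := PolySize.ofFn (L := (K.comap φ).len) (N := j)
      (a := fun t i => (it (φ t) i).2.encode) ((hNpoly.comap φ).mono hj)
      (hbest (fun x : Σ t, Fin (j t) => φ x.1) fun x => x.2).right
    refine PolyBdd.mono h1 fun t => ?_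
    rw [Val.size_ofList_reverse, List.map_ofFn]
    rfl
  have hpath_succ : ∀ x j, ((path x (j + 1)).map TwoStagePoint.encode).reverse =
      (it x j).2.encode :: ((path x j).map TwoStagePoint.encode).reverse := fun x j => by
    simp only [path, List.ofFn_succ_last, List.map_append, List.reverse_append]
    rfl
  have hst : ∀ {J : Type} (φ : J → S) (j : J → ℕ), (∀ t, j t ≤ N (φ t)) →
      PolySize (K.comap φ).len fun t => .pair (.num (fl (φ t) (j t)))
        (.pair (.ofCand TwoStagePoint.encode (some (it (φ t) (j t)))) (.pair (I (φ t)).encode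
          (.pair (.num ((I (φ t)).bound : ℤ))
            (.ofList ((path (φ t) (j t)).map TwoStagePoint.encode).reverse)))) :=
    fun φ j hj => (hfl φ j).pair ((hbest φ j).pair ((hI.comap φ).pair ((hM.comap φ).pair
      (hpath φ j hj))))
  have hscan := comp_scan (K := K.comap fun x : Σ x, Fin (N x) => x.1)
    (I := fun t => I t.1) (c := fun t => c t.1) (moves := moves) (hcp.comap Sigma.fst)
    (z := fun t => (it t.1 t.2).2) (acc := fun t => some (it t.1 t.2))
    (M := fun t => (I t.1).bound) (hI.comap Sigma.fst) (hbest _ _).right (hM.comap Sigma.fst) (by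
      -- The scan starts from an existing candidate, so each intermediate result is a feasible point
      -- with its cost, and the uniform size bound applies.
      have h1 : ∀ t : Σ t : (Σ x, Fin (N x)), Fin (Nat.size (I t.1).bound + 1),
          ∃ q, scan (I t.1.1) (c t.1.1) moves (it t.1.1 t.1.2).2 (some (it t.1.1 t.1.2)) t.2 =
            some q := fun t => by
        obtain ⟨q, hq, -⟩ := CostLE.scan (I := I t.1.1) (c := c t.1.1) (moves := moves)
          (z := (it t.1.1 t.1.2).2) (acc := some (it t.1.1 t.1.2)) (Nat.zero_le t.2)
          ⟨_, rfl, le_rfl⟩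
        exact ⟨q, hq⟩
      choose q hq using h1
      simp only [hq]
      exact polySize_feasible (K := K) hcp hI (fun t => t.1.1) q fun t =>
        scan_valid hker (hit _ _).1 (fun r hr => by
          obtain rfl := Option.mem_some.1 hr; exact hit _ _) _ _ (hq t))
  have hloop := Comp.loop (K := K) (c := .fst)
    (p := .seq (.pair (.seq (.pair (.nth 1) (.pair (.pair (.const (.num 1))
        (.pair (.seq (.nth 1) .snd) (.nth 2))) (.nth 3))) (scanProg cp moves)) .id)
      (.pair (.seq (.pair (.seq (.nth 2) .fst) (.seq .fst .fst)) .sub)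
        (.pair .fst (.pair (.nth 3) (.pair (.nth 4) (.pair (.seq (.nth 2) .snd) (.rest 5)))))))
    (st := fun x j => .pair (.num (fl x j)) (.pair (.ofCand TwoStagePoint.encode
        (some (it x j))) (.pair (I x).encode (.pair (.num ((I x).bound : ℤ))
          (.ofList ((path x j).map TwoStagePoint.encode).reverse)))))
    (cv := fun x j => .num (fl x j)) (n := N) hNpoly
    (.sl trivial (hst _ _ fun x => Nat.le_of_lt_succ x.2.2) fun _ => rfl)
    (fun x j hj => not_not.1 (Nat.find_min (hlast x) hj)) (fun x => Nat.find_spec (hlast x))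
    (by
      have hin := hst (fun x : Σ x, Fin (N x) => x.1) (fun x => x.2) fun x => x.2.2.le
      have h2 := (Comp.seq (Comp.sl (p := .pair (.nth 1) (.pair (.pair (.const (.num 1))
        (.pair (.seq (.nth 1) .snd) (.nth 2))) (.nth 3))) (by simp [Prog.IsSL]) hin
          fun _ => rfl) hscan).pair (Comp.sl (p := .id) trivial hin fun _ => rfl)
      refine h2.seq (.sl (by simp [Prog.IsSL]) h2.polySize_out fun t => ?_)
      rw [(nextPoint_spec hker (hit t.1 t.2)).1, hpath_succ]
      rfl)
  -- The flag at `N x` is not positive and the cost never increases, so the last step gained nothing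
  -- and the iterate before it is optimal.
  have hopt : ∀ x, ∃ k, N x = k + 1 ∧ (it x (N x)).1 = (it x k).1 ∧
      ∀ z', (I x).Feasible T W z' → (it x k).1 ≤ z'.cost (c x) := fun x => by
    obtain ⟨k, hk⟩ : ∃ k, N x = k + 1 := ⟨N x - 1, by have := hN0 x; omega⟩
    have h1 : ¬ 0 < fl x (N x) := Nat.find_spec (hlast x)
    have h3 := (nextPoint_spec (moves := moves) hker (hit x k)).2.2
    rw [hk] at h1
    change ¬ 0 < (it x k).1 - (it x (k + 1)).1 at h1
    change (it x (k + 1)).1 ≤ (it x k).1 at h3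
    have h4 : (it x k).1 - (it x (k + 1)).1 = 0 := by omega
    refine ⟨k, hk, by rw [hk]; omega, fun z' hz' => ?_⟩
    have h2 := gap_le hker hmoves (hF x) (hc x) (hit x k) hz'
    change _ ≤ _ * ((it x k).1 - (it x (k + 1)).1) at h2
    rw [h4, mul_zero] at h2
    omega
  refine ⟨fun x => it x (N x), fun x => path x (N x), fun x => hit _ _, fun x z' hz' => ?_,
    fun x => ?_, hloop.seq (.sl (by simp [Prog.IsSL]) hloop.polySize_out fun _ => rfl)⟩
  · obtain ⟨k, -, h1, h2⟩ := hopt x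
    exact h1.trans_le (h2 z' hz')
  · obtain ⟨k, hk, -, h2⟩ := hopt x
    dsimp only [path]
    refine ⟨?_, ?_, ?_, (it x k).2, ?_, (hit x k).1, fun z' hz' => ?_⟩
    · rw [hk, List.ofFn_succ]
      rfl
    · simp only [List.mem_ofFn, forall_exists_index]
      rintro _ i rfl
      exact (hit x i).1
    · rw [List.isChain_ofFn]
      intro i hi
      rw [cost_cast (hc x), cost_cast (hc x), Int.cast_lt, ← (hit x i).2, ← (hit x (i + 1)).2]
      have h3 : 0 < (it x i).1 - (it x (i + 1)).1 := not_not.1 (Nat.find_min (hlast x) hi)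
      omega
    · rw [hk, List.ofFn_succ_last, List.getLast?_append]
      rfl
    · rw [cost_cast (hc x), cost_cast (hc x), ← (hit x k).2, Int.cast_le]
      exact h2 z' hz'

theorem comp_optimize (hcp : CostProg K c cp) (hI : PolySize K.len fun s => (I s).encode)
    (hker : ∀ g ∈ moves, ∀ w ∈ g.2, T.mulVec g.1 + W.mulVec w = 0)
    (hmoves : ∀ (N : ℕ) (u : Fin m → ℤ) (w : Fin N → Fin n → ℤ), 0 < N →
      (∀ i, T.mulVec u + W.mulVec (w i) = 0) → (u ≠ 0 ∨ ∃ i, w i ≠ 0) →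
      ∃ g ∈ moves, ∃ w' : Fin N → Fin n → ℤ, (∀ i, w' i ∈ g.2) ∧ (g.1 ≠ 0 ∨ ∃ i, w' i ≠ 0) ∧
        ∀ i j, Conf (coords C D g.1 (w' i) j) (coords C D u (w i) j))
    {F : (x : S) → Fin (I x).N → Fin s → ℝ → ℝ} (hF : ∀ x i j, ConvexOn ℝ Set.univ (F x i j))
    (hc : ∀ t i x y, (c t i x y : ℝ) = scenarioCost C D (F t i) (realVec x, realVec y))
    {z : (x : S) → TwoStagePoint m n (I x).N} (hz : ∀ x, (I x).Feasible T W (z x)) :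
    ∃ (z' : (x : S) → TwoStagePoint m n (I x).N)
      (path : (x : S) → List (TwoStagePoint m n (I x).N)),
      (∀ x, IsOptimal T W (I x) (fun i => scenarioCost C D (F x i)) (z' x)) ∧
      (∀ x, AugmentsToOptimality T W (I x) (fun i => scenarioCost C D (F x i)) (z x) (path x)) ∧
      Comp K (optimizeProg cp moves) (fun x => .pair (I x).encode (z x).encode)
        fun x => .pair (.pair (.num ((z' x).cost (c x))) (z' x).encode)
          (.ofList ((path x).map TwoStagePoint.encode).reverse) := by
  have hp : ∀ x, IsFeasiblePair T W (I x) (c x) ((z x).cost (c x), z x) := fun x => ⟨hz x, rfl⟩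
  have hb := comp_bound hI fun x => ⟨z x, (hz x).inBounds⟩
  obtain ⟨p', path, hp', hopt, hpath, haug⟩ := comp_augment (C := C) (D := D) hcp hI
    hb.polySize_out hker hmoves hF hc hp
  refine ⟨fun x => (p' x).2, path, fun x => ⟨(hp' x).1, fun z'' hz'' => ?_⟩, hpath, ?_⟩
  · rw [cost_cast (hc x), cost_cast (hc x), ← (hp' x).2]
    exact Int.cast_le.2 (hopt x z'' hz'')
  have hz0 := (polySize_feasible (K := K) hcp hI (fun x => x) _ hp).right
  have hin := hI.pair hz0
  have hstep := comp_step hcp hI hz0 (a := fun _ => 1) (.const _)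
    ((0 : Fin m → ℤ), [(0 : Fin n → ℤ)])
  have hcand : ∀ x, stepCand (I x) (c x) (z x) 1 ((0 : Fin m → ℤ), [(0 : Fin n → ℤ)]) =
      some ((z x).cost (c x), z x) := fun x => by
    have hsh : (z x).shift ((1 : ℤ) • (0 : Fin m → ℤ))
        (fun i => (1 : ℤ) • (0 : Fin n → ℤ)) = z x := by simp [TwoStagePoint.shift]
    obtain ⟨q, hq, -⟩ := stepCand_le (I := I x) (c := c x) (z := z x) (a := 1)
      (g := ((0 : Fin m → ℤ), [(0 : Fin n → ℤ)])) (w := fun _ => 0)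
      (fun _ => List.mem_singleton_self _) (hsh.symm ▸ (hz x).inBounds)
    obtain ⟨⟨w, hw, hqw⟩, -, hqc⟩ := stepCand_valid hq
    obtain rfl : w = fun _ => 0 := funext fun i => List.mem_singleton.1 (hw i)
    rw [hsh] at hqw
    rw [hq, ← hqw, ← hqc]
  have h1 := (Comp.seq (Comp.sl (K := K) (p := .pair (.const (.num 1)) (.pair .snd .fst))
    (by simp [Prog.IsSL]) hin fun _ => rfl) hstep).pair ((Comp.sl (p := .fst) trivial hin
      fun _ => rfl).pair (((Comp.sl (p := .fst) trivial hin fun _ => rfl).seq hb).pair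
        (Comp.sl (p := .const (.num 0)) trivial hin fun _ => rfl)))
  simp only [hcand] at h1
  refine Comp.congr (h1.seq ((Comp.sl (p := .pair (.const (.num 1)) .id) (by simp [Prog.IsSL])
    h1.polySize_out fun _ => rfl).seq haug)) fun x => ?_
  rw [← (hp' x).2]
  rfl

end Optimizer

/-! ### Augmentation with an evaluation oracle -/

section Oracle

variable {d m n s : ℕ}

/-- An instance of the optimization problem with an evaluation oracle. -/
structure OracleInstance (T : Matrix (Fin d) (Fin m) ℤ) (W : Matrix (Fin d) (Fin n) ℤ)
    (C : Matrix (Fin s) (Fin m) ℤ) (D : Matrix (Fin s) (Fin n) ℤ) (q : Polynomial ℕ) : Type where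
  I : TwoStageData d m n
  F : Fin I.N → Fin s → ℝ → ℝ
  O : Oracle
  L : ℕ
  z₀ : TwoStagePoint m n I.N
  size_le : I.encode.size ≤ L
  convex : ∀ i j, ConvexOn ℝ Set.univ (F i j)
  oracle : IsEvalOracle q L (fun i => scenarioCost C D (F i)) O
  feasible : I.Feasible T W z₀

theorem PolySize.evalQuery {S : Type} {L : S → ℕ} {N : S → ℕ} (hN : PolyBdd L N)
    {i : (t : S) → Fin (N t)} {x : S → Fin m → ℤ} {y : S → Fin n → ℤ}
    (hx : PolySize L fun t => .ofVec (x t)) (hy : PolySize L fun t => .ofVec (y t)) :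
    PolySize L fun t => _root_.evalQuery (i t) (x t) (y t) :=
  (PolySize.num (PolyBdd.mono hN fun t => by
    rw [Int.natAbs_natCast]
    exact (Nat.size_le_self _).trans (i t).2.le)).pair (hx.pair hy)

/-- The time and the answer length of the oracle are polynomial in `L` and the question, and
questions about points of polynomial size have polynomial size. -/
theorem costProg_query {T : Matrix (Fin d) (Fin m) ℤ} {W : Matrix (Fin d) (Fin n) ℤ}
    {C : Matrix (Fin s) (Fin m) ℤ} {D : Matrix (Fin s) (Fin n) ℤ} {q : Polynomial ℕ} :
    CostProg (m := m) (n := n) (S := OracleInstance T W C D q) ⟨fun t => t.L, fun t => t.O⟩ (N := fun t => t.I.N)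
      (fun t i x y => t.O.answer (evalQuery i x y)) .query := by
  intro J φ i x y hx hy
  have hN : PolyBdd (fun t : OracleInstance T W C D q => t.L) fun t => t.I.N :=
    PolyBdd.self.mono fun t => le_trans (by
      rw [TwoStageData.encode, Val.size, Val.size_ofList_ofFn, Finset.sum_add_distrib]
      simp; omega) t.size_le
  have hv := PolySize.evalQuery (hN.comap φ) (i := i) hx hy
  refine Comp.of_polyBdd _ ((((PolyBdd.const 1).add hv).add
    ((PolyBdd.self.add hv).eval q)).mono fun t => ?_) fun t => .query _
  have := ((φ t).oracle (i t) (x t) (y t)).2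
  change _ + _ + _ + (φ t).O.time _ ≤ _
  change _ ≤ 1 + (evalQuery (i t) (x t) (y t)).size +
    q.eval ((φ t).L + (evalQuery (i t) (x t) (y t)).size)
  change 1 + _ + (Val.num ((φ t).O.answer _)).size + _ ≤ _
  omega

/-- Augmentation from a given feasible point.  Since the step lengths are restricted to powers of
two, the candidates are compared by oracle calls, and splitting intervals is not required. -/
theorem exists_augmentation (T : Matrix (Fin d) (Fin m) ℤ) (W : Matrix (Fin d) (Fin n) ℤ)
    (C : Matrix (Fin s) (Fin m) ℤ) (D : Matrix (Fin s) (Fin n) ℤ) :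
    ∃ prog : Prog, ∀ q : Polynomial ℕ, ∃ P : Polynomial ℕ, ∀ t : OracleInstance T W C D q,
      ∃ (path : List (TwoStagePoint m n t.I.N)) (τ : ℕ),
        AugmentsToOptimality T W t.I (fun i => scenarioCost C D (t.F i)) t.z₀ path ∧
        Runs t.O prog (.pair t.I.encode t.z₀.encode) (.ofList (path.map TwoStagePoint.encode)) τ ∧
        τ ≤ P.eval t.L := by
  classical
  obtain ⟨moves, hker, hmoves⟩ := exists_moves T W C D
  -- The program is fixed before `q`, which affects only the time bound. The path was recorded
  -- backwards and is reversed.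
  refine ⟨.seq (optimizeProg .query moves) (.seq .snd .reverse), fun q => ?_⟩
  let K : Ctx (OracleInstance T W C D q) := ⟨fun t => t.L, fun t => t.O⟩
  obtain ⟨z', path, -, hpath, hcomp⟩ := comp_optimize (K := K) (I := fun t => t.I)
    (F := fun t => t.F) costProg_query (PolyBdd.self.mono fun t => t.size_le) hker hmoves
    (fun t => t.convex) (fun t i x y => (t.oracle i x y).1) (fun t => t.feasible)
  obtain ⟨P, hP⟩ := hcomp.seq ((Comp.sl (p := .snd) trivial hcomp.polySize_out fun _ => rfl).seq
    (Comp.reverse hcomp.polySize_out.right))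
  refine ⟨P, fun t => ?_⟩
  obtain ⟨τ, hτ, hr⟩ := hP t
  simp only [List.reverse_reverse] at hr
  exact ⟨path t, τ, hpath t, hr, hτ⟩

end Oracle

/-! ### Feasibility -/

namespace Prog

/-- Appends a list to a vector of length `k`. -/
def append : ℕ → Prog
  | 0 => .snd
  | k + 1 => .pair (.seq .fst .fst) (.seq (.pair (.seq .fst .snd) .snd) (append k))

/-- The first `k` entries of a list. -/
def take : ℕ → Prog
  | 0 => .const (.num 0)
  | k + 1 => .pair .fst (.seq .snd (take k))

/-- The positive parts of the entries of `σ y`. -/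
def clip (σ : ℤ) : ℕ → Prog
  | 0 => .const (.num 0)
  | k + 1 => .pair (.seq (.seq (.pair (.const (.num σ)) .fst) .mul) (.ite .id .id (.const (.num 0))))
      (.seq .snd (clip σ k))

@[simp] theorem isSL_append (k : ℕ) : (append k).IsSL := by
  induction k with
  | zero => trivial
  | succ k ih => simp [append, IsSL, ih]

@[simp] theorem isSL_take (k : ℕ) : (take k).IsSL := by
  induction k with
  | zero => trivial
  | succ k ih => simp [take, IsSL, ih]

@[simp] theorem isSL_clip (σ : ℤ) (k : ℕ) : (clip σ k).IsSL := by
  induction k with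
  | zero => trivial
  | succ k ih => simp [clip, IsSL, ih]

theorem eval_append {k l : ℕ} (v : Fin k → ℤ) (w : Fin l → ℤ) :
    (append k).eval (.pair (.ofVec v) (.ofVec w)) = .ofVec (Fin.append v w) := by
  have key : ∀ (l₁ l₂ : List Val), (append l₁.length).eval (.pair (.ofList l₁) (.ofList l₂)) =
      .ofList (l₁ ++ l₂) := by
    intro l₁ l₂
    induction l₁ with
    | nil => rfl
    | cons a l₁ ih =>
      change Val.pair a ((append l₁.length).eval (.pair (.ofList l₁) (.ofList l₂))) = _
      rw [ih]
      rfl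
  have := key (List.ofFn fun i => .num (v i)) (List.ofFn fun i => .num (w i))
  rw [List.length_ofFn] at this
  refine this.trans ?_
  rw [Val.ofVec, ← List.ofFn_fin_append]
  congr 2
  funext i
  refine Fin.addCases (fun i => ?_) (fun i => ?_) i <;> simp

theorem eval_take {k l : ℕ} (v : Fin (k + l) → ℤ) :
    (take k).eval (.ofVec v) = .ofVec fun i => v (Fin.castAdd l i) := by
  have key : ∀ (l₁ l₂ : List Val), (take l₁.length).eval (.ofList (l₁ ++ l₂)) = .ofList l₁ := by
    intro l₁ l₂
    induction l₁ with
    | nil => rfl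
    | cons a l₁ ih =>
      change Val.pair a ((take l₁.length).eval (.ofList (l₁ ++ l₂))) = _
      rw [ih]
      rfl
  have := key (List.ofFn fun i => .num (v (Fin.castAdd l i)))
    (List.ofFn fun i => .num (v (Fin.natAdd k i)))
  rw [List.length_ofFn] at this
  rw [Val.ofVec, List.ofFn_add]
  exact this

theorem eval_rest {k l : ℕ} (v : Fin (k + l) → ℤ) :
    (rest k).eval (.ofVec v) = .ofVec fun i => v (Fin.natAdd k i) := by
  have key : ∀ (l₁ l₂ : List Val), (rest l₁.length).eval (.ofList (l₁ ++ l₂)) = .ofList l₂ := by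
    intro l₁ l₂
    induction l₁ with
    | nil => rfl
    | cons a l₁ ih => exact ih
  have := key (List.ofFn fun i => .num (v (Fin.castAdd l i)))
    (List.ofFn fun i => .num (v (Fin.natAdd k i)))
  rw [List.length_ofFn] at this
  rw [Val.ofVec, List.ofFn_add]
  exact this

theorem eval_clip (σ : ℤ) (k : ℕ) (y : Fin k → ℤ) :
    (clip σ k).eval (.ofVec y) = .ofVec fun i => max (σ * y i) 0 := by
  induction k with
  | zero => simp [clip, eval, Val.ofVec_zero]
  | succ k ih =>
    rw [Val.ofVec_succ, Val.ofVec_succ]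
    simp only [clip, eval, Val.fst, Val.snd, Val.arith, Val.IsPos, ih]
    congr 1
    by_cases h : 0 < σ * y 0
    · simp [h, h.le]
    · simp [h, not_lt.1 h]

end Prog

section Feasibility

variable {d m n : ℕ}

/-- The matrix `(W, 1, -1)`. -/
def slackMatrix (W : Matrix (Fin d) (Fin n) ℤ) : Matrix (Fin d) (Fin (n + (d + d))) ℤ :=
  Matrix.of fun r => Fin.append (W r) (Fin.append ((1 : Matrix (Fin d) (Fin d) ℤ) r)
    ((-1 : Matrix (Fin d) (Fin d) ℤ) r))

theorem slackMatrix_mulVec (W : Matrix (Fin d) (Fin n) ℤ) (y : Fin (n + (d + d)) → ℤ) :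
    (slackMatrix W).mulVec y = W.mulVec (fun k => y (Fin.castAdd _ k)) +
      ((fun k => y (Fin.natAdd n (Fin.castAdd d k))) -
        fun k => y (Fin.natAdd n (Fin.natAdd d k))) := by
  funext r
  simp only [slackMatrix, Matrix.mulVec, dotProduct, Matrix.of_apply, Fin.sum_univ_add,
    Fin.append_left, Fin.append_right, Pi.add_apply, Pi.sub_apply, Matrix.neg_apply,
    Matrix.one_apply]
  simp [sub_eq_add_neg]

/-- The positive parts of the entries of `σ b`. -/
def clipVec (σ : ℤ) (b : Fin d → ℤ) : Fin d → ℤ := fun k => max (σ * b k) 0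

/-- The bounds `(u, b⁺, b⁻)` or the starting point `(0, b⁺, b⁻)`. -/
def withSlack (u : Fin n → ℤ) (b : Fin d → ℤ) : Fin (n + (d + d)) → ℤ :=
  Fin.append u (Fin.append (clipVec 1 b) (clipVec (-1) b))

/-- The problem with slack variables for all equations. -/
def TwoStageData.relax (I : TwoStageData d m n) : TwoStageData d m (n + (d + d)) where
  N := I.N
  b := I.b
  ux := I.ux
  uy i := withSlack (I.uy i) (I.b i)

/-- The point all of whose nonzero entries are slack variables. -/
def TwoStageData.start (I : TwoStageData d m n) : TwoStagePoint m (n + (d + d)) I.relax.N where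
  x := 0
  y i := withSlack 0 (I.b i)

/-- Removes the slack variables. -/
def TwoStageData.unrelax (I : TwoStageData d m n) (z : TwoStagePoint m (n + (d + d)) I.relax.N) :
    TwoStagePoint m n I.N where
  x := z.x
  y i := fun k => z.y i (Fin.castAdd _ k)

/-- The sum of the slack variables. -/
def slackCost (n d : ℕ) (y : Fin (n + (d + d)) → ℤ) : ℤ := ∑ k, y (Fin.natAdd n k)

/-- The coefficients of the sum of the slack variables. -/
def slackRow (n d : ℕ) : Matrix (Fin 1) (Fin (n + (d + d))) ℤ :=
  Matrix.of fun _ => Fin.append (0 : Fin n → ℤ) 1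

/-- The sum of the slacks is a separable convex cost with a single row and the identity function, so
the augmentation algorithm covers it. -/
theorem slackCost_eq (x : Fin m → ℤ) (y : Fin (n + (d + d)) → ℤ) :
    (slackCost n d y : ℝ) = scenarioCost (0 : Matrix (Fin 1) (Fin m) ℤ) (slackRow n d)
      (fun _ r => r) (realVec x, realVec y) := by
  simp [scenarioCost, slackCost, slackRow, realVec, Fin.sum_univ_add]

theorem inBox_append {k l : ℕ} {y u : Fin k → ℤ} {y' u' : Fin l → ℤ} :
    InBox (Fin.append y y') (Fin.append u u') ↔ InBox y u ∧ InBox y' u' := by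
  simp only [InBox, Pi.le_def, Fin.forall_fin_add, Fin.append_left, Fin.append_right,
    Pi.zero_apply]
  tauto

theorem clipVec_nonneg (σ : ℤ) (b : Fin d → ℤ) : 0 ≤ clipVec σ b := fun _ => le_max_right _ _

theorem clipVec_sub (b : Fin d → ℤ) : clipVec 1 b - clipVec (-1) b = b := by
  funext k
  simp only [clipVec, Pi.sub_apply]
  omega

/-- The bounds of `I` are nonnegative. -/
def TwoStageData.Nonneg (I : TwoStageData d m n) : Prop :=
  -- The double negation matches the test in the program, which counts violating scenarios.
  InBox 0 I.ux ∧ ¬ ∃ i, ¬ InBox 0 (I.uy i)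

namespace TwoStageData

variable {I : TwoStageData d m n} {T : Matrix (Fin d) (Fin m) ℤ} {W : Matrix (Fin d) (Fin n) ℤ}

theorem Feasible.nonneg {z : TwoStagePoint m n I.N} (h : I.Feasible T W z) : I.Nonneg :=
  ⟨⟨le_rfl, h.1.1.trans h.1.2⟩, fun ⟨i, hi⟩ => hi ⟨le_rfl, (h.2 i).2.1.trans (h.2 i).2.2⟩⟩

/-- With all original variables zero, the slacks `b⁺` and `b⁻` satisfy the equations since `b = b⁺ -
b⁻`; they meet their upper bounds with equality. -/
theorem start_feasible (h : I.Nonneg) : I.relax.Feasible T (slackMatrix W) I.start := by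
  refine ⟨⟨le_rfl, h.1.2⟩, fun i => ⟨?_, ?_⟩⟩
  · rw [slackMatrix_mulVec]
    simp only [start, withSlack, relax, Fin.append_left, Fin.append_right]
    change T.mulVec 0 + (W.mulVec 0 + (clipVec 1 (I.b i) - clipVec (-1) (I.b i))) = I.b i
    simp [clipVec_sub]
  · have hb : InBox 0 (I.uy i) := not_not.1 fun hi => h.2 ⟨i, hi⟩
    exact inBox_append.2 ⟨hb, inBox_append.2 ⟨⟨clipVec_nonneg _ _, le_rfl⟩,
      clipVec_nonneg _ _, le_rfl⟩⟩

/-- Nonnegative slacks whose sum is at most zero all vanish, and then the original equations hold.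
-/
theorem unrelax_feasible {z : TwoStagePoint m (n + (d + d)) I.relax.N}
    (hz : I.relax.Feasible T (slackMatrix W) z)
    (hc : z.cost (fun _ _ => slackCost n d) ≤ 0) : I.Feasible T W (I.unrelax z) := by
  have h0 : ∀ i k, 0 ≤ z.y i k := fun i => (hz.2 i).2.1
  have h1 : ∀ i, 0 ≤ slackCost n d (z.y i) := fun i => Finset.sum_nonneg fun k _ => h0 i _
  have h2 : ∀ i, slackCost n d (z.y i) = 0 := fun i =>
    (Finset.sum_eq_zero_iff_of_nonneg fun i _ => h1 i).1
      (le_antisymm hc (Finset.sum_nonneg fun i _ => h1 i)) i (Finset.mem_univ i)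
  have h3 : ∀ i k, z.y i (Fin.natAdd n k) = 0 := fun i k =>
    (Finset.sum_eq_zero_iff_of_nonneg fun k _ => h0 i _).1 (h2 i) k (Finset.mem_univ k)
  refine ⟨hz.1, fun i => ⟨?_, fun k => h0 i _, fun k => ?_⟩⟩
  · have h4 := (hz.2 i).1
    rw [slackMatrix_mulVec] at h4
    have h5 : ((fun k => z.y i (Fin.natAdd n (Fin.castAdd d k))) -
        fun k => z.y i (Fin.natAdd n (Fin.natAdd d k))) = 0 :=
      funext fun k => (congrArg₂ (· - ·) (h3 i _) (h3 i _)).trans (sub_self 0)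
    rw [h5, add_zero] at h4
    exact h4
  · have h4 : z.y i (Fin.castAdd _ k) ≤ withSlack (I.uy i) (I.b i) (Fin.castAdd _ k) :=
      (hz.2 i).2.2 (Fin.castAdd _ k)
    rw [withSlack, Fin.append_left] at h4
    exact h4

theorem exists_relax_feasible {z : TwoStagePoint m n I.N} (hz : I.Feasible T W z) :
    ∃ z' : TwoStagePoint m (n + (d + d)) I.relax.N, I.relax.Feasible T (slackMatrix W) z' ∧
      z'.cost (fun _ _ => slackCost n d) = 0 := by
  refine ⟨⟨z.x, fun i => Fin.append (z.y i) (Fin.append 0 0)⟩, ⟨hz.1, fun i => ⟨?_, ?_⟩⟩, ?_⟩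
  · rw [slackMatrix_mulVec]
    simp only [Fin.append_left, Fin.append_right]
    refine Eq.trans ?_ (hz.2 i).1
    simp
  · exact inBox_append.2 ⟨(hz.2 i).2, inBox_append.2 ⟨⟨le_rfl, clipVec_nonneg _ _⟩, le_rfl,
      clipVec_nonneg _ _⟩⟩
  · refine Finset.sum_eq_zero fun i _ => Finset.sum_eq_zero fun k _ => ?_
    change Fin.append (z.y i) (Fin.append 0 0) (Fin.natAdd n k) = 0
    rw [Fin.append_right]
    exact Fin.addCases (fun k => Fin.append_left 0 0 k) (fun k => Fin.append_right 0 0 k) k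

end TwoStageData

/-- Computes `withSlack u b`; the vector `u` is computed by `p`, and `b` is the first
component. -/
def slackProg (n d : ℕ) (p : Prog) : Prog :=
  .seq (.pair p (.seq (.pair (.seq .fst (.clip 1 d)) (.seq .fst (.clip (-1) d))) (.append d)))
    (.append n)

/-- Computes the relaxed problem and its starting point. -/
def relaxProg (m n d : ℕ) : Prog :=
  .pair (.pair .fst (.seq .snd (.map (.pair .fst (slackProg n d .snd)))))
    (.pair (.const (.ofVec (0 : Fin m → ℤ)))
      (.seq .snd (.map (slackProg n d (.const (.ofVec (0 : Fin n → ℤ)))))))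

theorem eval_slackProg {p : Prog} {v : Val} {b : Fin d → ℤ} {u : Fin n → ℤ}
    (hp : p.eval (.pair (.ofVec b) v) = .ofVec u) :
    (slackProg n d p).eval (.pair (.ofVec b) v) = .ofVec (withSlack u b) := by
  simp only [slackProg, Prog.eval, hp, Val.fst, Prog.eval_clip, Prog.eval_append]
  rfl

theorem isSL_slackProg {p : Prog} (hp : p.IsSL) : (slackProg n d p).IsSL := by
  simp [slackProg, Prog.IsSL, hp]

/-- Decides whether there is a feasible point, and constructs one. -/
def feasibleProg (m n d : ℕ) (moves : List ((Fin m → ℤ) × List (Fin (n + (d + d)) → ℤ))) : Prog :=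
  .ite (.seq (.pair (.const (.ofVec (0 : Fin m → ℤ))) .fst) (.inBox m))
    (.ite (.seq .snd (.sum (.seq (.pair (.const (.num 1)) (.seq (.pair
        (.const (.ofVec (0 : Fin n → ℤ))) .snd) (.inBox n))) .sub))) (.const (.num 0))
      (.seq (.seq (relaxProg m n d)
          (optimizeProg (.seq (.rest 2) (.seq (.rest n) (.vecSum (d + d)))) moves))
        -- A positive minimum of the slack sum means infeasibility.
        (.ite (.seq .fst .fst) (.const (.num 0)) (.seq .fst (.seq .snd
          (.pair .fst (.seq .snd (.map (.take n)))))))))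
    (.const (.num 0))

theorem comp_relax {S : Type} {K : Ctx S} {I : S → TwoStageData d m n}
    (hI : PolySize K.len fun t => (I t).encode) :
    Comp K (relaxProg m n d) (fun t => (I t).encode)
      fun t => .pair (I t).relax.encode (I t).start.encode := by
  obtain ⟨hN, hux, hsc, -, -⟩ := hI.scenarios
  have h1 := Comp.map (out := fun t i => .pair (.ofVec ((I t).b i))
      (.ofVec (withSlack ((I t).uy i) ((I t).b i)))) (body := .pair .fst (slackProg n d .snd)) hsc
    (.sl ⟨trivial, isSL_slackProg trivial⟩ hsc.get fun x => by
      rw [Prog.eval, eval_slackProg rfl]; rfl)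
  have h2 := Comp.map (out := fun t i => .ofVec (withSlack 0 ((I t).b i)))
    (body := slackProg n d (.const (.ofVec (0 : Fin n → ℤ)))) hsc
    (.sl (isSL_slackProg trivial) hsc.get fun x => eval_slackProg rfl)
  have hsnd := Comp.sl (p := .snd) trivial hI fun _ => rfl
  exact ((Comp.sl (p := .fst) trivial hI fun _ => rfl).pair (hsnd.seq h1)).pair
    ((Comp.sl (p := .const _) trivial hI fun _ => rfl).pair (hsnd.seq h2))

theorem costProg_slack {S : Type} {K : Ctx S} {N : S → ℕ} (hN : PolyBdd K.len N) :
    CostProg (m := m) K (N := N) (fun _ _ _ => slackCost n d)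
      (.seq (.rest 2) (.seq (.rest n) (.vecSum (d + d)))) := by
  intro J φ i x y hx hy
  refine .sl (by simp [Prog.IsSL]) (PolySize.evalQuery (hN.comap φ) hx hy) fun t => ?_
  change (Prog.vecSum (d + d)).eval ((Prog.rest n).eval (.ofVec (y t))) = _
  rw [Prog.eval_rest, Prog.eval_vecSum]
  rfl

/-- A problem with nonnegative bounds is feasible if and only if its relaxation has minimal slack
sum zero, and the relaxation comes with a feasible starting point. A negative upper bound excludes
feasibility at once. -/
theorem exists_feasibility_test (T : Matrix (Fin d) (Fin m) ℤ) (W : Matrix (Fin d) (Fin n) ℤ) :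
    ∃ (prog : Prog) (P : Polynomial ℕ), ∀ I : TwoStageData d m n,
      ∃ (out : Val) (t : ℕ), Runs Oracle.trivial prog I.encode out t ∧
        t ≤ P.eval I.encode.size ∧
        ((∃ z₀ : TwoStagePoint m n I.N, I.Feasible T W z₀ ∧ out = z₀.encode) ∨
          ((¬ ∃ z : TwoStagePoint m n I.N, I.Feasible T W z) ∧ out = Val.num 0)) := by
  classical
  obtain ⟨moves, hker, hmoves⟩ := exists_moves T (slackMatrix W) (0 : Matrix (Fin 1) (Fin m) ℤ)
    (slackRow n d)
  let K : Ctx (TwoStageData d m n) := ⟨fun I => I.encode.size, fun _ => Oracle.trivial⟩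
  have hI : PolySize K.len fun I : TwoStageData d m n => I.encode := PolyBdd.self
  obtain ⟨hN, hux, hsc, -, -⟩ := hI.scenarios
  -- The optimizer is run on this subfamily only, as otherwise the starting point would violate the
  -- bounds.
  let φ : {I : TwoStageData d m n // I.Nonneg} → TwoStageData d m n := Subtype.val
  have hrel := comp_relax (K := K.comap φ) (I := fun t => t.1) (hI.comap φ)
  obtain ⟨z', path, hopt, -, hcomp⟩ := comp_optimize (K := K.comap φ) (I := fun t => t.1.relax)
    (c := fun _ _ _ => slackCost n d) (F := fun _ _ _ r => r)
    (costProg_slack (d := d) (n := n) (K := K.comap φ) (N := fun t => t.1.N) (hN.comap φ)) hrel.polySize_out.left hker hmoves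
    (fun _ _ _ => convexOn_id convex_univ) (fun _ _ x y => slackCost_eq x y)
    (z := fun t => t.1.start) (fun t => TwoStageData.start_feasible t.2)
  have hrun := hrel.seq hcomp
  let out : TwoStageData d m n → Val := fun I => if h : I.Nonneg then
    if 0 < (z' ⟨I, h⟩).cost (fun _ _ => slackCost n d) then .num 0
    else (I.unrelax (z' ⟨I, h⟩)).encode else .num 0
  have hout : ∀ {I} (h : I.Nonneg), out I =
      if 0 < (z' ⟨I, h⟩).cost (fun _ _ => slackCost n d) then .num 0
      else (I.unrelax (z' ⟨I, h⟩)).encode := fun h => dif_pos h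
  have hout' : ∀ {I}, ¬ I.Nonneg → out I = .num 0 := fun h => dif_neg h
  have key : Comp K (feasibleProg m n d moves) (fun I => I.encode) out := by
    have hz : PolySize (K.comap φ).len fun t => (z' t).encode := hrun.polySize_out.left.right
    have htake : Comp (K.comap φ) (.pair .fst (.seq .snd (.map (.take n))))
        (fun t => (z' t).encode) fun t => (t.1.unrelax (z' t)).encode :=
      (Comp.sl (p := .fst) trivial hz fun _ => rfl).pair
        ((Comp.sl (p := .snd) trivial hz fun _ => rfl).seq
          (.map hz.right (.sl (by simp) (PolySize.get hz.right) fun x => Prog.eval_take _)))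
    have hpoint := (Comp.sl (p := .fst) trivial hrun.polySize_out fun _ => rfl).seq
      ((Comp.sl (p := .snd) trivial hrun.polySize_out.left fun _ => rfl).seq htake)
    have hmain : Comp (K.comap φ) _ (fun t => t.1.encode) fun t => out t.1 :=
      hrun.seq (.ite (a := fun t => .num ((z' t).cost fun _ _ => slackCost n d))
        (c := .seq .fst .fst) (p := .const (.num 0))
        (.sl ⟨trivial, trivial⟩ hrun.polySize_out fun _ => rfl)
        (.sl trivial (hrun.polySize_out.comap Subtype.val) fun t =>
          ((hout t.1.2).trans (if_pos t.2)).symm)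
        ((hpoint.comap Subtype.val).congr fun t => ((hout t.1.2).trans (if_neg t.2)).symm))
    have hpos : ∀ {I : TwoStageData d m n},
        0 < (∑ i, (1 - if InBox 0 (I.uy i) then 1 else 0) : ℤ) ↔ ∃ i, ¬ InBox 0 (I.uy i) := by
      intro I
      rw [Finset.sum_pos_iff_of_nonneg fun i _ => by split <;> simp]
      refine ⟨fun ⟨i, _, h⟩ => ⟨i, fun hi => by simp [hi] at h⟩,
        fun ⟨i, h⟩ => ⟨i, Finset.mem_univ i, by simp [h]⟩⟩
    have hbox : ∀ {I : TwoStageData d m n},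
        (0 : ℤ) < (if InBox 0 I.ux then 1 else 0) ↔ InBox 0 I.ux := by
      intro I
      split <;> simp [*]
    refine Comp.ite (a := fun I => .num (if InBox 0 I.ux then 1 else 0))
      (.sl (by simp [Prog.IsSL]) hI fun I => Prog.eval_inBox m _ _)
      (Comp.ite (a := fun t => .num (∑ i, (1 - if InBox 0 (t.1.uy i) then 1 else 0)))
        (.seq (.sl (p := .snd) trivial (hI.comap _) fun _ => rfl)
          (.sum (hsc.comap _) (.sl (by simp [Prog.IsSL]) (PolySize.get (hsc.comap _))
            fun x => ?_)))
        (.sl trivial ((hI.comap _).comap _) fun t => ?_) ?_)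
      (.sl trivial (hI.comap _) fun t => ?_)
    · simp only [Prog.eval, Val.snd, Prog.eval_inBox]
      rfl
    · exact (hout' fun (h : t.1.1.Nonneg) => h.2 (hpos.1 t.2)).symm
    · exact hmain.comap fun t : {s : {I // 0 < (if InBox 0 I.ux then 1 else 0 : ℤ)} //
        ¬ 0 < (∑ i, (1 - if InBox 0 (s.1.uy i) then 1 else 0) : ℤ)} =>
          ⟨t.1.1, hbox.1 t.1.2, fun h => t.2 (hpos.2 h)⟩
    · exact (hout' fun (h : t.1.Nonneg) => t.2 (hbox.2 h.1)).symm
  obtain ⟨P, hP⟩ := key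
  refine ⟨feasibleProg m n d moves, P, fun I => ?_⟩
  obtain ⟨t, ht, hr⟩ := hP I
  refine ⟨out I, t, hr, ht, ?_⟩
  by_cases h : I.Nonneg
  swap
  · exact .inr ⟨fun ⟨z, hz⟩ => h hz.nonneg, hout' h⟩
  by_cases h0 : 0 < (z' ⟨I, h⟩).cost (fun _ _ => slackCost n d)
  · refine .inr ⟨fun ⟨z, hz⟩ => ?_, (hout h).trans (if_pos h0)⟩
    -- A feasible point padded with zero slacks would have smaller cost than the computed optimum.
    obtain ⟨z'', hz'', hc''⟩ := TwoStageData.exists_relax_feasible hz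
    have h1 := (hopt ⟨I, h⟩).2 z'' hz''
    rw [cost_cast (c := fun _ _ => slackCost n d) fun _ x y => slackCost_eq x y,
      cost_cast (c := fun _ _ => slackCost n d) fun _ x y => slackCost_eq x y, Int.cast_le,
      hc''] at h1
    omega
  · exact .inl ⟨_, TwoStageData.unrelax_feasible (hopt ⟨I, h⟩).1 (not_lt.1 h0),
      (hout h).trans (if_neg h0)⟩

end Feasibility

theorem mainTheorem4 {d m n s : ℕ}
    (T : Matrix (Fin d) (Fin m) ℤ) (W : Matrix (Fin d) (Fin n) ℤ)
    (C : Matrix (Fin s) (Fin m) ℤ) (D : Matrix (Fin s) (Fin n) ℤ) :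
    -- (a) a feasible solution is found, or infeasibility is reported, in polynomial time
    (∃ (prog : Prog) (P : Polynomial ℕ), ∀ I : TwoStageData d m n,
      ∃ (out : Val) (t : ℕ), Runs Oracle.trivial prog I.encode out t ∧
        t ≤ P.eval I.encode.size ∧
        ((∃ z₀ : TwoStagePoint m n I.N, I.Feasible T W z₀ ∧ out = z₀.encode) ∨
          ((¬ ∃ z : TwoStagePoint m n I.N, I.Feasible T W z) ∧ out = Val.num 0))) ∧
    -- (b) every feasible solution is augmented to optimality in polynomial time
    (∃ prog : Prog, ∀ p q : Polynomial ℕ, ∃ P : Polynomial ℕ,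
      ∀ (I : TwoStageData d m n) (F : Fin I.N → Fin s → ℝ → ℝ) (O : Oracle) (L : ℕ)
        (z₀ : TwoStagePoint m n I.N),
        I.encode.size ≤ L →
        (∀ i j, ConvexOn ℝ Set.univ (F i j)) →
        (∀ i, Splittable p L (scenarioCost C D (F i))) →
        IsEvalOracle q L (fun i => scenarioCost C D (F i)) O →
        I.Feasible T W z₀ →
        ∃ (path : List (TwoStagePoint m n I.N)) (t : ℕ),
          AugmentsToOptimality T W I (fun i => scenarioCost C D (F i)) z₀ path ∧
          Runs O prog (.pair I.encode z₀.encode)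
            (.ofList (path.map TwoStagePoint.encode)) t ∧
          t ≤ P.eval L) := by
  refine ⟨exists_feasibility_test T W, ?_⟩
  obtain ⟨prog, hprog⟩ := exists_augmentation T W C D
  refine ⟨prog, fun _ q => ?_⟩
  obtain ⟨P, hP⟩ := hprog q
  exact ⟨P, fun I F O L z₀ hL hF _ hO hz => hP ⟨I, F, O, L, z₀, hL, hF, hO, hz⟩⟩
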